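/- **Languages.** GTT (gradual type theory) is a call-by-push-value calculus with value types $A ::= {?} \mid U\underline B \mid 0 \mid A+A \mid 1 \mid A\times A$ and computation types $\underline B ::= \underline{¿} \mid \underline F A \mid \top \mid \underline B \mathbin{\&} \underline B \mid A\to\underline B$, complex values $\Gamma\vdash V:A$, and terms $\Gamma\mid\Delta\vdash M:\underline B$, where the stoup $\Delta$ is empty (computations) or a single hole $\bullet:\underline B_0$ (complex stacks). Type dynamism $\sqsubseteq$ is the least reflexive, transitive relation on value types and on computation types that is a congruence for all (covariant) type constructors and satisfies $A\sqsubseteq{?}$ and $\underline B\sqsubseteq\underline{¿}$. Besides the introduction and elimination forms, terms contain an error $\mho$ at every computation type (with empty stoup), an upcast $\langle A'\leftarrowtail A\rangle V$ for each $A\sqsubseteq A'$ and a downcast $\langle\underline B\twoheadleftarrow\underline B'\rangle M$ for each $\underline B\sqsubseteq\underline B'$. A dynamism context $\Phi:\Gamma\sqsubseteq\Gamma'$ consists of $A_i\sqsubseteq A_i'$ for the variables $x_i:A_i$ of $\Gamma$ and the corresponding variables $x_i':A_i'$ of $\Gamma'$; $\Psi:\Delta\sqsubseteq\Delta'$ is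 empty if both stoups are empty, or is $\underline B_0\sqsubseteq\underline B_0'$ if $\Delta=\bullet:\underline B_0$ and $\Delta'=\bullet:\underline B_0'$. The heterogeneous term dynamism judgements $\Phi\vdash V\sqsubseteq V':A\sqsubseteq A'$ and $\Phi\mid\Psi\vdash M\sqsubseteq M':\underline B\sqsubseteq\underline B'$ (for $\Gamma\vdash V:A$, $\Gamma'\vdash V':A'$, $\Gamma\mid\Delta\vdash M:\underline B$, $\Gamma'\mid\Delta'\vdash M':\underline B'$) are generated by: reflexivity; transitivity; the rules for variables and for the hole; closure under substitution of values for a variable and of terms for the hole; congruence for each introduction and elimination form; for $A\sqsubseteq A'$, $x:A\sqsubseteq A$ implies $x\sqsubseteq\langle A'\leftarrowtail A\rangle x:A\sqsubseteq A'$, and $x\sqsubseteq x':A\sqsubseteq A'$ implies $\langle A'\leftarrowtail A\rangle x\sqsubseteq x':A'\sqsubseteq A'$; for $\underline B\sqsubseteq\underline B'$, dually, $\bullet:\underline B'\sqsubseteq\underline B'$ implies $\langle\underline B\twoheadleftarrow\underline B'\rangle\bullet\sqsubseteq\bullet:\underline B\sqsubseteq\underline B'$, and $\bullet\sqsubseteq\bullet:\underline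 B\sqsubseteq\underline B'$ implies $\bullet\sqsubseteq\langle\underline B\twoheadleftarrow\underline B'\rangle\bullet:\underline B\sqsubseteq\underline B$; the retract axioms $\langle\underline F A\twoheadleftarrow\underline F{?}\rangle(\mathrm{ret}\,\langle{?}\leftarrowtail A\rangle x)\sqsubseteq\mathrm{ret}\,x$ and $\langle\underline B\twoheadleftarrow\underline{¿}\rangle(\mathrm{force}\,\langle U\underline{¿}\leftarrowtail U\underline B\rangle x)\sqsubseteq\mathrm{force}\,x$; the $\beta$ and $\eta$ laws of all connectives, as inequalities in both directions; $\mho\sqsubseteq M':\underline B\sqsubseteq\underline B'$ for all $M'$ with empty stoup; and $S[\mho]\sqsubseteq\mho$ for every stack $S$. CBPV* is the same calculus without ${?}$, $\underline{¿}$ and casts, and with recursive value types $\mu X.A$ and corecursive computation types $\nu\underline Y.\underline B$ (with roll/unroll forms) instead. Its inequational theory $\Gamma\mid\Delta\vdash E\sqsubseteq E':T$ is homogeneous (both sides have the same contexts and the same type), and is generated by reflexivity, transitivity, closure under both substitutions, congruence, the $\beta$ and $\eta$ laws (those of $\mu$ and $\nu$ included), $\mho\sqsubseteq M$ and $S[\mho]\sqsubseteq\mho$.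 Write $\equiv$ for $\sqsubseteq$ in both directions. **Dynamic type interpretations.** In CBPV*, a value ep pair from $A$ to $A'$ consists of a value $x:A\vdash V_e:A'$ and a stack $\bullet:\underline F A'\vdash S_p:\underline F A$ with $\mathrm{ret}\,x\equiv S_p[\mathrm{ret}\,V_e]$ and $\mathrm{bind}\ x\leftarrow S_p;\ \mathrm{ret}\,V_e\sqsubseteq\bullet$. A computation ep pair from $\underline B$ to $\underline B'$ consists of $z:U\underline B\vdash V_e:U\underline B'$ and $\bullet:\underline B'\vdash S_p:\underline B$ with $\mathrm{force}\,z\equiv S_p[\mathrm{force}\,V_e]$ and $V_e[\mathrm{thunk}\,S_p[\mathrm{force}\,w]/z]\sqsubseteq w$ for $w:U\underline B'$. A dynamic type interpretation $\rho$ consists of a closed value type $\rho({?})$ and a closed computation type $\rho(\underline{¿})$ of CBPV*, a value ep pair from $\llbracket G\rrbracket$ to $\rho({?})$ for each $G\in\{1,\ {?}\times{?},\ {?}+{?},\ U\underline{¿}\}$, and a computation ep pair from $\llbracket\underline G\rrbracket$ to $\rho(\underline{¿})$ for each $\underline G\in\{{?}\to\underline{¿},\ \underline{¿}\mathbin{\&}\underline{¿},\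 \underline F{?}\}$. Here $\llbracket\cdot\rrbracket$ on types replaces ${?}$ by $\rho({?})$ and $\underline{¿}$ by $\rho(\underline{¿})$, and is homomorphic otherwise; $\llbracket\Gamma\rrbracket$ and $\llbracket\Delta\rrbracket$ are defined pointwise. **Contract translation.** For $A\sqsubseteq A'$, define in CBPV* the upcast $x:\llbracket A\rrbracket\vdash\llbracket A'\leftarrowtail A\rrbracket:\llbracket A'\rrbracket$ and the downcast $\bullet:\llbracket\underline F A'\rrbracket\vdash\llbracket\underline F A\twoheadleftarrow\underline F A'\rrbracket:\llbracket\underline F A\rrbracket$; for $\underline B\sqsubseteq\underline B'$, define the downcast $\bullet:\llbracket\underline B'\rrbracket\vdash\llbracket\underline B\twoheadleftarrow\underline B'\rrbracket:\llbracket\underline B\rrbracket$ and the upcast $x:\llbracket U\underline B\rrbracket\vdash\llbracket U\underline B'\leftarrowtail U\underline B\rrbracket:\llbracket U\underline B'\rrbracket$. Abbreviate these up/down pairs by $c_{A,A'}$ and $c_{\underline B,\underline B'}$. They are defined by recursion on types, the first clause that applies being used: - $c_{0,A'}$ has upcast $\mathrm{abort}\,x$ and downcast $\mathrm{bind}\ x\leftarrow\bullet;\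 \mho$; $c_{\top,\underline B'}$ has upcast $\mathrm{thunk}\,\mho$ and downcast $\{\}$; - $c_{{?},{?}}$, $c_{\underline{¿},\underline{¿}}$ and $c_{1,1}$ are identities; - for the types $G$, $\underline G$ listed above, $c_{G,{?}}$ and $c_{\underline G,\underline{¿}}$ are the ep pairs of $\rho$; - otherwise, $c_{A,{?}}$ is the composite of $c_{A,G}$ and $c_{G,{?}}$, where $G$ is the listed type with the same outermost connective as $A$; likewise $c_{\underline B,\underline{¿}}$ is the composite of $c_{\underline B,\underline G}$ and $c_{\underline G,\underline{¿}}$; - $c_{A_1+A_2,A_1'+A_2'}$ and $c_{A_1\times A_2,A_1'\times A_2'}$ apply the component upcasts to the components; their downcasts bind the result of $\bullet$, take it apart, run the component downcasts on the returned components (first component first) and return the reassembled value; - $c_{U\underline B,U\underline B'}$ has the upcast of $c_{\underline B,\underline B'}$, and downcast $\mathrm{bind}\ x\leftarrow\bullet;\ \mathrm{ret}\,\mathrm{thunk}\,\llbracket\underline B\twoheadleftarrow\underline B'\rrbracket[\mathrm{force}\,x]$; - $c_{\underline F A,\underline F A'}$ has the downcast of $c_{A,A'}$, and upcast $\mathrm{thunk}\,(\mathrm{bind}\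 y\leftarrow\mathrm{force}\,x;\ \mathrm{ret}\,\llbracket A'\leftarrowtail A\rrbracket[y])$; - $c_{A\to\underline B,A'\to\underline B'}$ has downcast $\lambda y.\,\llbracket\underline B\twoheadleftarrow\underline B'\rrbracket[\bullet\,(\llbracket A'\leftarrowtail A\rrbracket[y])]$ and upcast $\mathrm{thunk}\,\lambda y'.\,\mathrm{bind}\ y\leftarrow\llbracket\underline F A\twoheadleftarrow\underline F A'\rrbracket[\mathrm{ret}\,y'];\ \mathrm{force}\,\llbracket U\underline B'\leftarrowtail U\underline B\rrbracket[\mathrm{thunk}((\mathrm{force}\,x)\,y)]$; - $c_{\underline B_1\mathbin{\&}\underline B_2,\underline B_1'\mathbin{\&}\underline B_2'}$ acts componentwise: its downcast has the components $\llbracket\underline B_i\twoheadleftarrow\underline B_i'\rrbracket[\pi_i\bullet]$, and its upcast is the thunk of the pair with components $\mathrm{force}\,\llbracket U\underline B_i'\leftarrowtail U\underline B_i\rrbracket[\mathrm{thunk}\,\pi_i\,\mathrm{force}\,x]$. On terms, $\llbracket\langle A'\leftarrowtail A\rangle V\rrbracket=\llbracket A'\leftarrowtail A\rrbracket[\llbracket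 V\rrbracket]$, $\llbracket\langle\underline B\twoheadleftarrow\underline B'\rangle M\rrbracket=\llbracket\underline B\twoheadleftarrow\underline B'\rrbracket[\llbracket M\rrbracket]$, and $\llbracket\cdot\rrbracket$ is homomorphic on all other forms. For $\Phi:\Gamma\sqsubseteq\Gamma'$, let $\llbracket\Phi\rrbracket$ be the substitution of $\llbracket A_i'\leftarrowtail A_i\rrbracket[x_i]$ for $x_i'$. For $\Psi:\Delta\sqsubseteq\Delta'$, let $M[\llbracket\Psi\rrbracket]=M$ if the stoups are empty, and $M[\llbracket\Psi\rrbracket]=M[\llbracket\underline B_0\twoheadleftarrow\underline B_0'\rrbracket/\bullet]$ if $\Psi$ is $\underline B_0\sqsubseteq\underline B_0'$. **Theorem (Axiomatic Graduality).** For every dynamic type interpretation, and all $\Phi:\Gamma\sqsubseteq\Gamma'$ and $\Psi:\Delta\sqsubseteq\Delta'$, the following hold in CBPV*. 1. If $\Phi\mid\Psi\vdash M\sqsubseteq M':\underline B\sqsubseteq\underline B'$ is derivable in GTT, then $$\llbracket\Gamma\rrbracket\mid\llbracket\Delta'\rrbracket\vdash\llbracket M\rrbracket[\llbracket\Psi\rrbracket]\sqsubseteq\llbracket\underline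 B\twoheadleftarrow\underline B'\rrbracket\big[\llbracket M'\rrbracket[\llbracket\Phi\rrbracket]\big]:\llbracket\underline B\rrbracket.$$ 2. If $\Phi\vdash V\sqsubseteq V':A\sqsubseteq A'$ is derivable in GTT, then $$\llbracket\Gamma\rrbracket\vdash\llbracket A'\leftarrowtail A\rrbracket[\llbracket V\rrbracket]\sqsubseteq\llbracket V'\rrbracket[\llbracket\Phi\rrbracket]:\llbracket A'\rrbracket.$$ -/

import Mathlib

namespace Gradual

/-! ## Kinds, variables, renamings (shared by the two languages) -/

/-- The two kinds of types: value types and computation types. -/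
inductive Kind : Type
  | val
  | comp

/-- De Bruijn variables. Contexts are lists with the most recent entry first, so the
context `Γ, x : A, Γ'` is the list `Γ' ++ A :: Γ`. -/
inductive Var {α : Type} : List α → α → Type
  | z {Γ : List α} {a : α} : Var (a :: Γ) a
  | s {Γ : List α} {a b : α} : Var Γ a → Var (b :: Γ) a

/-- The variable `x` of the context `Γ, x : A, Γ'` (with `Γ'` written `Ξ`). -/
def Var.at {α : Type} {Γ : List α} {a : α} : (Ξ : List α) → Var (Ξ ++ a :: Γ) a
  | [] => .z
  | _ :: Ξ => .s (Var.at Ξ)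

def Var.map {α β : Type} (f : α → β) : {Γ : List α} → {a : α} → Var Γ a → Var (Γ.map f) (f a)
  | _, _, .z => .z
  | _, _, .s x => .s (x.map f)

abbrev Ren {α : Type} (Γ Γ' : List α) : Type := ∀ a : α, Var Γ a → Var Γ' a

def Ren.lift {α : Type} {Γ Γ' : List α} {b : α} (r : Ren Γ Γ') : Ren (b :: Γ) (b :: Γ')
  | _, .z => .z
  | _, .s x => .s (r _ x)

def Ren.wk {α : Type} {Γ : List α} {b : α} : Ren Γ (b :: Γ) := fun _ x => .s x

/-- The renaming out of the empty context. -/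
def Ren.nil {α : Type} {Γ : List α} : Ren [] Γ := fun _ x => nomatch x

/-! ## CBPV*: call-by-push-value with complex values, complex stacks and recursive types -/

namespace CBPV

/-- Value and computation types in a context of type variables. -/
inductive Ty : List Kind → Kind → Type
  | var {Θ : List Kind} {k : Kind} : Var Θ k → Ty Θ k
  | U {Θ : List Kind} : Ty Θ .comp → Ty Θ .val
  | zero {Θ : List Kind} : Ty Θ .val
  | sum {Θ : List Kind} : Ty Θ .val → Ty Θ .val → Ty Θ .val
  | one {Θ : List Kind} : Ty Θ .val
  | prod {Θ : List Kind} : Ty Θ .val → Ty Θ .val → Ty Θ .val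
  | mu {Θ : List Kind} : Ty (.val :: Θ) .val → Ty Θ .val
  | F {Θ : List Kind} : Ty Θ .val → Ty Θ .comp
  | top {Θ : List Kind} : Ty Θ .comp
  | amp {Θ : List Kind} : Ty Θ .comp → Ty Θ .comp → Ty Θ .comp
  | arr {Θ : List Kind} : Ty Θ .val → Ty Θ .comp → Ty Θ .comp
  | nu {Θ : List Kind} : Ty (.comp :: Θ) .comp → Ty Θ .comp

def Ty.ren : {Θ Θ' : List Kind} → {k : Kind} → Ty Θ k → Ren Θ Θ' → Ty Θ' k
  | _, _, _, .var x, r => .var (r _ x)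
  | _, _, _, .U B, r => .U (B.ren r)
  | _, _, _, .zero, _ => .zero
  | _, _, _, .sum A₁ A₂, r => .sum (A₁.ren r) (A₂.ren r)
  | _, _, _, .one, _ => .one
  | _, _, _, .prod A₁ A₂, r => .prod (A₁.ren r) (A₂.ren r)
  | _, _, _, .mu A, r => .mu (A.ren r.lift)
  | _, _, _, .F A, r => .F (A.ren r)
  | _, _, _, .top, _ => .top
  | _, _, _, .amp B₁ B₂, r => .amp (B₁.ren r) (B₂.ren r)
  | _, _, _, .arr A B, r => .arr (A.ren r) (B.ren r)
  | _, _, _, .nu B, r => .nu (B.ren r.lift)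

abbrev TySub (Θ Θ' : List Kind) : Type := ∀ k : Kind, Var Θ k → Ty Θ' k

def TySub.lift {Θ Θ' : List Kind} {j : Kind} (σ : TySub Θ Θ') : TySub (j :: Θ) (j :: Θ')
  | _, .z => .var .z
  | _, .s x => (σ _ x).ren Ren.wk

def TySub.single {Θ : List Kind} {j : Kind} (T : Ty Θ j) : TySub (j :: Θ) Θ
  | _, .z => T
  | _, .s x => .var x

def Ty.subst : {Θ Θ' : List Kind} → {k : Kind} → Ty Θ k → TySub Θ Θ' → Ty Θ' k
  | _, _, _, .var x, σ => σ _ x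
  | _, _, _, .U B, σ => .U (B.subst σ)
  | _, _, _, .zero, _ => .zero
  | _, _, _, .sum A₁ A₂, σ => .sum (A₁.subst σ) (A₂.subst σ)
  | _, _, _, .one, _ => .one
  | _, _, _, .prod A₁ A₂, σ => .prod (A₁.subst σ) (A₂.subst σ)
  | _, _, _, .mu A, σ => .mu (A.subst σ.lift)
  | _, _, _, .F A, σ => .F (A.subst σ)
  | _, _, _, .top, _ => .top
  | _, _, _, .amp B₁ B₂, σ => .amp (B₁.subst σ) (B₂.subst σ)
  | _, _, _, .arr A B, σ => .arr (A.subst σ) (B.subst σ)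
  | _, _, _, .nu B, σ => .nu (B.subst σ.lift)

/-- `T[S/X]`. -/
def Ty.inst {Θ : List Kind} {j k : Kind} (T : Ty (j :: Θ) k) (S : Ty Θ j) : Ty Θ k :=
  T.subst (TySub.single S)

/-- Closed value types. -/
abbrev VTy : Type := Ty [] .val
/-- Closed computation types. -/
abbrev CTy : Type := Ty [] .comp
abbrev Ctx : Type := List VTy
/-- A stoup `Δ`: empty, or a single hole `• : B`. -/
abbrev Stoup : Type := Option CTy

/-- What stands around `E` in the judgement `Γ | Δ ⊢ E : T`: it is either a value judgement
`Γ ⊢ V : A` (which has no stoup) or a computation judgement `Γ | Δ ⊢ M : B`. -/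
inductive Goal : Type
  | val (A : VTy)
  | comp (Δ : Stoup) (B : CTy)

/-- Typing derivations of CBPV*: `Tm Γ (.val A)` are the complex values `Γ ⊢ V : A`,
`Tm Γ (.comp none B)` the computations `Γ | · ⊢ M : B`, and `Tm Γ (.comp (some B) B')` the
complex stacks `Γ | • : B ⊢ S : B'`. -/
inductive Tm : Ctx → Goal → Type
  | var {Γ : Ctx} {A : VTy} : Var Γ A → Tm Γ (.val A)
  | hole {Γ : Ctx} {B : CTy} : Tm Γ (.comp (some B) B)
  | err {Γ : Ctx} {B : CTy} : Tm Γ (.comp none B)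
  | abort {Γ : Ctx} {g : Goal} : Tm Γ (.val .zero) → Tm Γ g
  | inl {Γ : Ctx} {A₁ A₂ : VTy} : Tm Γ (.val A₁) → Tm Γ (.val (.sum A₁ A₂))
  | inr {Γ : Ctx} {A₁ A₂ : VTy} : Tm Γ (.val A₂) → Tm Γ (.val (.sum A₁ A₂))
  | caseOf {Γ : Ctx} {A₁ A₂ : VTy} {g : Goal} :
      Tm Γ (.val (.sum A₁ A₂)) → Tm (A₁ :: Γ) g → Tm (A₂ :: Γ) g → Tm Γ g
  | unit {Γ : Ctx} : Tm Γ (.val .one)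
  | letUnit {Γ : Ctx} {g : Goal} : Tm Γ (.val .one) → Tm Γ g → Tm Γ g
  | pair {Γ : Ctx} {A₁ A₂ : VTy} :
      Tm Γ (.val A₁) → Tm Γ (.val A₂) → Tm Γ (.val (.prod A₁ A₂))
  | letPair {Γ : Ctx} {A₁ A₂ : VTy} {g : Goal} :
      Tm Γ (.val (.prod A₁ A₂)) → Tm (A₂ :: A₁ :: Γ) g → Tm Γ g
  | thunk {Γ : Ctx} {B : CTy} : Tm Γ (.comp none B) → Tm Γ (.val (.U B))
  | force {Γ : Ctx} {B : CTy} : Tm Γ (.val (.U B)) → Tm Γ (.comp none B)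
  | ret {Γ : Ctx} {A : VTy} : Tm Γ (.val A) → Tm Γ (.comp none (.F A))
  | bind {Γ : Ctx} {Δ : Stoup} {A : VTy} {B : CTy} :
      Tm Γ (.comp Δ (.F A)) → Tm (A :: Γ) (.comp none B) → Tm Γ (.comp Δ B)
  | lam {Γ : Ctx} {Δ : Stoup} {A : VTy} {B : CTy} :
      Tm (A :: Γ) (.comp Δ B) → Tm Γ (.comp Δ (.arr A B))
  | app {Γ : Ctx} {Δ : Stoup} {A : VTy} {B : CTy} :
      Tm Γ (.comp Δ (.arr A B)) → Tm Γ (.val A) → Tm Γ (.comp Δ B)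
  | topI {Γ : Ctx} {Δ : Stoup} : Tm Γ (.comp Δ .top)
  | ampI {Γ : Ctx} {Δ : Stoup} {B₁ B₂ : CTy} :
      Tm Γ (.comp Δ B₁) → Tm Γ (.comp Δ B₂) → Tm Γ (.comp Δ (.amp B₁ B₂))
  | fst {Γ : Ctx} {Δ : Stoup} {B₁ B₂ : CTy} :
      Tm Γ (.comp Δ (.amp B₁ B₂)) → Tm Γ (.comp Δ B₁)
  | snd {Γ : Ctx} {Δ : Stoup} {B₁ B₂ : CTy} :
      Tm Γ (.comp Δ (.amp B₁ B₂)) → Tm Γ (.comp Δ B₂)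
  | roll {Γ : Ctx} {A : Ty [.val] .val} : Tm Γ (.val (A.inst (.mu A))) → Tm Γ (.val (.mu A))
  | letRoll {Γ : Ctx} {A : Ty [.val] .val} {g : Goal} :
      Tm Γ (.val (.mu A)) → Tm (A.inst (.mu A) :: Γ) g → Tm Γ g
  | rollC {Γ : Ctx} {Δ : Stoup} {B : Ty [.comp] .comp} :
      Tm Γ (.comp Δ (B.inst (.nu B))) → Tm Γ (.comp Δ (.nu B))
  | unroll {Γ : Ctx} {Δ : Stoup} {B : Ty [.comp] .comp} :
      Tm Γ (.comp Δ (.nu B)) → Tm Γ (.comp Δ (B.inst (.nu B)))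

def Tm.ren : {Γ Γ' : Ctx} → {g : Goal} → Tm Γ g → Ren Γ Γ' → Tm Γ' g
  | _, _, _, .var x, r => .var (r _ x)
  | _, _, _, .hole, _ => .hole
  | _, _, _, .err, _ => .err
  | _, _, _, .abort V, r => .abort (V.ren r)
  | _, _, _, .inl V, r => .inl (V.ren r)
  | _, _, _, .inr V, r => .inr (V.ren r)
  | _, _, _, .caseOf V E₁ E₂, r => .caseOf (V.ren r) (E₁.ren r.lift) (E₂.ren r.lift)
  | _, _, _, .unit, _ => .unit
  | _, _, _, .letUnit V E, r => .letUnit (V.ren r) (E.ren r)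
  | _, _, _, .pair V W, r => .pair (V.ren r) (W.ren r)
  | _, _, _, .letPair V E, r => .letPair (V.ren r) (E.ren r.lift.lift)
  | _, _, _, .thunk M, r => .thunk (M.ren r)
  | _, _, _, .force V, r => .force (V.ren r)
  | _, _, _, .ret V, r => .ret (V.ren r)
  | _, _, _, .bind M N, r => .bind (M.ren r) (N.ren r.lift)
  | _, _, _, .lam M, r => .lam (M.ren r.lift)
  | _, _, _, .app M V, r => .app (M.ren r) (V.ren r)
  | _, _, _, .topI, _ => .topI
  | _, _, _, .ampI M N, r => .ampI (M.ren r) (N.ren r)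
  | _, _, _, .fst M, r => .fst (M.ren r)
  | _, _, _, .snd M, r => .snd (M.ren r)
  | _, _, _, .roll V, r => .roll (V.ren r)
  | _, _, _, .letRoll V E, r => .letRoll (V.ren r) (E.ren r.lift)
  | _, _, _, .rollC M, r => .rollC (M.ren r)
  | _, _, _, .unroll M, r => .unroll (M.ren r)

def Tm.wk {Γ : Ctx} {g : Goal} {A : VTy} (E : Tm Γ g) : Tm (A :: Γ) g := E.ren Ren.wk

/-- Substitutions of values for the variables of `Γ`, with values over `Γ'`. -/
abbrev Sub (Γ Γ' : Ctx) : Type := ∀ A : VTy, Var Γ A → Tm Γ' (.val A)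

def Sub.lift {Γ Γ' : Ctx} {A : VTy} (σ : Sub Γ Γ') : Sub (A :: Γ) (A :: Γ')
  | _, .z => .var .z
  | _, .s x => (σ _ x).wk

/-- `σ` extended by `V` for the most recent variable. -/
def Sub.cons {Γ Γ' : Ctx} {A : VTy} (V : Tm Γ' (.val A)) (σ : Sub Γ Γ') : Sub (A :: Γ) Γ'
  | _, .z => V
  | _, .s x => σ _ x

def Sub.id {Γ : Ctx} : Sub Γ Γ := fun _ x => .var x

/-- The substitution `[V/x]` from `Γ, x : A, Γ'` to `Γ, Γ'` (with `Γ'` written `Ξ`). -/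
def Sub.at {Γ : Ctx} {A : VTy} (V : Tm Γ (.val A)) : (Ξ : Ctx) → Sub (Ξ ++ A :: Γ) (Ξ ++ Γ)
  | [] => Sub.cons V Sub.id
  | _ :: Ξ => (Sub.at V Ξ).lift

def Tm.subst : {Γ Γ' : Ctx} → {g : Goal} → Tm Γ g → Sub Γ Γ' → Tm Γ' g
  | _, _, _, .var x, σ => σ _ x
  | _, _, _, .hole, _ => .hole
  | _, _, _, .err, _ => .err
  | _, _, _, .abort V, σ => .abort (V.subst σ)
  | _, _, _, .inl V, σ => .inl (V.subst σ)
  | _, _, _, .inr V, σ => .inr (V.subst σ)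
  | _, _, _, .caseOf V E₁ E₂, σ => .caseOf (V.subst σ) (E₁.subst σ.lift) (E₂.subst σ.lift)
  | _, _, _, .unit, _ => .unit
  | _, _, _, .letUnit V E, σ => .letUnit (V.subst σ) (E.subst σ)
  | _, _, _, .pair V W, σ => .pair (V.subst σ) (W.subst σ)
  | _, _, _, .letPair V E, σ => .letPair (V.subst σ) (E.subst σ.lift.lift)
  | _, _, _, .thunk M, σ => .thunk (M.subst σ)
  | _, _, _, .force V, σ => .force (V.subst σ)
  | _, _, _, .ret V, σ => .ret (V.subst σ)
  | _, _, _, .bind M N, σ => .bind (M.subst σ) (N.subst σ.lift)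
  | _, _, _, .lam M, σ => .lam (M.subst σ.lift)
  | _, _, _, .app M V, σ => .app (M.subst σ) (V.subst σ)
  | _, _, _, .topI, _ => .topI
  | _, _, _, .ampI M N, σ => .ampI (M.subst σ) (N.subst σ)
  | _, _, _, .fst M, σ => .fst (M.subst σ)
  | _, _, _, .snd M, σ => .snd (M.subst σ)
  | _, _, _, .roll V, σ => .roll (V.subst σ)
  | _, _, _, .letRoll V E, σ => .letRoll (V.subst σ) (E.subst σ.lift)
  | _, _, _, .rollC M, σ => .rollC (M.subst σ)
  | _, _, _, .unroll M, σ => .unroll (M.subst σ)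

/-- Substitution of `N` for the hole; see `Tm.fill`. -/
def Tm.plug {B₁ : CTy} {Δ : Stoup} : {Γ : Ctx} → {g : Goal} → Tm Γ g → {B₂ : CTy} →
    g = .comp (some B₁) B₂ → Tm Γ (.comp Δ B₁) → Tm Γ (.comp Δ B₂)
  | _, _, .hole, _, rfl, N => N
  | _, _, .abort V, _, rfl, _ => .abort V
  | _, _, .caseOf V E₁ E₂, _, rfl, N => .caseOf V (E₁.plug rfl N.wk) (E₂.plug rfl N.wk)
  | _, _, .letUnit V E, _, rfl, N => .letUnit V (E.plug rfl N)
  | _, _, .letPair V E, _, rfl, N => .letPair V (E.plug rfl N.wk.wk)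
  | _, _, .bind M L, _, rfl, N => .bind (M.plug rfl N) L
  | _, _, .lam M, _, rfl, N => .lam (M.plug rfl N.wk)
  | _, _, .app M V, _, rfl, N => .app (M.plug rfl N) V
  | _, _, .topI, _, rfl, _ => .topI
  | _, _, .ampI M L, _, rfl, N => .ampI (M.plug rfl N) (L.plug rfl N)
  | _, _, .fst M, _, rfl, N => .fst (M.plug rfl N)
  | _, _, .snd M, _, rfl, N => .snd (M.plug rfl N)
  | _, _, .letRoll V E, _, rfl, N => .letRoll V (E.plug rfl N.wk)
  | _, _, .rollC M, _, rfl, N => .rollC (M.plug rfl N)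
  | _, _, .unroll M, _, rfl, N => .unroll (M.plug rfl N)

/-- `S[N/•]`. -/
def Tm.fill {Γ : Ctx} {Δ : Stoup} {B₁ B₂ : CTy} (S : Tm Γ (.comp (some B₁) B₂))
    (N : Tm Γ (.comp Δ B₁)) : Tm Γ (.comp Δ B₂) := S.plug rfl N

/-- `V[W/x]` for `x : A ⊢ V : A'` and `Γ ⊢ W : A`. -/
def Tm.put {Γ : Ctx} {A A' : VTy} (V : Tm [A] (.val A')) (W : Tm Γ (.val A)) :
    Tm Γ (.val A') := V.subst (Sub.cons W fun _ x => nomatch x)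

/-- `S[N/•]` for `• : B₁ ⊢ S : B₂` and `Γ | Δ ⊢ N : B₁`. -/
def Tm.on {Γ : Ctx} {Δ : Stoup} {B₁ B₂ : CTy} (S : Tm [] (.comp (some B₁) B₂))
    (N : Tm Γ (.comp Δ B₁)) : Tm Γ (.comp Δ B₂) := (S.ren Ren.nil).fill N

/-- The `β` and `η` equations of CBPV*. -/
inductive BetaEta : {Γ : Ctx} → {g : Goal} → Tm Γ g → Tm Γ g → Prop
  | sumBetaL {Γ : Ctx} {A₁ A₂ : VTy} {g : Goal} (V : Tm Γ (.val A₁))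
      (E₁ : Tm (A₁ :: Γ) g) (E₂ : Tm (A₂ :: Γ) g) :
      BetaEta (.caseOf (.inl V) E₁ E₂) (E₁.subst (Sub.cons V Sub.id))
  | sumBetaR {Γ : Ctx} {A₁ A₂ : VTy} {g : Goal} (V : Tm Γ (.val A₂))
      (E₁ : Tm (A₁ :: Γ) g) (E₂ : Tm (A₂ :: Γ) g) :
      BetaEta (.caseOf (.inr V) E₁ E₂) (E₂.subst (Sub.cons V Sub.id))
  | sumEta {Γ : Ctx} {A₁ A₂ : VTy} {g : Goal} (E : Tm (.sum A₁ A₂ :: Γ) g) :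
      BetaEta E (.caseOf (.var .z)
        (E.subst (Sub.cons (.inl (.var .z)) fun _ x => .var (.s (.s x))))
        (E.subst (Sub.cons (.inr (.var .z)) fun _ x => .var (.s (.s x)))))
  | zeroEta {Γ : Ctx} {g : Goal} (E : Tm (.zero :: Γ) g) : BetaEta E (.abort (.var .z))
  | prodBeta {Γ : Ctx} {A₁ A₂ : VTy} {g : Goal} (V₁ : Tm Γ (.val A₁)) (V₂ : Tm Γ (.val A₂))
      (E : Tm (A₂ :: A₁ :: Γ) g) :
      BetaEta (.letPair (.pair V₁ V₂) E) (E.subst (Sub.cons V₂ (Sub.cons V₁ Sub.id)))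
  | prodEta {Γ : Ctx} {A₁ A₂ : VTy} {g : Goal} (E : Tm (.prod A₁ A₂ :: Γ) g) :
      BetaEta E (.letPair (.var .z)
        (E.subst (Sub.cons (.pair (.var (.s .z)) (.var .z)) fun _ x => .var (.s (.s (.s x))))))
  | oneBeta {Γ : Ctx} {g : Goal} (E : Tm Γ g) : BetaEta (.letUnit .unit E) E
  | oneEta {Γ : Ctx} {g : Goal} (E : Tm (.one :: Γ) g) :
      BetaEta E (.letUnit (.var .z) (E.subst (Sub.cons .unit fun _ x => .var (.s x))))
  | UBeta {Γ : Ctx} {B : CTy} (M : Tm Γ (.comp none B)) : BetaEta (.force (.thunk M)) M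
  | UEta {Γ : Ctx} {B : CTy} :
      BetaEta (Γ := .U B :: Γ) (.var .z) (.thunk (.force (.var .z)))
  | FBeta {Γ : Ctx} {A : VTy} {B : CTy} (V : Tm Γ (.val A)) (M : Tm (A :: Γ) (.comp none B)) :
      BetaEta (.bind (.ret V) M) (M.subst (Sub.cons V Sub.id))
  | FEta {Γ : Ctx} {A : VTy} {B : CTy} (M : Tm Γ (.comp (some (.F A)) B)) :
      BetaEta M (.bind .hole (M.wk.fill (.ret (.var .z))))
  | arrBeta {Γ : Ctx} {Δ : Stoup} {A : VTy} {B : CTy} (M : Tm (A :: Γ) (.comp Δ B))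
      (V : Tm Γ (.val A)) :
      BetaEta (.app (.lam M) V) (M.subst (Sub.cons V Sub.id))
  | arrEta {Γ : Ctx} {A : VTy} {B : CTy} :
      BetaEta (Γ := Γ) (g := .comp (some (.arr A B)) (.arr A B))
        .hole (.lam (.app .hole (.var .z)))
  | ampBetaL {Γ : Ctx} {Δ : Stoup} {B₁ B₂ : CTy} (M₁ : Tm Γ (.comp Δ B₁))
      (M₂ : Tm Γ (.comp Δ B₂)) : BetaEta (.fst (.ampI M₁ M₂)) M₁
  | ampBetaR {Γ : Ctx} {Δ : Stoup} {B₁ B₂ : CTy} (M₁ : Tm Γ (.comp Δ B₁))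
      (M₂ : Tm Γ (.comp Δ B₂)) : BetaEta (.snd (.ampI M₁ M₂)) M₂
  | ampEta {Γ : Ctx} {B₁ B₂ : CTy} :
      BetaEta (Γ := Γ) (g := .comp (some (.amp B₁ B₂)) (.amp B₁ B₂))
        .hole (.ampI (.fst .hole) (.snd .hole))
  | topEta {Γ : Ctx} : BetaEta (Γ := Γ) (g := .comp (some .top) .top) .hole .topI
  | muBeta {Γ : Ctx} {A : Ty [.val] .val} {g : Goal} (V : Tm Γ (.val (A.inst (.mu A))))
      (E : Tm (A.inst (.mu A) :: Γ) g) :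
      BetaEta (.letRoll (.roll V) E) (E.subst (Sub.cons V Sub.id))
  | muEta {Γ : Ctx} {A : Ty [.val] .val} {g : Goal} (E : Tm (.mu A :: Γ) g) :
      BetaEta E (.letRoll (.var .z)
        (E.subst (Sub.cons (.roll (.var .z)) fun _ x => .var (.s (.s x)))))
  | nuBeta {Γ : Ctx} {Δ : Stoup} {B : Ty [.comp] .comp}
      (M : Tm Γ (.comp Δ (B.inst (.nu B)))) : BetaEta (.unroll (.rollC M)) M
  | nuEta {Γ : Ctx} {B : Ty [.comp] .comp} :
      BetaEta (Γ := Γ) (g := .comp (some (.nu B)) (.nu B)) .hole (.rollC (.unroll .hole))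

/-- The homogeneous inequational theory `Γ | Δ ⊢ E ⊑ E' : T` of CBPV*. (The rules for variables,
the hole, `()` and `{}` are instances of reflexivity.) -/
inductive Le : {Γ : Ctx} → {g : Goal} → Tm Γ g → Tm Γ g → Prop
  | refl {Γ : Ctx} {g : Goal} (E : Tm Γ g) : Le E E
  | trans {Γ : Ctx} {g : Goal} {E E' E'' : Tm Γ g} : Le E E' → Le E' E'' → Le E E''
  | valSubst {Γ Ξ : Ctx} {A : VTy} {g : Goal} {V V' : Tm Γ (.val A)}
      {E E' : Tm (Ξ ++ A :: Γ) g} :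
      Le V V' → Le E E' → Le (E.subst (Sub.at V Ξ)) (E'.subst (Sub.at V' Ξ))
  | stkSubst {Γ : Ctx} {Δ : Stoup} {B₁ B₂ : CTy} {M₁ M₁' : Tm Γ (.comp Δ B₁)}
      {M₂ M₂' : Tm Γ (.comp (some B₁) B₂)} :
      Le M₁ M₁' → Le M₂ M₂' → Le (M₂.fill M₁) (M₂'.fill M₁')
  | abort {Γ : Ctx} {g : Goal} {V V' : Tm Γ (.val .zero)} :
      Le V V' → Le (g := g) (.abort V) (.abort V')
  | inl {Γ : Ctx} {A₁ A₂ : VTy} {V V' : Tm Γ (.val A₁)} :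
      Le V V' → Le (g := .val (.sum A₁ A₂)) (.inl V) (.inl V')
  | inr {Γ : Ctx} {A₁ A₂ : VTy} {V V' : Tm Γ (.val A₂)} :
      Le V V' → Le (g := .val (.sum A₁ A₂)) (.inr V) (.inr V')
  | caseOf {Γ : Ctx} {A₁ A₂ : VTy} {g : Goal} {V V' : Tm Γ (.val (.sum A₁ A₂))}
      {E₁ E₁' : Tm (A₁ :: Γ) g} {E₂ E₂' : Tm (A₂ :: Γ) g} :
      Le V V' → Le E₁ E₁' → Le E₂ E₂' → Le (.caseOf V E₁ E₂) (.caseOf V' E₁' E₂')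
  | letUnit {Γ : Ctx} {g : Goal} {V V' : Tm Γ (.val .one)} {E E' : Tm Γ g} :
      Le V V' → Le E E' → Le (.letUnit V E) (.letUnit V' E')
  | pair {Γ : Ctx} {A₁ A₂ : VTy} {V₁ V₁' : Tm Γ (.val A₁)} {V₂ V₂' : Tm Γ (.val A₂)} :
      Le V₁ V₁' → Le V₂ V₂' → Le (.pair V₁ V₂) (.pair V₁' V₂')
  | letPair {Γ : Ctx} {A₁ A₂ : VTy} {g : Goal} {V V' : Tm Γ (.val (.prod A₁ A₂))}
      {E E' : Tm (A₂ :: A₁ :: Γ) g} :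
      Le V V' → Le E E' → Le (.letPair V E) (.letPair V' E')
  | thunk {Γ : Ctx} {B : CTy} {M M' : Tm Γ (.comp none B)} :
      Le M M' → Le (.thunk M) (.thunk M')
  | force {Γ : Ctx} {B : CTy} {V V' : Tm Γ (.val (.U B))} :
      Le V V' → Le (.force V) (.force V')
  | ret {Γ : Ctx} {A : VTy} {V V' : Tm Γ (.val A)} : Le V V' → Le (.ret V) (.ret V')
  | bind {Γ : Ctx} {Δ : Stoup} {A : VTy} {B : CTy} {M M' : Tm Γ (.comp Δ (.F A))}
      {N N' : Tm (A :: Γ) (.comp none B)} :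
      Le M M' → Le N N' → Le (.bind M N) (.bind M' N')
  | lam {Γ : Ctx} {Δ : Stoup} {A : VTy} {B : CTy} {M M' : Tm (A :: Γ) (.comp Δ B)} :
      Le M M' → Le (.lam M) (.lam M')
  | app {Γ : Ctx} {Δ : Stoup} {A : VTy} {B : CTy} {M M' : Tm Γ (.comp Δ (.arr A B))}
      {V V' : Tm Γ (.val A)} : Le M M' → Le V V' → Le (.app M V) (.app M' V')
  | ampI {Γ : Ctx} {Δ : Stoup} {B₁ B₂ : CTy} {M₁ M₁' : Tm Γ (.comp Δ B₁)}
      {M₂ M₂' : Tm Γ (.comp Δ B₂)} :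
      Le M₁ M₁' → Le M₂ M₂' → Le (.ampI M₁ M₂) (.ampI M₁' M₂')
  | fst {Γ : Ctx} {Δ : Stoup} {B₁ B₂ : CTy} {M M' : Tm Γ (.comp Δ (.amp B₁ B₂))} :
      Le M M' → Le (.fst M) (.fst M')
  | snd {Γ : Ctx} {Δ : Stoup} {B₁ B₂ : CTy} {M M' : Tm Γ (.comp Δ (.amp B₁ B₂))} :
      Le M M' → Le (.snd M) (.snd M')
  | roll {Γ : Ctx} {A : Ty [.val] .val} {V V' : Tm Γ (.val (A.inst (.mu A)))} :
      Le V V' → Le (.roll V) (.roll V')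
  | letRoll {Γ : Ctx} {A : Ty [.val] .val} {g : Goal} {V V' : Tm Γ (.val (.mu A))}
      {E E' : Tm (A.inst (.mu A) :: Γ) g} :
      Le V V' → Le E E' → Le (.letRoll V E) (.letRoll V' E')
  | rollC {Γ : Ctx} {Δ : Stoup} {B : Ty [.comp] .comp}
      {M M' : Tm Γ (.comp Δ (B.inst (.nu B)))} : Le M M' → Le (.rollC M) (.rollC M')
  | unroll {Γ : Ctx} {Δ : Stoup} {B : Ty [.comp] .comp} {M M' : Tm Γ (.comp Δ (.nu B))} :
      Le M M' → Le (.unroll M) (.unroll M')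
  | betaEtaL {Γ : Ctx} {g : Goal} {E E' : Tm Γ g} : BetaEta E E' → Le E E'
  | betaEtaR {Γ : Ctx} {g : Goal} {E E' : Tm Γ g} : BetaEta E E' → Le E' E
  | errBot {Γ : Ctx} {B : CTy} (M : Tm Γ (.comp none B)) : Le .err M
  | stkStrict {Γ : Ctx} {B B' : CTy} (S : Tm Γ (.comp (some B) B')) : Le (S.fill .err) .err

/-- Provable equivalence. -/
def Eqv {Γ : Ctx} {g : Goal} (E E' : Tm Γ g) : Prop := Le E E' ∧ Le E' E

/-! ### Embedding-projection pairs -/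

/-- A value `x : A ⊢ up : A'` and a stack `• : F A' ⊢ dn : F A`. -/
structure ValCast (A A' : VTy) where
  up : Tm [A] (.val A')
  dn : Tm [] (.comp (some (.F A')) (.F A))

/-- A value `z : U B ⊢ up : U B'` and a stack `• : B' ⊢ dn : B`. -/
structure CompCast (B B' : CTy) where
  up : Tm [.U B] (.val (.U B'))
  dn : Tm [] (.comp (some B') B)

/-- Value embedding-projection pairs from `A` to `A'`. -/
structure ValEP (A A' : VTy) extends ValCast A A' where
  retraction : Eqv (Γ := [A]) (.ret (.var .z)) (dn.on (.ret up))
  projection : Le (.bind dn (.ret up)) .hole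

/-- Computation embedding-projection pairs from `B` to `B'`. -/
structure CompEP (B B' : CTy) extends CompCast B B' where
  retraction : Eqv (Γ := [.U B]) (.force (.var .z)) (dn.on (.force up))
  projection : Le (Γ := [.U B']) (up.put (.thunk (dn.on (.force (.var .z))))) (.var .z)

/-! ### The building blocks of the cast-to-contract translation -/

namespace ValCast

def id (A : VTy) : ValCast A A := ⟨.var .z, .hole⟩

def trans {A A' A'' : VTy} (c : ValCast A A') (d : ValCast A' A'') : ValCast A A'' :=
  ⟨d.up.put c.up, c.dn.on d.dn⟩

def zero (A : VTy) : ValCast .zero A := ⟨.abort (.var .z), .bind .hole .err⟩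

def sum {A₁ A₁' A₂ A₂' : VTy} (c : ValCast A₁ A₁') (d : ValCast A₂ A₂') :
    ValCast (.sum A₁ A₂) (.sum A₁' A₂') where
  up := .caseOf (.var .z) (.inl (c.up.put (.var .z))) (.inr (d.up.put (.var .z)))
  dn := .bind .hole (.caseOf (.var .z)
    (.bind (c.dn.on (.ret (.var .z))) (.ret (.inl (.var .z))))
    (.bind (d.dn.on (.ret (.var .z))) (.ret (.inr (.var .z)))))

def prod {A₁ A₁' A₂ A₂' : VTy} (c : ValCast A₁ A₁') (d : ValCast A₂ A₂') :
    ValCast (.prod A₁ A₂) (.prod A₁' A₂') where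
  up := .letPair (.var .z) (.pair (c.up.put (.var (.s .z))) (d.up.put (.var .z)))
  dn := .bind .hole (.letPair (.var .z)
    (.bind (c.dn.on (.ret (.var (.s .z))))
      (.bind (d.dn.on (.ret (.var (.s .z)))) (.ret (.pair (.var (.s .z)) (.var .z))))))

def U {B B' : CTy} (c : CompCast B B') : ValCast (.U B) (.U B') where
  up := c.up
  dn := .bind .hole (.ret (.thunk (c.dn.on (.force (.var .z)))))

end ValCast

namespace CompCast

def id (B : CTy) : CompCast B B := ⟨.var .z, .hole⟩

def trans {B B' B'' : CTy} (c : CompCast B B') (d : CompCast B' B'') : CompCast B B'' :=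
  ⟨d.up.put c.up, c.dn.on d.dn⟩

def top (B : CTy) : CompCast .top B := ⟨.thunk .err, .topI⟩

def amp {B₁ B₁' B₂ B₂' : CTy} (c : CompCast B₁ B₁') (d : CompCast B₂ B₂') :
    CompCast (.amp B₁ B₂) (.amp B₁' B₂') where
  up := .thunk (.ampI
    (.force (c.up.put (.thunk (.fst (.force (.var .z))))))
    (.force (d.up.put (.thunk (.snd (.force (.var .z)))))))
  dn := .ampI (c.dn.on (.fst .hole)) (d.dn.on (.snd .hole))

def arr {A A' : VTy} {B B' : CTy} (c : ValCast A A') (d : CompCast B B') :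
    CompCast (.arr A B) (.arr A' B') where
  up := .thunk (.lam (.bind (c.dn.on (.ret (.var .z)))
    (.force (d.up.put (.thunk (.app (.force (.var (.s (.s .z)))) (.var .z)))))))
  dn := .lam (d.dn.on (.app .hole (c.up.put (.var .z))))

def F {A A' : VTy} (c : ValCast A A') : CompCast (.F A) (.F A') where
  up := .thunk (.bind (.force (.var .z)) (.ret (c.up.put (.var .z))))
  dn := c.dn

end CompCast

/-- The data interpreting a cast between two types of the same kind. -/
def CastData : {k : Kind} → Ty [] k → Ty [] k → Type
  | .val, A, A' => ValCast A A'
  | .comp, B, B' => CompCast B B'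

end CBPV

/-! ## GTT: gradual type theory -/

namespace GTT

/-- Value and computation types of GTT, with the dynamic types `dyn` and `dynC`. -/
inductive Ty : Kind → Type
  | dyn : Ty .val
  | U : Ty .comp → Ty .val
  | zero : Ty .val
  | sum : Ty .val → Ty .val → Ty .val
  | one : Ty .val
  | prod : Ty .val → Ty .val → Ty .val
  | dynC : Ty .comp
  | F : Ty .val → Ty .comp
  | top : Ty .comp
  | amp : Ty .comp → Ty .comp → Ty .comp
  | arr : Ty .val → Ty .comp → Ty .comp

abbrev VTy : Type := Ty .val
abbrev CTy : Type := Ty .comp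
abbrev Ctx : Type := List VTy
abbrev Stoup : Type := Option CTy

/-- Type dynamism `T ⊑ T'`, for value types and for computation types. -/
inductive Dyn : {k : Kind} → Ty k → Ty k → Prop
  | refl {k : Kind} (T : Ty k) : Dyn T T
  | trans {k : Kind} {T T' T'' : Ty k} : Dyn T T' → Dyn T' T'' → Dyn T T''
  | dyn (A : VTy) : Dyn A .dyn
  | U {B B' : CTy} : Dyn B B' → Dyn (.U B) (.U B')
  | sum {A₁ A₁' A₂ A₂' : VTy} : Dyn A₁ A₁' → Dyn A₂ A₂' → Dyn (.sum A₁ A₂) (.sum A₁' A₂')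
  | prod {A₁ A₁' A₂ A₂' : VTy} : Dyn A₁ A₁' → Dyn A₂ A₂' → Dyn (.prod A₁ A₂) (.prod A₁' A₂')
  | dynC (B : CTy) : Dyn B .dynC
  | F {A A' : VTy} : Dyn A A' → Dyn (.F A) (.F A')
  | amp {B₁ B₁' B₂ B₂' : CTy} : Dyn B₁ B₁' → Dyn B₂ B₂' → Dyn (.amp B₁ B₂) (.amp B₁' B₂')
  | arr {A A' : VTy} {B B' : CTy} : Dyn A A' → Dyn B B' → Dyn (.arr A B) (.arr A' B')

/-- `Γ ⊢ V : A` or `Γ | Δ ⊢ M : B`, as for CBPV*. -/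
inductive Goal : Type
  | val (A : VTy)
  | comp (Δ : Stoup) (B : CTy)

/-- Typing derivations of GTT. -/
inductive Tm : Ctx → Goal → Type
  | upcast {Γ : Ctx} {A A' : VTy} : Dyn A A' → Tm Γ (.val A) → Tm Γ (.val A')
  | dncast {Γ : Ctx} {Δ : Stoup} {B B' : CTy} :
      Dyn B B' → Tm Γ (.comp Δ B') → Tm Γ (.comp Δ B)
  | var {Γ : Ctx} {A : VTy} : Var Γ A → Tm Γ (.val A)
  | hole {Γ : Ctx} {B : CTy} : Tm Γ (.comp (some B) B)
  | err {Γ : Ctx} {B : CTy} : Tm Γ (.comp none B)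
  | abort {Γ : Ctx} {g : Goal} : Tm Γ (.val .zero) → Tm Γ g
  | inl {Γ : Ctx} {A₁ A₂ : VTy} : Tm Γ (.val A₁) → Tm Γ (.val (.sum A₁ A₂))
  | inr {Γ : Ctx} {A₁ A₂ : VTy} : Tm Γ (.val A₂) → Tm Γ (.val (.sum A₁ A₂))
  | caseOf {Γ : Ctx} {A₁ A₂ : VTy} {g : Goal} :
      Tm Γ (.val (.sum A₁ A₂)) → Tm (A₁ :: Γ) g → Tm (A₂ :: Γ) g → Tm Γ g
  | unit {Γ : Ctx} : Tm Γ (.val .one)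
  | letUnit {Γ : Ctx} {g : Goal} : Tm Γ (.val .one) → Tm Γ g → Tm Γ g
  | pair {Γ : Ctx} {A₁ A₂ : VTy} :
      Tm Γ (.val A₁) → Tm Γ (.val A₂) → Tm Γ (.val (.prod A₁ A₂))
  | letPair {Γ : Ctx} {A₁ A₂ : VTy} {g : Goal} :
      Tm Γ (.val (.prod A₁ A₂)) → Tm (A₂ :: A₁ :: Γ) g → Tm Γ g
  | thunk {Γ : Ctx} {B : CTy} : Tm Γ (.comp none B) → Tm Γ (.val (.U B))
  | force {Γ : Ctx} {B : CTy} : Tm Γ (.val (.U B)) → Tm Γ (.comp none B)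
  | ret {Γ : Ctx} {A : VTy} : Tm Γ (.val A) → Tm Γ (.comp none (.F A))
  | bind {Γ : Ctx} {Δ : Stoup} {A : VTy} {B : CTy} :
      Tm Γ (.comp Δ (.F A)) → Tm (A :: Γ) (.comp none B) → Tm Γ (.comp Δ B)
  | lam {Γ : Ctx} {Δ : Stoup} {A : VTy} {B : CTy} :
      Tm (A :: Γ) (.comp Δ B) → Tm Γ (.comp Δ (.arr A B))
  | app {Γ : Ctx} {Δ : Stoup} {A : VTy} {B : CTy} :
      Tm Γ (.comp Δ (.arr A B)) → Tm Γ (.val A) → Tm Γ (.comp Δ B)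
  | topI {Γ : Ctx} {Δ : Stoup} : Tm Γ (.comp Δ .top)
  | ampI {Γ : Ctx} {Δ : Stoup} {B₁ B₂ : CTy} :
      Tm Γ (.comp Δ B₁) → Tm Γ (.comp Δ B₂) → Tm Γ (.comp Δ (.amp B₁ B₂))
  | fst {Γ : Ctx} {Δ : Stoup} {B₁ B₂ : CTy} :
      Tm Γ (.comp Δ (.amp B₁ B₂)) → Tm Γ (.comp Δ B₁)
  | snd {Γ : Ctx} {Δ : Stoup} {B₁ B₂ : CTy} :
      Tm Γ (.comp Δ (.amp B₁ B₂)) → Tm Γ (.comp Δ B₂)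

def Tm.ren : {Γ Γ' : Ctx} → {g : Goal} → Tm Γ g → Ren Γ Γ' → Tm Γ' g
  | _, _, _, .upcast h V, r => .upcast h (V.ren r)
  | _, _, _, .dncast h M, r => .dncast h (M.ren r)
  | _, _, _, .var x, r => .var (r _ x)
  | _, _, _, .hole, _ => .hole
  | _, _, _, .err, _ => .err
  | _, _, _, .abort V, r => .abort (V.ren r)
  | _, _, _, .inl V, r => .inl (V.ren r)
  | _, _, _, .inr V, r => .inr (V.ren r)
  | _, _, _, .caseOf V E₁ E₂, r => .caseOf (V.ren r) (E₁.ren r.lift) (E₂.ren r.lift)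
  | _, _, _, .unit, _ => .unit
  | _, _, _, .letUnit V E, r => .letUnit (V.ren r) (E.ren r)
  | _, _, _, .pair V W, r => .pair (V.ren r) (W.ren r)
  | _, _, _, .letPair V E, r => .letPair (V.ren r) (E.ren r.lift.lift)
  | _, _, _, .thunk M, r => .thunk (M.ren r)
  | _, _, _, .force V, r => .force (V.ren r)
  | _, _, _, .ret V, r => .ret (V.ren r)
  | _, _, _, .bind M N, r => .bind (M.ren r) (N.ren r.lift)
  | _, _, _, .lam M, r => .lam (M.ren r.lift)
  | _, _, _, .app M V, r => .app (M.ren r) (V.ren r)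
  | _, _, _, .topI, _ => .topI
  | _, _, _, .ampI M N, r => .ampI (M.ren r) (N.ren r)
  | _, _, _, .fst M, r => .fst (M.ren r)
  | _, _, _, .snd M, r => .snd (M.ren r)

def Tm.wk {Γ : Ctx} {g : Goal} {A : VTy} (E : Tm Γ g) : Tm (A :: Γ) g := E.ren Ren.wk

abbrev Sub (Γ Γ' : Ctx) : Type := ∀ A : VTy, Var Γ A → Tm Γ' (.val A)

def Sub.lift {Γ Γ' : Ctx} {A : VTy} (σ : Sub Γ Γ') : Sub (A :: Γ) (A :: Γ')
  | _, .z => .var .z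
  | _, .s x => (σ _ x).wk

def Sub.cons {Γ Γ' : Ctx} {A : VTy} (V : Tm Γ' (.val A)) (σ : Sub Γ Γ') : Sub (A :: Γ) Γ'
  | _, .z => V
  | _, .s x => σ _ x

def Sub.id {Γ : Ctx} : Sub Γ Γ := fun _ x => .var x

/-- The substitution `[V/x]` from `Γ, x : A, Γ'` to `Γ, Γ'` (with `Γ'` written `Ξ`). -/
def Sub.at {Γ : Ctx} {A : VTy} (V : Tm Γ (.val A)) : (Ξ : Ctx) → Sub (Ξ ++ A :: Γ) (Ξ ++ Γ)
  | [] => Sub.cons V Sub.id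
  | _ :: Ξ => (Sub.at V Ξ).lift

def Tm.subst : {Γ Γ' : Ctx} → {g : Goal} → Tm Γ g → Sub Γ Γ' → Tm Γ' g
  | _, _, _, .upcast h V, σ => .upcast h (V.subst σ)
  | _, _, _, .dncast h M, σ => .dncast h (M.subst σ)
  | _, _, _, .var x, σ => σ _ x
  | _, _, _, .hole, _ => .hole
  | _, _, _, .err, _ => .err
  | _, _, _, .abort V, σ => .abort (V.subst σ)
  | _, _, _, .inl V, σ => .inl (V.subst σ)
  | _, _, _, .inr V, σ => .inr (V.subst σ)
  | _, _, _, .caseOf V E₁ E₂, σ => .caseOf (V.subst σ) (E₁.subst σ.lift) (E₂.subst σ.lift)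
  | _, _, _, .unit, _ => .unit
  | _, _, _, .letUnit V E, σ => .letUnit (V.subst σ) (E.subst σ)
  | _, _, _, .pair V W, σ => .pair (V.subst σ) (W.subst σ)
  | _, _, _, .letPair V E, σ => .letPair (V.subst σ) (E.subst σ.lift.lift)
  | _, _, _, .thunk M, σ => .thunk (M.subst σ)
  | _, _, _, .force V, σ => .force (V.subst σ)
  | _, _, _, .ret V, σ => .ret (V.subst σ)
  | _, _, _, .bind M N, σ => .bind (M.subst σ) (N.subst σ.lift)
  | _, _, _, .lam M, σ => .lam (M.subst σ.lift)
  | _, _, _, .app M V, σ => .app (M.subst σ) (V.subst σ)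
  | _, _, _, .topI, _ => .topI
  | _, _, _, .ampI M N, σ => .ampI (M.subst σ) (N.subst σ)
  | _, _, _, .fst M, σ => .fst (M.subst σ)
  | _, _, _, .snd M, σ => .snd (M.subst σ)

/-- Substitution of `N` for the hole; see `Tm.fill`. -/
def Tm.plug {B₁ : CTy} {Δ : Stoup} : {Γ : Ctx} → {g : Goal} → Tm Γ g → {B₂ : CTy} →
    g = .comp (some B₁) B₂ → Tm Γ (.comp Δ B₁) → Tm Γ (.comp Δ B₂)
  | _, _, .dncast h M, _, rfl, N => .dncast h (M.plug rfl N)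
  | _, _, .hole, _, rfl, N => N
  | _, _, .abort V, _, rfl, _ => .abort V
  | _, _, .caseOf V E₁ E₂, _, rfl, N => .caseOf V (E₁.plug rfl N.wk) (E₂.plug rfl N.wk)
  | _, _, .letUnit V E, _, rfl, N => .letUnit V (E.plug rfl N)
  | _, _, .letPair V E, _, rfl, N => .letPair V (E.plug rfl N.wk.wk)
  | _, _, .bind M L, _, rfl, N => .bind (M.plug rfl N) L
  | _, _, .lam M, _, rfl, N => .lam (M.plug rfl N.wk)
  | _, _, .app M V, _, rfl, N => .app (M.plug rfl N) V
  | _, _, .topI, _, rfl, _ => .topI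
  | _, _, .ampI M L, _, rfl, N => .ampI (M.plug rfl N) (L.plug rfl N)
  | _, _, .fst M, _, rfl, N => .fst (M.plug rfl N)
  | _, _, .snd M, _, rfl, N => .snd (M.plug rfl N)

/-- `S[N/•]`. -/
def Tm.fill {Γ : Ctx} {Δ : Stoup} {B₁ B₂ : CTy} (S : Tm Γ (.comp (some B₁) B₂))
    (N : Tm Γ (.comp Δ B₁)) : Tm Γ (.comp Δ B₂) := S.plug rfl N

/-! ### Dynamism contexts -/

/-- `Φ : Γ ⊑ Γ'`. -/
inductive CtxDyn : Ctx → Ctx → Prop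
  | nil : CtxDyn [] []
  | cons {A A' : VTy} {Γ Γ' : Ctx} : Dyn A A' → CtxDyn Γ Γ' → CtxDyn (A :: Γ) (A' :: Γ')

/-- `Ψ : Δ ⊑ Δ'`. -/
inductive StoupDyn : Stoup → Stoup → Prop
  | none : StoupDyn none none
  | some {B B' : CTy} : Dyn B B' → StoupDyn (some B) (some B')

/-- `A ⊑ A'` for values, and `Ψ : Δ ⊑ Δ'` together with `B ⊑ B'` for computations. -/
inductive GoalDyn : Goal → Goal → Prop
  | val {A A' : VTy} : Dyn A A' → GoalDyn (.val A) (.val A')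
  | comp {Δ Δ' : Stoup} {B B' : CTy} :
      StoupDyn Δ Δ' → Dyn B B' → GoalDyn (.comp Δ B) (.comp Δ' B')

theorem CtxDyn.refl : (Γ : Ctx) → CtxDyn Γ Γ
  | [] => .nil
  | A :: Γ => .cons (.refl A) (CtxDyn.refl Γ)

theorem CtxDyn.head {A A' : VTy} {Γ Γ' : Ctx} : CtxDyn (A :: Γ) (A' :: Γ') → Dyn A A'
  | .cons h _ => h

theorem CtxDyn.tail {A A' : VTy} {Γ Γ' : Ctx} : CtxDyn (A :: Γ) (A' :: Γ') → CtxDyn Γ Γ'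
  | .cons _ Φ => Φ

theorem CtxDyn.trans {Γ Γ' Γ'' : Ctx} (Φ : CtxDyn Γ Γ') (Φ' : CtxDyn Γ' Γ'') :
    CtxDyn Γ Γ'' := by
  induction Φ generalizing Γ'' with
  | nil => exact Φ'
  | cons h _ ih => cases Φ' with | cons h' Φ' => exact .cons (h.trans h') (ih Φ')

/-- `Φ, Φ'` (with `Φ'` written `Χ`). -/
theorem CtxDyn.append {Γ Γ' Ξ Ξ' : Ctx} (Χ : CtxDyn Ξ Ξ') (Φ : CtxDyn Γ Γ') :
    CtxDyn (Ξ ++ Γ) (Ξ' ++ Γ') := by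
  induction Χ with
  | nil => exact Φ
  | cons h _ ih => exact .cons h ih

theorem StoupDyn.refl : (Δ : Stoup) → StoupDyn Δ Δ
  | Option.none => .none
  | Option.some B => .some (.refl B)

theorem StoupDyn.hole {B B' : CTy} : StoupDyn (Option.some B) (Option.some B') → Dyn B B'
  | .some h => h

theorem StoupDyn.trans {Δ Δ' Δ'' : Stoup} (Ψ : StoupDyn Δ Δ') (Ψ' : StoupDyn Δ' Δ'') :
    StoupDyn Δ Δ'' := by
  cases Ψ with
  | none => exact Ψ'
  | some h => cases Ψ' with | some h' => exact .some (h.trans h')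

theorem GoalDyn.refl : (g : Goal) → GoalDyn g g
  | .val A => .val (.refl A)
  | .comp Δ B => .comp (.refl Δ) (.refl B)

theorem GoalDyn.trans {g g' g'' : Goal} (h : GoalDyn g g') (h' : GoalDyn g' g'') :
    GoalDyn g g'' := by
  cases h with
  | val h => cases h' with | val h' => exact .val (h.trans h')
  | comp Ψ h => cases h' with | comp Ψ' h' => exact .comp (Ψ.trans Ψ') (h.trans h')

/-! ### Term dynamism -/

/-- The `β` and `η` equations of GTT. -/
inductive BetaEta : {Γ : Ctx} → {g : Goal} → Tm Γ g → Tm Γ g → Prop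
  | sumBetaL {Γ : Ctx} {A₁ A₂ : VTy} {g : Goal} (V : Tm Γ (.val A₁))
      (E₁ : Tm (A₁ :: Γ) g) (E₂ : Tm (A₂ :: Γ) g) :
      BetaEta (.caseOf (.inl V) E₁ E₂) (E₁.subst (Sub.cons V Sub.id))
  | sumBetaR {Γ : Ctx} {A₁ A₂ : VTy} {g : Goal} (V : Tm Γ (.val A₂))
      (E₁ : Tm (A₁ :: Γ) g) (E₂ : Tm (A₂ :: Γ) g) :
      BetaEta (.caseOf (.inr V) E₁ E₂) (E₂.subst (Sub.cons V Sub.id))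
  | sumEta {Γ : Ctx} {A₁ A₂ : VTy} {g : Goal} (E : Tm (.sum A₁ A₂ :: Γ) g) :
      BetaEta E (.caseOf (.var .z)
        (E.subst (Sub.cons (.inl (.var .z)) fun _ x => .var (.s (.s x))))
        (E.subst (Sub.cons (.inr (.var .z)) fun _ x => .var (.s (.s x)))))
  | zeroEta {Γ : Ctx} {g : Goal} (E : Tm (.zero :: Γ) g) : BetaEta E (.abort (.var .z))
  | prodBeta {Γ : Ctx} {A₁ A₂ : VTy} {g : Goal} (V₁ : Tm Γ (.val A₁)) (V₂ : Tm Γ (.val A₂))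
      (E : Tm (A₂ :: A₁ :: Γ) g) :
      BetaEta (.letPair (.pair V₁ V₂) E) (E.subst (Sub.cons V₂ (Sub.cons V₁ Sub.id)))
  | prodEta {Γ : Ctx} {A₁ A₂ : VTy} {g : Goal} (E : Tm (.prod A₁ A₂ :: Γ) g) :
      BetaEta E (.letPair (.var .z)
        (E.subst (Sub.cons (.pair (.var (.s .z)) (.var .z)) fun _ x => .var (.s (.s (.s x))))))
  | oneBeta {Γ : Ctx} {g : Goal} (E : Tm Γ g) : BetaEta (.letUnit .unit E) E
  | oneEta {Γ : Ctx} {g : Goal} (E : Tm (.one :: Γ) g) :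
      BetaEta E (.letUnit (.var .z) (E.subst (Sub.cons .unit fun _ x => .var (.s x))))
  | UBeta {Γ : Ctx} {B : CTy} (M : Tm Γ (.comp none B)) : BetaEta (.force (.thunk M)) M
  | UEta {Γ : Ctx} {B : CTy} :
      BetaEta (Γ := .U B :: Γ) (.var .z) (.thunk (.force (.var .z)))
  | FBeta {Γ : Ctx} {A : VTy} {B : CTy} (V : Tm Γ (.val A)) (M : Tm (A :: Γ) (.comp none B)) :
      BetaEta (.bind (.ret V) M) (M.subst (Sub.cons V Sub.id))
  | FEta {Γ : Ctx} {A : VTy} {B : CTy} (M : Tm Γ (.comp (some (.F A)) B)) :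
      BetaEta M (.bind .hole (M.wk.fill (.ret (.var .z))))
  | arrBeta {Γ : Ctx} {Δ : Stoup} {A : VTy} {B : CTy} (M : Tm (A :: Γ) (.comp Δ B))
      (V : Tm Γ (.val A)) :
      BetaEta (.app (.lam M) V) (M.subst (Sub.cons V Sub.id))
  | arrEta {Γ : Ctx} {A : VTy} {B : CTy} :
      BetaEta (Γ := Γ) (g := .comp (some (.arr A B)) (.arr A B))
        .hole (.lam (.app .hole (.var .z)))
  | ampBetaL {Γ : Ctx} {Δ : Stoup} {B₁ B₂ : CTy} (M₁ : Tm Γ (.comp Δ B₁))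
      (M₂ : Tm Γ (.comp Δ B₂)) : BetaEta (.fst (.ampI M₁ M₂)) M₁
  | ampBetaR {Γ : Ctx} {Δ : Stoup} {B₁ B₂ : CTy} (M₁ : Tm Γ (.comp Δ B₁))
      (M₂ : Tm Γ (.comp Δ B₂)) : BetaEta (.snd (.ampI M₁ M₂)) M₂
  | ampEta {Γ : Ctx} {B₁ B₂ : CTy} :
      BetaEta (Γ := Γ) (g := .comp (some (.amp B₁ B₂)) (.amp B₁ B₂))
        .hole (.ampI (.fst .hole) (.snd .hole))
  | topEta {Γ : Ctx} : BetaEta (Γ := Γ) (g := .comp (some .top) .top) .hole .topI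

/-- Term dynamism. `TmDyn Φ (.val h) V V'` is `Φ ⊢ V ⊑ V' : A ⊑ A'` and
`TmDyn Φ (.comp Ψ h) M M'` is `Φ | Ψ ⊢ M ⊑ M' : B ⊑ B'`, where the (proof-irrelevant) arguments
`Φ : Γ ⊑ Γ'`, `Ψ : Δ ⊑ Δ'` and `h` are the presuppositions of these judgements. -/
inductive TmDyn : {Γ Γ' : Ctx} → CtxDyn Γ Γ' → {g g' : Goal} → GoalDyn g g' →
    Tm Γ g → Tm Γ' g' → Prop
  -- structural rules
  | refl {Γ : Ctx} {g : Goal} (E : Tm Γ g) : TmDyn (.refl Γ) (.refl g) E E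
  | var {Γ Γ' Ξ Ξ' : Ctx} {A A' : VTy} (Φ : CtxDyn Γ Γ') (h : Dyn A A') (Χ : CtxDyn Ξ Ξ') :
      TmDyn (Χ.append (.cons h Φ)) (.val h) (.var (Var.at Ξ)) (.var (Var.at Ξ'))
  | trans {Γ Γ' Γ'' : Ctx} {Φ : CtxDyn Γ Γ'} {Φ' : CtxDyn Γ' Γ''} {g g' g'' : Goal}
      {h : GoalDyn g g'} {h' : GoalDyn g' g''} {E : Tm Γ g} {E' : Tm Γ' g'} {E'' : Tm Γ'' g''} :
      TmDyn Φ h E E' → TmDyn Φ' h' E' E'' → TmDyn (Φ.trans Φ') (h.trans h') E E''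
  | valSubst {Γ Γ' Ξ Ξ' : Ctx} {A A' : VTy} {g g' : Goal} {Φ : CtxDyn Γ Γ'} {hA : Dyn A A'}
      {Χ : CtxDyn Ξ Ξ'} {h : GoalDyn g g'} {V : Tm Γ (.val A)} {V' : Tm Γ' (.val A')}
      {E : Tm (Ξ ++ A :: Γ) g} {E' : Tm (Ξ' ++ A' :: Γ') g'} :
      TmDyn Φ (.val hA) V V' → TmDyn (Χ.append (.cons hA Φ)) h E E' →
      TmDyn (Χ.append Φ) h (E.subst (Sub.at V Ξ)) (E'.subst (Sub.at V' Ξ'))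
  | hole {Γ Γ' : Ctx} {B B' : CTy} (Φ : CtxDyn Γ Γ') (h : Dyn B B') :
      TmDyn Φ (.comp (.some h) h) .hole .hole
  | stkSubst {Γ Γ' : Ctx} {Δ Δ' : Stoup} {B₁ B₁' B₂ B₂' : CTy} {Φ : CtxDyn Γ Γ'}
      {Ψ : StoupDyn Δ Δ'} {h₁ : Dyn B₁ B₁'} {h₂ : Dyn B₂ B₂'}
      {M₁ : Tm Γ (.comp Δ B₁)} {M₁' : Tm Γ' (.comp Δ' B₁')}
      {M₂ : Tm Γ (.comp (some B₁) B₂)} {M₂' : Tm Γ' (.comp (some B₁') B₂')} :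
      TmDyn Φ (.comp Ψ h₁) M₁ M₁' → TmDyn Φ (.comp (.some h₁) h₂) M₂ M₂' →
      TmDyn Φ (.comp Ψ h₂) (M₂.fill M₁) (M₂'.fill M₁')
  -- congruence rules
  | inl {Γ Γ' : Ctx} {A₁ A₁' A₂ A₂' : VTy} {Φ : CtxDyn Γ Γ'} {h₁ : Dyn A₁ A₁'}
      (h₂ : Dyn A₂ A₂') {V : Tm Γ (.val A₁)} {V' : Tm Γ' (.val A₁')} :
      TmDyn Φ (.val h₁) V V' → TmDyn Φ (.val (.sum h₁ h₂)) (.inl V) (.inl V')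
  | inr {Γ Γ' : Ctx} {A₁ A₁' A₂ A₂' : VTy} {Φ : CtxDyn Γ Γ'} (h₁ : Dyn A₁ A₁')
      {h₂ : Dyn A₂ A₂'} {V : Tm Γ (.val A₂)} {V' : Tm Γ' (.val A₂')} :
      TmDyn Φ (.val h₂) V V' → TmDyn Φ (.val (.sum h₁ h₂)) (.inr V) (.inr V')
  | caseOf {Γ Γ' : Ctx} {A₁ A₁' A₂ A₂' : VTy} {g g' : Goal} {Φ : CtxDyn Γ Γ'}
      {h₁ : Dyn A₁ A₁'} {h₂ : Dyn A₂ A₂'} {h : GoalDyn g g'}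
      {V : Tm Γ (.val (.sum A₁ A₂))} {V' : Tm Γ' (.val (.sum A₁' A₂'))}
      {E₁ : Tm (A₁ :: Γ) g} {E₁' : Tm (A₁' :: Γ') g'}
      {E₂ : Tm (A₂ :: Γ) g} {E₂' : Tm (A₂' :: Γ') g'} :
      TmDyn Φ (.val (.sum h₁ h₂)) V V' → TmDyn (.cons h₁ Φ) h E₁ E₁' →
      TmDyn (.cons h₂ Φ) h E₂ E₂' → TmDyn Φ h (.caseOf V E₁ E₂) (.caseOf V' E₁' E₂')
  | abort {Γ Γ' : Ctx} {g g' : Goal} {Φ : CtxDyn Γ Γ'} (h : GoalDyn g g')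
      {V : Tm Γ (.val .zero)} {V' : Tm Γ' (.val .zero)} :
      TmDyn Φ (.val (.refl .zero)) V V' → TmDyn Φ h (.abort V) (.abort V')
  | unit {Γ Γ' : Ctx} (Φ : CtxDyn Γ Γ') : TmDyn Φ (.val (.refl .one)) .unit .unit
  | letUnit {Γ Γ' : Ctx} {g g' : Goal} {Φ : CtxDyn Γ Γ'} {h : GoalDyn g g'}
      {V : Tm Γ (.val .one)} {V' : Tm Γ' (.val .one)} {E : Tm Γ g} {E' : Tm Γ' g'} :
      TmDyn Φ (.val (.refl .one)) V V' → TmDyn Φ h E E' →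
      TmDyn Φ h (.letUnit V E) (.letUnit V' E')
  | pair {Γ Γ' : Ctx} {A₁ A₁' A₂ A₂' : VTy} {Φ : CtxDyn Γ Γ'} {h₁ : Dyn A₁ A₁'}
      {h₂ : Dyn A₂ A₂'} {V₁ : Tm Γ (.val A₁)} {V₁' : Tm Γ' (.val A₁')}
      {V₂ : Tm Γ (.val A₂)} {V₂' : Tm Γ' (.val A₂')} :
      TmDyn Φ (.val h₁) V₁ V₁' → TmDyn Φ (.val h₂) V₂ V₂' →
      TmDyn Φ (.val (.prod h₁ h₂)) (.pair V₁ V₂) (.pair V₁' V₂')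
  | letPair {Γ Γ' : Ctx} {A₁ A₁' A₂ A₂' : VTy} {g g' : Goal} {Φ : CtxDyn Γ Γ'}
      {h₁ : Dyn A₁ A₁'} {h₂ : Dyn A₂ A₂'} {h : GoalDyn g g'}
      {V : Tm Γ (.val (.prod A₁ A₂))} {V' : Tm Γ' (.val (.prod A₁' A₂'))}
      {E : Tm (A₂ :: A₁ :: Γ) g} {E' : Tm (A₂' :: A₁' :: Γ') g'} :
      TmDyn Φ (.val (.prod h₁ h₂)) V V' → TmDyn (.cons h₂ (.cons h₁ Φ)) h E E' →
      TmDyn Φ h (.letPair V E) (.letPair V' E')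
  | thunk {Γ Γ' : Ctx} {B B' : CTy} {Φ : CtxDyn Γ Γ'} {h : Dyn B B'}
      {M : Tm Γ (.comp none B)} {M' : Tm Γ' (.comp none B')} :
      TmDyn Φ (.comp .none h) M M' → TmDyn Φ (.val (.U h)) (.thunk M) (.thunk M')
  | force {Γ Γ' : Ctx} {B B' : CTy} {Φ : CtxDyn Γ Γ'} {h : Dyn B B'}
      {V : Tm Γ (.val (.U B))} {V' : Tm Γ' (.val (.U B'))} :
      TmDyn Φ (.val (.U h)) V V' → TmDyn Φ (.comp .none h) (.force V) (.force V')
  | ret {Γ Γ' : Ctx} {A A' : VTy} {Φ : CtxDyn Γ Γ'} {h : Dyn A A'}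
      {V : Tm Γ (.val A)} {V' : Tm Γ' (.val A')} :
      TmDyn Φ (.val h) V V' → TmDyn Φ (.comp .none (.F h)) (.ret V) (.ret V')
  | bind {Γ Γ' : Ctx} {Δ Δ' : Stoup} {A A' : VTy} {B B' : CTy} {Φ : CtxDyn Γ Γ'}
      {Ψ : StoupDyn Δ Δ'} {hA : Dyn A A'} {hB : Dyn B B'}
      {M : Tm Γ (.comp Δ (.F A))} {M' : Tm Γ' (.comp Δ' (.F A'))}
      {N : Tm (A :: Γ) (.comp none B)} {N' : Tm (A' :: Γ') (.comp none B')} :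
      TmDyn Φ (.comp Ψ (.F hA)) M M' → TmDyn (.cons hA Φ) (.comp .none hB) N N' →
      TmDyn Φ (.comp Ψ hB) (.bind M N) (.bind M' N')
  | lam {Γ Γ' : Ctx} {Δ Δ' : Stoup} {A A' : VTy} {B B' : CTy} {Φ : CtxDyn Γ Γ'}
      {Ψ : StoupDyn Δ Δ'} {hA : Dyn A A'} {hB : Dyn B B'}
      {M : Tm (A :: Γ) (.comp Δ B)} {M' : Tm (A' :: Γ') (.comp Δ' B')} :
      TmDyn (.cons hA Φ) (.comp Ψ hB) M M' →
      TmDyn Φ (.comp Ψ (.arr hA hB)) (.lam M) (.lam M')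
  | app {Γ Γ' : Ctx} {Δ Δ' : Stoup} {A A' : VTy} {B B' : CTy} {Φ : CtxDyn Γ Γ'}
      {Ψ : StoupDyn Δ Δ'} {hA : Dyn A A'} {hB : Dyn B B'}
      {M : Tm Γ (.comp Δ (.arr A B))} {M' : Tm Γ' (.comp Δ' (.arr A' B'))}
      {V : Tm Γ (.val A)} {V' : Tm Γ' (.val A')} :
      TmDyn Φ (.comp Ψ (.arr hA hB)) M M' → TmDyn Φ (.val hA) V V' →
      TmDyn Φ (.comp Ψ hB) (.app M V) (.app M' V')
  | topI {Γ Γ' : Ctx} {Δ Δ' : Stoup} (Φ : CtxDyn Γ Γ') (Ψ : StoupDyn Δ Δ') :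
      TmDyn Φ (.comp Ψ (.refl .top)) .topI .topI
  | ampI {Γ Γ' : Ctx} {Δ Δ' : Stoup} {B₁ B₁' B₂ B₂' : CTy} {Φ : CtxDyn Γ Γ'}
      {Ψ : StoupDyn Δ Δ'} {h₁ : Dyn B₁ B₁'} {h₂ : Dyn B₂ B₂'}
      {M₁ : Tm Γ (.comp Δ B₁)} {M₁' : Tm Γ' (.comp Δ' B₁')}
      {M₂ : Tm Γ (.comp Δ B₂)} {M₂' : Tm Γ' (.comp Δ' B₂')} :
      TmDyn Φ (.comp Ψ h₁) M₁ M₁' → TmDyn Φ (.comp Ψ h₂) M₂ M₂' →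
      TmDyn Φ (.comp Ψ (.amp h₁ h₂)) (.ampI M₁ M₂) (.ampI M₁' M₂')
  | fst {Γ Γ' : Ctx} {Δ Δ' : Stoup} {B₁ B₁' B₂ B₂' : CTy} {Φ : CtxDyn Γ Γ'}
      {Ψ : StoupDyn Δ Δ'} {h₁ : Dyn B₁ B₁'} {h₂ : Dyn B₂ B₂'}
      {M : Tm Γ (.comp Δ (.amp B₁ B₂))} {M' : Tm Γ' (.comp Δ' (.amp B₁' B₂'))} :
      TmDyn Φ (.comp Ψ (.amp h₁ h₂)) M M' → TmDyn Φ (.comp Ψ h₁) (.fst M) (.fst M')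
  | snd {Γ Γ' : Ctx} {Δ Δ' : Stoup} {B₁ B₁' B₂ B₂' : CTy} {Φ : CtxDyn Γ Γ'}
      {Ψ : StoupDyn Δ Δ'} {h₁ : Dyn B₁ B₁'} {h₂ : Dyn B₂ B₂'}
      {M : Tm Γ (.comp Δ (.amp B₁ B₂))} {M' : Tm Γ' (.comp Δ' (.amp B₁' B₂'))} :
      TmDyn Φ (.comp Ψ (.amp h₁ h₂)) M M' → TmDyn Φ (.comp Ψ h₂) (.snd M) (.snd M')
  -- universal properties of casts
  | upBound {Γ : Ctx} {A A' : VTy} (h : Dyn A A') :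
      TmDyn (.refl (A :: Γ)) (.val h) (.var .z) (.upcast h (.var .z))
  | upBest {Γ : Ctx} {A A' : VTy} (h : Dyn A A') :
      TmDyn (.cons h (.refl Γ)) (.val (.refl A')) (.upcast h (.var .z)) (.var .z)
  | dnBound {Γ : Ctx} {B B' : CTy} (h : Dyn B B') :
      TmDyn (.refl Γ) (.comp (.refl (some B')) h) (.dncast h .hole) .hole
  | dnBest {Γ : Ctx} {B B' : CTy} (h : Dyn B B') :
      TmDyn (.refl Γ) (.comp (.some h) (.refl B)) .hole (.dncast h .hole)
  -- retract axioms
  | retractF {Γ : Ctx} {A : VTy} :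
      TmDyn (.refl (A :: Γ)) (.refl (.comp none (.F A)))
        (.dncast (.F (.dyn A)) (.ret (.upcast (.dyn A) (.var .z)))) (.ret (.var .z))
  | retractU {Γ : Ctx} {B : CTy} :
      TmDyn (.refl (.U B :: Γ)) (.refl (.comp none B))
        (.dncast (.dynC B) (.force (.upcast (.U (.dynC B)) (.var .z)))) (.force (.var .z))
  -- universal properties of types
  | betaEtaL {Γ : Ctx} {g : Goal} {E E' : Tm Γ g} :
      BetaEta E E' → TmDyn (.refl Γ) (.refl g) E E'
  | betaEtaR {Γ : Ctx} {g : Goal} {E E' : Tm Γ g} :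
      BetaEta E E' → TmDyn (.refl Γ) (.refl g) E' E
  -- properties of errors
  | errBot {Γ Γ' : Ctx} {B B' : CTy} (Φ : CtxDyn Γ Γ') (h : Dyn B B')
      (M' : Tm Γ' (.comp none B')) : TmDyn Φ (.comp .none h) .err M'
  | stkStrict {Γ : Ctx} {B B' : CTy} (S : Tm Γ (.comp (some B) B')) :
      TmDyn (.refl Γ) (.refl (.comp none B')) (S.fill .err) .err

/-! ### Normalized type dynamism

`NDyn` computes type dynamism by recursion on the types. It is what makes the definition of the
casts by recursion on types total. -/

def NDyn : {k : Kind} → Ty k → Ty k → Prop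
  | _, _, .dyn => True
  | _, _, .dynC => True
  | _, .zero, .zero => True
  | _, .one, .one => True
  | _, .U B, .U B' => NDyn B B'
  | _, .sum A₁ A₂, .sum A₁' A₂' => NDyn A₁ A₁' ∧ NDyn A₂ A₂'
  | _, .prod A₁ A₂, .prod A₁' A₂' => NDyn A₁ A₁' ∧ NDyn A₂ A₂'
  | _, .F A, .F A' => NDyn A A'
  | _, .top, .top => True
  | _, .amp B₁ B₂, .amp B₁' B₂' => NDyn B₁ B₁' ∧ NDyn B₂ B₂'
  | _, .arr A B, .arr A' B' => NDyn A A' ∧ NDyn B B'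
  | _, _, _ => False

theorem NDyn.dyn (A : VTy) : NDyn A .dyn := by cases A <;> simp [NDyn]

theorem NDyn.dynC (B : CTy) : NDyn B .dynC := by cases B <;> simp [NDyn]

theorem NDyn.refl {k : Kind} (T : Ty k) : NDyn T T := by
  induction T <;> simp_all [NDyn]

theorem NDyn.trans {k : Kind} {T T' T'' : Ty k} (h : NDyn T T') (h' : NDyn T' T'') :
    NDyn T T'' := by
  induction T with
  | U B ih | F A ih =>
    cases T' <;> first | exact h.elim | skip
    all_goals cases T'' <;> first | exact h'.elim | trivial | exact ih h h'
  | sum _ _ ih₁ ih₂ | prod _ _ ih₁ ih₂ | amp _ _ ih₁ ih₂ | arr _ _ ih₁ ih₂ =>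
    cases T' <;> first | exact h.elim | skip
    all_goals cases T'' <;>
      first | exact h'.elim | trivial | exact ⟨ih₁ h.1 h'.1, ih₂ h.2 h'.2⟩
  | _ =>
    cases T' <;> first | exact h.elim | skip
    all_goals cases T'' <;> first | exact h'.elim | trivial

theorem Dyn.ndyn {k : Kind} {T T' : Ty k} (h : Dyn T T') : NDyn T T' := by
  induction h with
  | refl T => exact .refl T
  | trans _ _ ih ih' => exact ih.trans ih'
  | dyn A => exact .dyn A
  | dynC B => exact .dynC B
  | U _ ih | F _ ih => exact ih
  | sum _ _ ih₁ ih₂ | prod _ _ ih₁ ih₂ | amp _ _ ih₁ ih₂ | arr _ _ ih₁ ih₂ => exact ⟨ih₁, ih₂⟩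

/-! ## The contract translation of GTT into CBPV* -/

/-- Interpretation of types, given interpretations `D`, `C` of the two dynamic types. -/
def Ty.interp (D : CBPV.VTy) (C : CBPV.CTy) : {k : Kind} → Ty k → CBPV.Ty [] k
  | _, .dyn => D
  | _, .U B => .U (B.interp D C)
  | _, .zero => .zero
  | _, .sum A₁ A₂ => .sum (A₁.interp D C) (A₂.interp D C)
  | _, .one => .one
  | _, .prod A₁ A₂ => .prod (A₁.interp D C) (A₂.interp D C)
  | _, .dynC => C
  | _, .F A => .F (A.interp D C)
  | _, .top => .top
  | _, .amp B₁ B₂ => .amp (B₁.interp D C) (B₂.interp D C)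
  | _, .arr A B => .arr (A.interp D C) (B.interp D C)

/-- Ground value types, without `0`. -/
inductive VGround : Type
  | one
  | prod
  | sum
  | U

def VGround.ty : VGround → VTy
  | .one => .one
  | .prod => .prod .dyn .dyn
  | .sum => .sum .dyn .dyn
  | .U => .U .dynC

/-- Ground computation types, without `⊤`. -/
inductive CGround : Type
  | arr
  | amp
  | F

def CGround.ty : CGround → CTy
  | .arr => .arr .dyn .dynC
  | .amp => .amp .dynC .dynC
  | .F => .F .dyn

end GTT

/-- Dynamic type interpretations. -/
structure DynInterp where
  dyn : CBPV.VTy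
  dynC : CBPV.CTy
  valEP : ∀ G : GTT.VGround, CBPV.ValEP (G.ty.interp dyn dynC) dyn
  compEP : ∀ G : GTT.CGround, CBPV.CompEP (G.ty.interp dyn dynC) dynC

namespace DynInterp

/-- `⟦T⟧`. -/
def ty (ρ : DynInterp) {k : Kind} (T : GTT.Ty k) : CBPV.Ty [] k := T.interp ρ.dyn ρ.dynC

/-- `⟦Γ⟧`. -/
abbrev ctx (ρ : DynInterp) (Γ : GTT.Ctx) : CBPV.Ctx := Γ.map ρ.ty

/-- `⟦Δ⟧`. -/
abbrev stoup (ρ : DynInterp) (Δ : GTT.Stoup) : CBPV.Stoup := Δ.map ρ.ty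

def goal (ρ : DynInterp) : GTT.Goal → CBPV.Goal
  | .val A => .val (ρ.ty A)
  | .comp Δ B => .comp (ρ.stoup Δ) (ρ.ty B)

/-! The casts `A₁ + A₂ ⊑ ?`, `A₁ × A₂ ⊑ ?`, … built from casts of the components to the dynamic
types: a cast from a ground type to the dynamic type is the one given by `ρ`, and the other casts
go through the ground type with the same connective. -/

def sumDyn (ρ : DynInterp) : (A₁ A₂ : GTT.VTy) → CBPV.ValCast (ρ.ty A₁) ρ.dyn →
    CBPV.ValCast (ρ.ty A₂) ρ.dyn → CBPV.ValCast (.sum (ρ.ty A₁) (ρ.ty A₂)) ρ.dyn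
  | .dyn, .dyn, _, _ => (ρ.valEP .sum).toValCast
  | _, _, c, d => (CBPV.ValCast.sum c d).trans (ρ.valEP .sum).toValCast

def prodDyn (ρ : DynInterp) : (A₁ A₂ : GTT.VTy) → CBPV.ValCast (ρ.ty A₁) ρ.dyn →
    CBPV.ValCast (ρ.ty A₂) ρ.dyn → CBPV.ValCast (.prod (ρ.ty A₁) (ρ.ty A₂)) ρ.dyn
  | .dyn, .dyn, _, _ => (ρ.valEP .prod).toValCast
  | _, _, c, d => (CBPV.ValCast.prod c d).trans (ρ.valEP .prod).toValCast

def UDyn (ρ : DynInterp) : (B : GTT.CTy) → CBPV.CompCast (ρ.ty B) ρ.dynC →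
    CBPV.ValCast (.U (ρ.ty B)) ρ.dyn
  | .dynC, _ => (ρ.valEP .U).toValCast
  | _, c => (CBPV.ValCast.U c).trans (ρ.valEP .U).toValCast

def ampDyn (ρ : DynInterp) : (B₁ B₂ : GTT.CTy) → CBPV.CompCast (ρ.ty B₁) ρ.dynC →
    CBPV.CompCast (ρ.ty B₂) ρ.dynC → CBPV.CompCast (.amp (ρ.ty B₁) (ρ.ty B₂)) ρ.dynC
  | .dynC, .dynC, _, _ => (ρ.compEP .amp).toCompCast
  | _, _, c, d => (CBPV.CompCast.amp c d).trans (ρ.compEP .amp).toCompCast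

def arrDyn (ρ : DynInterp) : (A : GTT.VTy) → (B : GTT.CTy) → CBPV.ValCast (ρ.ty A) ρ.dyn →
    CBPV.CompCast (ρ.ty B) ρ.dynC → CBPV.CompCast (.arr (ρ.ty A) (ρ.ty B)) ρ.dynC
  | .dyn, .dynC, _, _ => (ρ.compEP .arr).toCompCast
  | _, _, c, d => (CBPV.CompCast.arr c d).trans (ρ.compEP .arr).toCompCast

def FDyn (ρ : DynInterp) : (A : GTT.VTy) → CBPV.ValCast (ρ.ty A) ρ.dyn →
    CBPV.CompCast (.F (ρ.ty A)) ρ.dynC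
  | .dyn, _ => (ρ.compEP .F).toCompCast
  | _, c => (CBPV.CompCast.F c).trans (ρ.compEP .F).toCompCast

/-- The cast-to-contract translation. For value types `A ⊑ A'` it yields the upcast
`x : ⟦A⟧ ⊢ ⟦A' ↢ A⟧ : ⟦A'⟧` and the downcast `• : F ⟦A'⟧ ⊢ ⟦F A ↞ F A'⟧ : F ⟦A⟧`; for computation
types `B ⊑ B'` the upcast `x : U ⟦B⟧ ⊢ ⟦U B' ↢ U B⟧ : U ⟦B'⟧` and the downcast
`• : ⟦B'⟧ ⊢ ⟦B ↞ B'⟧ : ⟦B⟧`. -/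
def cast (ρ : DynInterp) : {k : Kind} → (T T' : GTT.Ty k) → GTT.NDyn T T' →
    CBPV.CastData (ρ.ty T) (ρ.ty T')
  -- value types
  | _, .zero, A', _ => CBPV.ValCast.zero (ρ.ty A')
  | _, .dyn, .dyn, _ => CBPV.ValCast.id _
  | _, .one, .dyn, _ => (ρ.valEP .one).toValCast
  | _, .sum A₁ A₂, .dyn, _ =>
      ρ.sumDyn A₁ A₂ (ρ.cast A₁ .dyn (.dyn A₁)) (ρ.cast A₂ .dyn (.dyn A₂))
  | _, .prod A₁ A₂, .dyn, _ =>
      ρ.prodDyn A₁ A₂ (ρ.cast A₁ .dyn (.dyn A₁)) (ρ.cast A₂ .dyn (.dyn A₂))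
  | _, .U B, .dyn, _ => ρ.UDyn B (ρ.cast B .dynC (.dynC B))
  | _, .one, .one, _ => CBPV.ValCast.id _
  | _, .sum A₁ A₂, .sum A₁' A₂', h =>
      CBPV.ValCast.sum (ρ.cast A₁ A₁' h.1) (ρ.cast A₂ A₂' h.2)
  | _, .prod A₁ A₂, .prod A₁' A₂', h =>
      CBPV.ValCast.prod (ρ.cast A₁ A₁' h.1) (ρ.cast A₂ A₂' h.2)
  | _, .U B, .U B', h => CBPV.ValCast.U (ρ.cast B B' h)
  -- computation types
  | _, .top, B', _ => CBPV.CompCast.top (ρ.ty B')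
  | _, .dynC, .dynC, _ => CBPV.CompCast.id _
  | _, .amp B₁ B₂, .dynC, _ =>
      ρ.ampDyn B₁ B₂ (ρ.cast B₁ .dynC (.dynC B₁)) (ρ.cast B₂ .dynC (.dynC B₂))
  | _, .arr A B, .dynC, _ =>
      ρ.arrDyn A B (ρ.cast A .dyn (.dyn A)) (ρ.cast B .dynC (.dynC B))
  | _, .F A, .dynC, _ => ρ.FDyn A (ρ.cast A .dyn (.dyn A))
  | _, .amp B₁ B₂, .amp B₁' B₂', h =>
      CBPV.CompCast.amp (ρ.cast B₁ B₁' h.1) (ρ.cast B₂ B₂' h.2)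
  | _, .arr A B, .arr A' B', h => CBPV.CompCast.arr (ρ.cast A A' h.1) (ρ.cast B B' h.2)
  | _, .F A, .F A', h => CBPV.CompCast.F (ρ.cast A A' h)

/-- `x : ⟦A⟧ ⊢ ⟦A' ↢ A⟧ : ⟦A'⟧`. -/
def up (ρ : DynInterp) {A A' : GTT.VTy} (h : GTT.Dyn A A') :
    CBPV.Tm [ρ.ty A] (.val (ρ.ty A')) :=
  CBPV.ValCast.up (ρ.cast A A' h.ndyn)

/-- `• : ⟦B'⟧ ⊢ ⟦B ↞ B'⟧ : ⟦B⟧`. -/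
def dn (ρ : DynInterp) {B B' : GTT.CTy} (h : GTT.Dyn B B') :
    CBPV.Tm [] (.comp (some (ρ.ty B')) (ρ.ty B)) :=
  CBPV.CompCast.dn (ρ.cast B B' h.ndyn)

/-- `⟦E⟧`: casts become contracts, and everything else is translated homomorphically. -/
def tm (ρ : DynInterp) : {Γ : GTT.Ctx} → {g : GTT.Goal} → GTT.Tm Γ g →
    CBPV.Tm (ρ.ctx Γ) (ρ.goal g)
  | _, _, .upcast h V => (ρ.up h).put (ρ.tm V)
  | _, _, .dncast h M => (ρ.dn h).on (ρ.tm M)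
  | _, _, .var x => .var (x.map ρ.ty)
  | _, _, .hole => .hole
  | _, _, .err => .err
  | _, _, .abort V => .abort (ρ.tm V)
  | _, _, .inl V => .inl (ρ.tm V)
  | _, _, .inr V => .inr (ρ.tm V)
  | _, _, .caseOf V E₁ E₂ => .caseOf (ρ.tm V) (ρ.tm E₁) (ρ.tm E₂)
  | _, _, .unit => .unit
  | _, _, .letUnit V E => .letUnit (ρ.tm V) (ρ.tm E)
  | _, _, .pair V W => .pair (ρ.tm V) (ρ.tm W)
  | _, _, .letPair V E => .letPair (ρ.tm V) (ρ.tm E)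
  | _, _, .thunk M => .thunk (ρ.tm M)
  | _, _, .force V => .force (ρ.tm V)
  | _, _, .ret V => .ret (ρ.tm V)
  | _, _, .bind M N => .bind (ρ.tm M) (ρ.tm N)
  | _, _, .lam M => .lam (ρ.tm M)
  | _, _, .app M V => .app (ρ.tm M) (ρ.tm V)
  | _, _, .topI => .topI
  | _, _, .ampI M N => .ampI (ρ.tm M) (ρ.tm N)
  | _, _, .fst M => .fst (ρ.tm M)
  | _, _, .snd M => .snd (ρ.tm M)

/-- `⟦Φ⟧`, the substitution of `⟦A' ↢ A⟧[x]` for each variable `x' : A'` of `Γ'`. -/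
def upSub (ρ : DynInterp) : {Γ Γ' : GTT.Ctx} → GTT.CtxDyn Γ Γ' →
    CBPV.Sub (ρ.ctx Γ') (ρ.ctx Γ)
  | [], [], _ => fun _ x => nomatch x
  | _ :: _, _ :: _, Φ =>
      CBPV.Sub.cons ((ρ.up Φ.head).put (.var .z)) (fun _ x => (ρ.upSub Φ.tail _ x).wk)

/-- `M[⟦Ψ⟧]`: substitution of `⟦B ↞ B'⟧[•]` for `•` if the stoup is not empty. -/
def dnStoup (ρ : DynInterp) {Γ : CBPV.Ctx} {C : CBPV.CTy} : {Δ Δ' : GTT.Stoup} →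
    GTT.StoupDyn Δ Δ' → CBPV.Tm Γ (.comp (ρ.stoup Δ) C) → CBPV.Tm Γ (.comp (ρ.stoup Δ') C)
  | none, none, _, M => M
  | some _, some _, Ψ, M => CBPV.Tm.fill M ((ρ.dn Ψ.hole).on .hole)

end DynInterp

end Gradual

/-!
Every cast of the contract translation is an embedding-projection pair in CBPV*. The laws of such
pairs say that the projection is right adjoint to the embedding, so either half determines the
other up to `≡` (`ValCast.dn_le_of_up_le`, `CompCast.up_le_of_dn_le`). This is what makes the casts
tractable: each connective of value types has a direct definition of its upcast and each connective
of computation types one of its downcast, and two casts agree as soon as their direct halves do.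
In this way the casts are shown to be ep pairs (`DynInterp.cast_isEP`), identities when both types
are the same (`DynInterp.cast_refl`), and closed under composition (`DynInterp.cast_trans`).

The translation commutes with substitution of values and with plugging of stacks
(`DynInterp.tm_subst`, `DynInterp.tm_fill`), and it sends `β` and `η` laws to `β` and `η` laws.
Graduality is then proved by induction on the derivation of term dynamism (`DynInterp.graduality`).
Reflexivity and transitivity are the functoriality of casts; the rules for upcasts and downcasts
are trivial after translation, as one side is by definition a cast of the other; the retract axioms
are the retraction laws of the ep pairs. In the congruence rules for eliminators with an arbitrary
goal, an upcast or a downcast has to be moved out of the branches. This is possible because both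
commute with substitution (`CBPV.Natural`), which by `η` is all that is needed. The rules for
`thunk`, `force`, `ret` and `bind` use the ep pair laws to pass between inequalities below a
downcast and inequalities above an upcast.

CBPV* has substitution for a single variable as a rule of its inequational theory; its closure
under simultaneous substitution (`CBPV.Le.subst_mono`) is established at the start.
-/

namespace Gradual

/-! ### Renaming, substitution and plugging in CBPV* -/

theorem Ren.lift_comp {α : Type} {Γ Γ' Γ'' : List α} {b : α} (r : Ren Γ Γ') (s : Ren Γ' Γ'') :
    (fun a x => s.lift a (r.lift (b := b) a x)) = Ren.lift fun a x => s a (r a x) := by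
  funext a x; cases x <;> rfl

namespace CBPV

@[simp] theorem Sub.lift_z {Γ Γ' : Ctx} {A : VTy} (σ : Sub Γ Γ') :
    σ.lift (A := A) _ .z = .var .z := rfl

@[simp] theorem Sub.lift_s {Γ Γ' : Ctx} {A C : VTy} (σ : Sub Γ Γ') (x : Var Γ C) :
    σ.lift (A := A) _ (.s x) = (σ _ x).wk := rfl

@[simp] theorem Sub.cons_z {Γ Γ' : Ctx} {A : VTy} (V : Tm Γ' (.val A)) (σ : Sub Γ Γ') :
    Sub.cons V σ _ .z = V := rfl

@[simp] theorem Sub.cons_s {Γ Γ' : Ctx} {A C : VTy} (V : Tm Γ' (.val A)) (σ : Sub Γ Γ')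
    (x : Var Γ C) : Sub.cons V σ _ (.s x) = σ _ x := rfl

@[simp] theorem Sub.id_apply {Γ : Ctx} {A : VTy} (x : Var Γ A) : Sub.id _ x = .var x := rfl

theorem Tm.ren_ren {Γ Γ' Γ'' : Ctx} {g : Goal} (E : Tm Γ g) (r : Ren Γ Γ') (s : Ren Γ' Γ'') :
    (E.ren r).ren s = E.ren fun a x => s a (r a x) := by
  induction E generalizing Γ' Γ'' <;> simp only [Tm.ren, Ren.lift_comp, *]

theorem Tm.subst_ren {Γ Γ' Γ'' : Ctx} {g : Goal} (E : Tm Γ g) (r : Ren Γ Γ') (σ : Sub Γ' Γ'') :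
    (E.ren r).subst σ = E.subst fun a x => σ a (r a x) := by
  have lift : ∀ {Γ Γ' Γ'' : Ctx} {A : VTy} (r : Ren Γ Γ') (σ : Sub Γ' Γ''),
      (fun a x => σ.lift (A := A) a (r.lift a x)) = Sub.lift fun a x => σ a (r a x) := by
    intros; funext a x; cases x <;> rfl
  induction E generalizing Γ' Γ'' <;> simp only [Tm.ren, Tm.subst, *]

theorem Tm.ren_subst {Γ Γ' Γ'' : Ctx} {g : Goal} (E : Tm Γ g) (σ : Sub Γ Γ') (r : Ren Γ' Γ'') :
    (E.subst σ).ren r = E.subst fun a x => (σ a x).ren r := by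
  have lift : ∀ {Γ Γ' Γ'' : Ctx} {A : VTy} (σ : Sub Γ Γ') (r : Ren Γ' Γ''),
      (fun a x => (σ.lift (A := A) a x).ren r.lift) = Sub.lift fun a x => (σ a x).ren r := by
    intros; funext a x; cases x
    · rfl
    · simp only [Sub.lift_s, Tm.wk, Tm.ren_ren]; rfl
  induction E generalizing Γ' Γ'' <;> simp only [Tm.ren, Tm.subst, *]

theorem Tm.subst_subst {Γ Γ' Γ'' : Ctx} {g : Goal} (E : Tm Γ g) (σ : Sub Γ Γ')
    (τ : Sub Γ' Γ'') : (E.subst σ).subst τ = E.subst fun a x => (σ a x).subst τ := by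
  have lift : ∀ {Γ Γ' Γ'' : Ctx} {A : VTy} (σ : Sub Γ Γ') (τ : Sub Γ' Γ''),
      (fun a x => (σ.lift (A := A) a x).subst τ.lift) =
        Sub.lift fun a x => (σ a x).subst τ := by
    intros; funext a x; cases x
    · rfl
    · simp only [Sub.lift_s, Tm.wk, Tm.subst_ren, Tm.ren_subst]; rfl
  induction E generalizing Γ' Γ'' <;> simp only [Tm.subst, *]

theorem Sub.lift_id {Γ : Ctx} {A : VTy} : Sub.lift (A := A) (Sub.id (Γ := Γ)) = Sub.id := by
  funext a x; cases x <;> rfl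

@[simp] theorem Tm.subst_id {Γ : Ctx} {g : Goal} (E : Tm Γ g) : E.subst Sub.id = E := by
  induction E <;> simp only [Tm.subst, Sub.lift_id, Sub.id_apply, *]

/-- Renamings are the substitutions of variables. -/
theorem Tm.ren_eq_subst {Γ Γ' : Ctx} {g : Goal} (E : Tm Γ g) (r : Ren Γ Γ') :
    E.ren r = E.subst fun _ x => .var (r _ x) := by
  conv_lhs => rw [← (E.ren r).subst_id, Tm.subst_ren]
  rfl

theorem Tm.subst_congr {Γ Γ' : Ctx} {g : Goal} (E : Tm Γ g) {σ τ : Sub Γ Γ'}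
    (h : ∀ A (x : Var Γ A), σ A x = τ A x) : E.subst σ = E.subst τ := by
  congr 1; funext A x; exact h A x

theorem Tm.subst_eq_self {Γ : Ctx} {g : Goal} (E : Tm Γ g) {σ : Sub Γ Γ}
    (h : ∀ A (x : Var Γ A), σ A x = .var x) : E.subst σ = E :=
  (E.subst_congr h).trans E.subst_id

section fill
variable {Γ : Ctx} {Δ : Stoup} {B₁ B₂ : CTy} (N : Tm Γ (.comp Δ B₁))

@[simp] theorem Tm.fill_hole' : Tm.fill (.hole) N = N := rfl
@[simp] theorem Tm.fill_abort (V : Tm Γ (.val .zero)) :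
    Tm.fill (B₂ := B₂) (.abort V) N = .abort V := rfl
@[simp] theorem Tm.fill_caseOf {A₁ A₂ : VTy} (V : Tm Γ (.val (.sum A₁ A₂)))
    (E₁ : Tm (A₁ :: Γ) (.comp (some B₁) B₂)) (E₂ : Tm (A₂ :: Γ) (.comp (some B₁) B₂)) :
    Tm.fill (.caseOf V E₁ E₂) N = .caseOf V (E₁.fill N.wk) (E₂.fill N.wk) := rfl
@[simp] theorem Tm.fill_letUnit (V : Tm Γ (.val .one)) (E : Tm Γ (.comp (some B₁) B₂)) :
    Tm.fill (.letUnit V E) N = .letUnit V (E.fill N) := rfl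
@[simp] theorem Tm.fill_letPair {A₁ A₂ : VTy} (V : Tm Γ (.val (.prod A₁ A₂)))
    (E : Tm (A₂ :: A₁ :: Γ) (.comp (some B₁) B₂)) :
    Tm.fill (.letPair V E) N = .letPair V (E.fill N.wk.wk) := rfl
@[simp] theorem Tm.fill_bind {A : VTy} (M : Tm Γ (.comp (some B₁) (.F A)))
    (L : Tm (A :: Γ) (.comp none B₂)) : Tm.fill (.bind M L) N = .bind (M.fill N) L := rfl
@[simp] theorem Tm.fill_lam {A : VTy} (M : Tm (A :: Γ) (.comp (some B₁) B₂)) :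
    Tm.fill (.lam M) N = .lam (M.fill N.wk) := rfl
@[simp] theorem Tm.fill_app {A : VTy} (M : Tm Γ (.comp (some B₁) (.arr A B₂)))
    (V : Tm Γ (.val A)) : Tm.fill (.app M V) N = .app (M.fill N) V := rfl
@[simp] theorem Tm.fill_topI : Tm.fill (.topI) N = .topI := rfl
@[simp] theorem Tm.fill_ampI {B₃ : CTy} (M : Tm Γ (.comp (some B₁) B₂))
    (L : Tm Γ (.comp (some B₁) B₃)) :
    Tm.fill (.ampI M L) N = .ampI (M.fill N) (L.fill N) := rfl
@[simp] theorem Tm.fill_fst {B₃ : CTy} (M : Tm Γ (.comp (some B₁) (.amp B₂ B₃))) :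
    Tm.fill (.fst M) N = .fst (M.fill N) := rfl
@[simp] theorem Tm.fill_snd {B₃ : CTy} (M : Tm Γ (.comp (some B₁) (.amp B₂ B₃))) :
    Tm.fill (.snd M) N = .snd (M.fill N) := rfl
@[simp] theorem Tm.fill_letRoll {A : Ty [.val] .val} (V : Tm Γ (.val (.mu A)))
    (E : Tm (A.inst (.mu A) :: Γ) (.comp (some B₁) B₂)) :
    Tm.fill (.letRoll V E) N = .letRoll V (E.fill N.wk) := rfl
@[simp] theorem Tm.fill_rollC {B : Ty [.comp] .comp}
    (M : Tm Γ (.comp (some B₁) (B.inst (.nu B)))) :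
    Tm.fill (.rollC M) N = .rollC (M.fill N) := rfl
@[simp] theorem Tm.fill_unroll {B : Ty [.comp] .comp} (M : Tm Γ (.comp (some B₁) (.nu B))) :
    Tm.fill (.unroll M) N = .unroll (M.fill N) := rfl
end fill

theorem Tm.wk_ren {Γ Γ' : Ctx} {A : VTy} {g : Goal} (E : Tm Γ g) (r : Ren Γ Γ') :
    (E.wk (A := A)).ren r.lift = (E.ren r).wk := by
  simp only [Tm.wk, Tm.ren_ren]; rfl

theorem Tm.wk_subst {Γ Γ' : Ctx} {A : VTy} {g : Goal} (E : Tm Γ g) (σ : Sub Γ Γ') :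
    (E.wk (A := A)).subst σ.lift = (E.subst σ).wk := by
  simp only [Tm.wk, Tm.subst_ren, Tm.ren_subst]; rfl

@[simp] theorem Tm.wk_subst_cons {Γ Γ' : Ctx} {A : VTy} {g : Goal} (E : Tm Γ g) (σ : Sub Γ Γ')
    (V : Tm Γ' (.val A)) : E.wk.subst (Sub.cons V σ) = E.subst σ := by
  simp only [Tm.wk, Tm.subst_ren]; rfl

/-- Induction on a stack: the induction principle of `Tm` restricted to non-empty stoups. -/
@[elab_as_elim]
theorem Tm.stackInduction {B₁ : CTy}
    {P : ∀ {Γ : Ctx} {B₂ : CTy}, Tm Γ (.comp (some B₁) B₂) → Prop}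
    (hole : ∀ {Γ}, P (Γ := Γ) .hole)
    (abort : ∀ {Γ B₂} (V : Tm Γ (.val .zero)), P (B₂ := B₂) (.abort V))
    (caseOf : ∀ {Γ B₂ A₁ A₂} (V : Tm Γ (.val (.sum A₁ A₂))) (E₁ : Tm (A₁ :: Γ) _)
      (E₂ : Tm (A₂ :: Γ) _), P E₁ → P E₂ → P (B₂ := B₂) (.caseOf V E₁ E₂))
    (letUnit : ∀ {Γ B₂} (V : Tm Γ (.val .one)) (E : Tm Γ _), P E → P (B₂ := B₂) (.letUnit V E))
    (letPair : ∀ {Γ B₂ A₁ A₂} (V : Tm Γ (.val (.prod A₁ A₂))) (E : Tm (A₂ :: A₁ :: Γ) _),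
      P E → P (B₂ := B₂) (.letPair V E))
    (bind : ∀ {Γ B₂ A} (M : Tm Γ (.comp (some B₁) (.F A))) (N : Tm (A :: Γ) (.comp none B₂)),
      P M → P (.bind M N))
    (lam : ∀ {Γ A B₂} (M : Tm (A :: Γ) (.comp (some B₁) B₂)), P M → P (.lam M))
    (app : ∀ {Γ A B₂} (M : Tm Γ (.comp (some B₁) (.arr A B₂))) (V : Tm Γ (.val A)),
      P M → P (.app M V))
    (topI : ∀ {Γ}, P (Γ := Γ) .topI)
    (ampI : ∀ {Γ B₂ B₃} (M : Tm Γ (.comp (some B₁) B₂)) (N : Tm Γ (.comp (some B₁) B₃)),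
      P M → P N → P (.ampI M N))
    (fst : ∀ {Γ B₂ B₃} (M : Tm Γ (.comp (some B₁) (.amp B₂ B₃))), P M → P (.fst M))
    (snd : ∀ {Γ B₂ B₃} (M : Tm Γ (.comp (some B₁) (.amp B₂ B₃))), P M → P (.snd M))
    (letRoll : ∀ {Γ B₂} {A : Ty [.val] .val} (V : Tm Γ (.val (.mu A)))
      (E : Tm (A.inst (.mu A) :: Γ) _), P E → P (B₂ := B₂) (.letRoll V E))
    (rollC : ∀ {Γ} {B : Ty [.comp] .comp} (M : Tm Γ (.comp (some B₁) (B.inst (.nu B)))),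
      P M → P (.rollC M))
    (unroll : ∀ {Γ} {B : Ty [.comp] .comp} (M : Tm Γ (.comp (some B₁) (.nu B))),
      P M → P (.unroll M))
    {Γ : Ctx} {B₂ : CTy} (S : Tm Γ (.comp (some B₁) B₂)) : P S := by
  suffices ∀ {Γ : Ctx} {g : Goal} (S : Tm Γ g) {B₂ : CTy} (h : g = .comp (some B₁) B₂),
      P (h ▸ S) from this S rfl
  intro Γ g S
  induction S with
  | hole => intro _ h; cases h; exact hole
  | abort V _ => intro _ h; cases h; exact abort V
  | caseOf V E₁ E₂ _ ih₁ ih₂ => intro _ h; cases h; exact caseOf V E₁ E₂ (ih₁ rfl) (ih₂ rfl)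
  | letUnit V E _ ih => intro _ h; cases h; exact letUnit V E (ih rfl)
  | letPair V E _ ih => intro _ h; cases h; exact letPair V E (ih rfl)
  | bind M N ih _ => intro _ h; cases h; exact bind M N (ih rfl)
  | lam M ih => intro _ h; cases h; exact lam M (ih rfl)
  | app M V ih _ => intro _ h; cases h; exact app M V (ih rfl)
  | topI => intro _ h; cases h; exact topI
  | ampI M N ih₁ ih₂ => intro _ h; cases h; exact ampI M N (ih₁ rfl) (ih₂ rfl)
  | fst M ih => intro _ h; cases h; exact fst M (ih rfl)
  | snd M ih => intro _ h; cases h; exact snd M (ih rfl)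
  | letRoll V E _ ih => intro _ h; cases h; exact letRoll V E (ih rfl)
  | rollC M ih => intro _ h; cases h; exact rollC M (ih rfl)
  | unroll M ih => intro _ h; cases h; exact unroll M (ih rfl)
  | _ => intro _ h; cases h

theorem Tm.fill_ren {Γ Γ' : Ctx} {Δ : Stoup} {B₁ B₂ : CTy} (S : Tm Γ (.comp (some B₁) B₂))
    (N : Tm Γ (.comp Δ B₁)) (r : Ren Γ Γ') :
    (S.fill N).ren r = (S.ren r).fill (N.ren r) := by
  induction S using Tm.stackInduction generalizing Γ' <;> simp_all [Tm.ren, Tm.wk_ren]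

theorem Tm.fill_wk {Γ : Ctx} {Δ : Stoup} {A : VTy} {B₁ B₂ : CTy}
    (S : Tm Γ (.comp (some B₁) B₂)) (N : Tm Γ (.comp Δ B₁)) :
    (S.fill N).wk (A := A) = S.wk.fill N.wk := S.fill_ren N _

theorem Tm.fill_subst {Γ Γ' : Ctx} {Δ : Stoup} {B₁ B₂ : CTy} (S : Tm Γ (.comp (some B₁) B₂))
    (N : Tm Γ (.comp Δ B₁)) (σ : Sub Γ Γ') :
    (S.fill N).subst σ = (S.subst σ).fill (N.subst σ) := by
  induction S using Tm.stackInduction generalizing Γ' <;> simp_all [Tm.subst, Tm.wk_subst]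

theorem Tm.fill_fill {Γ : Ctx} {Δ : Stoup} {B₁ B₂ B₃ : CTy} (S : Tm Γ (.comp (some B₂) B₃))
    (T : Tm Γ (.comp (some B₁) B₂)) (N : Tm Γ (.comp Δ B₁)) :
    (S.fill T).fill N = S.fill (T.fill N) := by
  induction S using Tm.stackInduction <;> simp_all [Tm.fill_wk]

@[simp] theorem Tm.fill_hole {Γ : Ctx} {B₁ B₂ : CTy} (S : Tm Γ (.comp (some B₁) B₂)) :
    S.fill .hole = S := by
  have wk : ∀ {Γ A B}, Tm.wk (A := A) (.hole : Tm Γ (.comp (some B) B)) = .hole := rfl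
  induction S using Tm.stackInduction <;> simp_all


/-! ### The inequational theory is closed under simultaneous substitution -/

/-- Splitting a substitution into its action on the older variables and on the newest one. -/
theorem Tm.subst_eq_lift_cons {Γ Γ' : Ctx} {A : VTy} {g : Goal} (E : Tm (A :: Γ) g)
    (σ : Sub (A :: Γ) Γ') :
    E.subst σ = (E.subst (Sub.lift fun _ x => σ _ (.s x))).subst (Sub.cons (σ _ .z) Sub.id) := by
  rw [Tm.subst_subst]
  apply Tm.subst_congr; intro C x; cases x
  · rfl
  · simp [Sub.lift]

theorem Tm.subst_cons_lift {Γ Γ' : Ctx} {A : VTy} {g : Goal} (E : Tm (A :: Γ) g)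
    (σ : Sub Γ Γ') (V : Tm Γ' (.val A)) :
    (E.subst σ.lift).subst (Sub.cons V Sub.id) = E.subst (Sub.cons V σ) := by
  rw [E.subst_eq_lift_cons (Sub.cons V σ)]; rfl

theorem Tm.subst_cons_id {Γ Γ' : Ctx} {A : VTy} {g : Goal} (E : Tm (A :: Γ) g)
    (σ : Sub Γ Γ') (V : Tm Γ (.val A)) :
    (E.subst (Sub.cons V Sub.id)).subst σ = E.subst (Sub.cons (V.subst σ) σ) := by
  rw [Tm.subst_subst]; apply Tm.subst_congr; intro C x; cases x <;> rfl

/-- The `η` laws are axioms about a variable, so after substitution they are recovered by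
substituting for the older variables first, and then for the newest one. -/
theorem Le.betaEta_subst {Γ Γ' : Ctx} {g : Goal} {E E' : Tm Γ g} (h : BetaEta E E')
    (σ : Sub Γ Γ') : Eqv (E.subst σ) (E'.subst σ) := by
  have of : ∀ {Γ : Ctx} {g : Goal} {E E' : Tm Γ g}, BetaEta E E' → Eqv E E' :=
    fun h => ⟨.betaEtaL h, .betaEtaR h⟩
  have plugVar : ∀ {Γ Γ' : Ctx} {A : VTy} {g : Goal} {E E' : Tm (A :: Γ) g} (σ : Sub (A :: Γ) Γ'),
      Eqv (E.subst (Sub.lift fun _ x => σ _ (.s x))) (E'.subst (Sub.lift fun _ x => σ _ (.s x))) →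
      Eqv (E.subst σ) (E'.subst σ) := by
    intro Γ Γ' A g E E' σ h
    rw [E.subst_eq_lift_cons, E'.subst_eq_lift_cons]
    exact ⟨.valSubst (Ξ := []) (.refl _) h.1, .valSubst (Ξ := []) (.refl _) h.2⟩
  cases h with
  | sumBetaL V E₁ E₂ =>
    rw [Tm.subst_cons_id, ← Tm.subst_cons_lift]; exact of (.sumBetaL _ _ _)
  | sumBetaR V E₁ E₂ =>
    rw [Tm.subst_cons_id, ← Tm.subst_cons_lift]; exact of (.sumBetaR _ _ _)
  | sumEta E =>
    apply plugVar
    convert of (.sumEta _) using 1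
    simp only [Tm.subst, Tm.subst_subst, Sub.lift_z]
    congr 1 <;>
    · apply Tm.subst_congr; intro C x; cases x
      · rfl
      · simp only [Sub.cons_s, Tm.subst, Sub.lift_s, Tm.wk, Tm.ren_eq_subst, Tm.subst_subst,
          Ren.wk]
  | zeroEta E => exact plugVar _ (of (.zeroEta _))
  | prodBeta V₁ V₂ E =>
    have : E.subst (Sub.cons (V₂.subst σ) (Sub.cons (V₁.subst σ) σ)) =
        (E.subst σ.lift.lift).subst
          (Sub.cons (V₂.subst σ) (Sub.cons (V₁.subst σ) Sub.id)) := by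
      rw [Tm.subst_subst]; apply Tm.subst_congr; intro C x
      rcases x with _ | _ | x <;> simp [Tm.subst]
    have h : (E.subst (Sub.cons V₂ (Sub.cons V₁ Sub.id))).subst σ =
        E.subst (Sub.cons (V₂.subst σ) (Sub.cons (V₁.subst σ) σ)) := by
      rw [Tm.subst_subst]; apply Tm.subst_congr; intro C x
      rcases x with _ | _ | x <;> rfl
    rw [h, this]; exact of (.prodBeta _ _ _)
  | prodEta E =>
    apply plugVar
    convert of (.prodEta _) using 1
    simp only [Tm.subst, Tm.subst_subst, Sub.lift_z]
    congr 1
    apply Tm.subst_congr; intro C x; cases x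
    · rfl
    · simp only [Sub.cons_s, Tm.subst, Sub.lift_s, Tm.wk, Tm.ren_eq_subst, Tm.subst_subst,
          Ren.wk]
  | oneBeta E => exact of (.oneBeta _)
  | oneEta E =>
    apply plugVar
    convert of (.oneEta _) using 1
    simp only [Tm.subst, Tm.subst_subst, Sub.lift_z]
    congr 1
    apply Tm.subst_congr; intro C x; cases x
    · rfl
    · simp only [Sub.cons_s, Tm.subst, Sub.lift_s, Tm.wk, Tm.ren_eq_subst, Tm.subst_subst,
          Ren.wk]
  | UBeta M => exact of (.UBeta _)
  | UEta => exact plugVar _ (of .UEta)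
  | FBeta V M => rw [Tm.subst_cons_id, ← Tm.subst_cons_lift]; exact of (.FBeta _ _)
  | FEta M =>
    convert of (.FEta _) using 1
    simp only [Tm.subst, Tm.fill_subst, Tm.wk_subst, Sub.lift_z]
  | arrBeta M V => rw [Tm.subst_cons_id, ← Tm.subst_cons_lift]; exact of (.arrBeta _ _)
  | arrEta => exact of .arrEta
  | ampBetaL M₁ M₂ => exact of (.ampBetaL _ _)
  | ampBetaR M₁ M₂ => exact of (.ampBetaR _ _)
  | ampEta => exact of .ampEta
  | topEta => exact of .topEta
  | muBeta V E => rw [Tm.subst_cons_id, ← Tm.subst_cons_lift]; exact of (.muBeta _ _)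
  | muEta E =>
    apply plugVar
    convert of (.muEta _) using 1
    simp only [Tm.subst, Tm.subst_subst, Sub.lift_z]
    congr 1
    apply Tm.subst_congr; intro C x; cases x
    · rfl
    · simp only [Sub.cons_s, Tm.subst, Sub.lift_s, Tm.wk, Tm.ren_eq_subst, Tm.subst_subst,
          Ren.wk]
  | nuBeta M => exact of (.nuBeta _)
  | nuEta => exact of .nuEta

/-- Substitution into a fixed term is monotone. The hypothesis is made stable under renaming
because it has to be carried under binders. -/
theorem Le.subst_right {Γ Γ' : Ctx} {g : Goal} (E : Tm Γ g) {σ τ : Sub Γ Γ'}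
    (h : ∀ A (x : Var Γ A) (Γ'' : Ctx) (r : Ren Γ' Γ''), Le ((σ A x).ren r) ((τ A x).ren r)) :
    Le (E.subst σ) (E.subst τ) := by
  have lift : ∀ {Γ Γ' : Ctx} {C : VTy} {σ τ : Sub Γ Γ'},
      (∀ A (x : Var Γ A) (Γ'' : Ctx) (r : Ren Γ' Γ''), Le ((σ A x).ren r) ((τ A x).ren r)) →
      ∀ A (x : Var (C :: Γ) A) (Γ'' : Ctx) (r : Ren (C :: Γ') Γ''),
        Le ((σ.lift A x).ren r) ((τ.lift A x).ren r) := by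
    intro Γ Γ' C σ τ h A x Γ'' r
    cases x with
    | z => exact .refl _
    | s x => simp only [Sub.lift_s, Tm.wk, Tm.ren_ren]; exact h _ _ _ _
  induction E generalizing Γ' with
  | var x =>
    have := h _ x _ (fun _ y => y)
    simpa only [Tm.ren_eq_subst, Tm.subst_eq_self _ fun _ _ => rfl, Tm.subst] using this
  | hole => exact .refl _
  | err => exact .refl _
  | abort V ih => exact .abort (ih h)
  | inl V ih => exact .inl (ih h)
  | inr V ih => exact .inr (ih h)
  | caseOf V E₁ E₂ ih ih₁ ih₂ => exact .caseOf (ih h) (ih₁ (lift h)) (ih₂ (lift h))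
  | unit => exact .refl _
  | letUnit V E ih ih' => exact .letUnit (ih h) (ih' h)
  | pair V W ih ih' => exact .pair (ih h) (ih' h)
  | letPair V E ih ih' => exact .letPair (ih h) (ih' (lift (lift h)))
  | thunk M ih => exact .thunk (ih h)
  | force V ih => exact .force (ih h)
  | ret V ih => exact .ret (ih h)
  | bind M N ih ih' => exact .bind (ih h) (ih' (lift h))
  | lam M ih => exact .lam (ih (lift h))
  | app M V ih ih' => exact .app (ih h) (ih' h)
  | topI => exact .refl _
  | ampI M N ih ih' => exact .ampI (ih h) (ih' h)
  | fst M ih => exact .fst (ih h)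
  | snd M ih => exact .snd (ih h)
  | roll V ih => exact .roll (ih h)
  | letRoll V E ih ih' => exact .letRoll (ih h) (ih' (lift h))
  | rollC M ih => exact .rollC (ih h)
  | unroll M ih => exact .unroll (ih h)

/-- The values of `[V/x]` are variables, except for a weakening of `V`. -/
theorem Sub.at_cases {Γ : Ctx} {A : VTy} (Ξ : Ctx) {C : VTy} (x : Var (Ξ ++ A :: Γ) C) :
    (∃ y : Var (Ξ ++ Γ) C, ∀ V : Tm Γ (.val A), Sub.at V Ξ C x = .var y) ∨
    (∃ (h : A = C) (r : Ren Γ (Ξ ++ Γ)), ∀ V : Tm Γ (.val A),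
      Sub.at V Ξ C x = h ▸ V.ren r) := by
  induction Ξ with
  | nil =>
    cases x with
    | z =>
      refine .inr ⟨rfl, fun _ y => y, fun V => ?_⟩
      exact ((V.ren_eq_subst _).trans V.subst_id).symm
    | s x => exact .inl ⟨x, fun V => rfl⟩
  | cons D Ξ ih =>
    cases x with
    | z => exact .inl ⟨.z, fun V => rfl⟩
    | s x =>
      rcases ih x with ⟨y, h⟩ | ⟨rfl, r, h⟩
      · exact .inl ⟨.s y, fun V => by simp only [Sub.at, Sub.lift, h]; rfl⟩
      · exact .inr ⟨rfl, fun _ y => .s (r _ y), fun V => by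
          simp only [Sub.at, Sub.lift, h, Tm.wk, Tm.ren_ren]; rfl⟩

/-- The theory is generated with substitution for one variable only; this is its closure under
simultaneous substitution. -/
theorem Le.subst {Γ Γ' : Ctx} {g : Goal} {E E' : Tm Γ g} (h : Le E E') (σ : Sub Γ Γ') :
    Le (E.subst σ) (E'.subst σ) := by
  induction h generalizing Γ' with
  | refl E => exact .refl _
  | trans _ _ ih ih' => exact (ih σ).trans (ih' σ)
  | @valSubst Γ Ξ A g V V' E E' _ _ ihV ihE =>
    rw [Tm.subst_subst, Tm.subst_subst]
    refine (ihE _).trans (Le.subst_right _ fun C x Γ'' r => ?_)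
    rcases Sub.at_cases Ξ x with ⟨y, h⟩ | ⟨rfl, s, h⟩
    · rw [h, h]; exact .refl _
    · rw [h, h]
      simp only [Tm.subst_ren, Tm.ren_subst]
      exact ihV _
  | stkSubst _ _ ih ih' => rw [Tm.fill_subst, Tm.fill_subst]; exact .stkSubst (ih σ) (ih' σ)
  | abort _ ih => exact .abort (ih σ)
  | inl _ ih => exact .inl (ih σ)
  | inr _ ih => exact .inr (ih σ)
  | caseOf _ _ _ ih ih₁ ih₂ => exact .caseOf (ih σ) (ih₁ _) (ih₂ _)
  | letUnit _ _ ih ih' => exact .letUnit (ih σ) (ih' σ)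
  | pair _ _ ih ih' => exact .pair (ih σ) (ih' σ)
  | letPair _ _ ih ih' => exact .letPair (ih σ) (ih' _)
  | thunk _ ih => exact .thunk (ih σ)
  | force _ ih => exact .force (ih σ)
  | ret _ ih => exact .ret (ih σ)
  | bind _ _ ih ih' => exact .bind (ih σ) (ih' _)
  | lam _ ih => exact .lam (ih _)
  | app _ _ ih ih' => exact .app (ih σ) (ih' σ)
  | ampI _ _ ih ih' => exact .ampI (ih σ) (ih' σ)
  | fst _ ih => exact .fst (ih σ)
  | snd _ ih => exact .snd (ih σ)
  | roll _ ih => exact .roll (ih σ)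
  | letRoll _ _ ih ih' => exact .letRoll (ih σ) (ih' _)
  | rollC _ ih => exact .rollC (ih σ)
  | unroll _ ih => exact .unroll (ih σ)
  | betaEtaL h => exact (Le.betaEta_subst h σ).1
  | betaEtaR h => exact (Le.betaEta_subst h σ).2
  | errBot M => exact .errBot _
  | stkStrict S => rw [Tm.fill_subst]; exact .stkStrict _

theorem Le.ren {Γ Γ' : Ctx} {g : Goal} {E E' : Tm Γ g} (h : Le E E') (r : Ren Γ Γ') :
    Le (E.ren r) (E'.ren r) := by
  rw [Tm.ren_eq_subst, Tm.ren_eq_subst]; exact h.subst _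

theorem Le.wk {Γ : Ctx} {A : VTy} {g : Goal} {E E' : Tm Γ g} (h : Le E E') :
    Le (E.wk (A := A)) E'.wk := h.ren _

theorem Le.subst_mono {Γ Γ' : Ctx} {g : Goal} {E E' : Tm Γ g} {σ τ : Sub Γ Γ'} (h : Le E E')
    (hσ : ∀ A (x : Var Γ A), Le (σ A x) (τ A x)) : Le (E.subst σ) (E'.subst τ) :=
  (h.subst σ).trans (Le.subst_right _ fun A x _ r => (hσ A x).ren r)

/-! ### Closed values and stacks as operations -/

@[simp] theorem Tm.put_subst {Γ Γ' : Ctx} {A A' : VTy} (V : Tm [A] (.val A'))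
    (W : Tm Γ (.val A)) (σ : Sub Γ Γ') : (V.put W).subst σ = V.put (W.subst σ) := by
  rw [Tm.put, Tm.put, Tm.subst_subst]
  apply Tm.subst_congr; intro C x; rcases x with _ | ⟨⟨⟩⟩; rfl

@[simp] theorem Tm.put_ren {Γ Γ' : Ctx} {A A' : VTy} (V : Tm [A] (.val A'))
    (W : Tm Γ (.val A)) (r : Ren Γ Γ') : (V.put W).ren r = V.put (W.ren r) := by
  simp only [Tm.ren_eq_subst, Tm.put_subst]

@[simp] theorem Tm.put_wk {Γ : Ctx} {A A' C : VTy} (V : Tm [A] (.val A'))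
    (W : Tm Γ (.val A)) : (V.put W).wk (A := C) = V.put W.wk := V.put_ren W _

@[simp] theorem Tm.put_put {Γ : Ctx} {A A' A'' : VTy} (V : Tm [A'] (.val A''))
    (W : Tm [A] (.val A')) (X : Tm Γ (.val A)) : (V.put W).put X = V.put (W.put X) :=
  V.put_subst W _

@[simp] theorem Tm.var_put {Γ : Ctx} {A : VTy} (W : Tm Γ (.val A)) :
    Tm.put (.var .z) W = W := rfl

@[simp] theorem Tm.put_var {A A' : VTy} (V : Tm [A] (.val A')) : V.put (.var .z) = V :=
  V.subst_eq_self fun C x => by rcases x with _ | ⟨⟨⟩⟩; rfl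

@[simp] theorem Tm.on_subst {Γ Γ' : Ctx} {Δ : Stoup} {B₁ B₂ : CTy}
    (S : Tm [] (.comp (some B₁) B₂)) (N : Tm Γ (.comp Δ B₁)) (σ : Sub Γ Γ') :
    (S.on N).subst σ = S.on (N.subst σ) := by
  rw [Tm.on, Tm.on, Tm.fill_subst, Tm.subst_ren, Tm.ren_eq_subst]
  congr 1; apply Tm.subst_congr; rintro C ⟨⟩

@[simp] theorem Tm.on_ren {Γ Γ' : Ctx} {Δ : Stoup} {B₁ B₂ : CTy}
    (S : Tm [] (.comp (some B₁) B₂)) (N : Tm Γ (.comp Δ B₁)) (r : Ren Γ Γ') :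
    (S.on N).ren r = S.on (N.ren r) := by
  simp only [Tm.ren_eq_subst, Tm.on_subst]

@[simp] theorem Tm.on_wk {Γ : Ctx} {Δ : Stoup} {A : VTy} {B₁ B₂ : CTy}
    (S : Tm [] (.comp (some B₁) B₂)) (N : Tm Γ (.comp Δ B₁)) :
    (S.on N).wk (A := A) = S.on N.wk := S.on_ren N _

@[simp] theorem Tm.on_fill {Γ : Ctx} {Δ : Stoup} {B₁ B₂ B₃ : CTy}
    (S : Tm [] (.comp (some B₂) B₃)) (T : Tm Γ (.comp (some B₁) B₂)) (N : Tm Γ (.comp Δ B₁)) :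
    (S.on T).fill N = S.on (T.fill N) := Tm.fill_fill _ _ _

@[simp] theorem Tm.on_hole {B₁ B₂ : CTy} (S : Tm [] (.comp (some B₁) B₂)) :
    S.on .hole = S := by
  rw [Tm.on, Tm.fill_hole, Tm.ren_eq_subst]; exact S.subst_eq_self fun _ x => nomatch x

@[simp] theorem Tm.hole_on {Γ : Ctx} {Δ : Stoup} {B : CTy} (N : Tm Γ (.comp Δ B)) :
    Tm.on .hole N = N := rfl

@[simp] theorem Tm.on_on {Γ : Ctx} {Δ : Stoup} {B₁ B₂ B₃ : CTy}
    (S : Tm [] (.comp (some B₂) B₃)) (T : Tm [] (.comp (some B₁) B₂)) (N : Tm Γ (.comp Δ B₁)) :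
    (S.on T).on N = S.on (T.on N) := by
  rw [Tm.on, Tm.on_ren, Tm.on_fill]; rfl

theorem Le.put {Γ : Ctx} {A A' : VTy} {V V' : Tm [A] (.val A')} {W W' : Tm Γ (.val A)}
    (h : Le V V') (h' : Le W W') : Le (V.put W) (V'.put W') :=
  h.subst_mono fun C x => by rcases x with _ | ⟨⟨⟩⟩; exact h'

theorem Le.on {Γ : Ctx} {Δ : Stoup} {B₁ B₂ : CTy} {S S' : Tm [] (.comp (some B₁) B₂)}
    {N N' : Tm Γ (.comp Δ B₁)} (h : Le S S') (h' : Le N N') : Le (S.on N) (S'.on N') :=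
  .stkSubst h' (h.ren _)

/-! ### Equational reasoning -/

namespace Eqv
variable {Γ : Ctx} {Δ : Stoup} {A A' A₁ A₂ : VTy} {B B₁ B₂ : CTy} {g : Goal}

theorem refl (E : Tm Γ g) : Eqv E E := ⟨.refl E, .refl E⟩
theorem of_eq {E E' : Tm Γ g} (h : E = E') : Eqv E E' := h ▸ refl E
theorem symm {E E' : Tm Γ g} (h : Eqv E E') : Eqv E' E := ⟨h.2, h.1⟩
theorem trans {E E' E'' : Tm Γ g} (h : Eqv E E') (h' : Eqv E' E'') : Eqv E E'' :=
  ⟨h.1.trans h'.1, h'.2.trans h.2⟩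
theorem betaEta {E E' : Tm Γ g} (h : BetaEta E E') : Eqv E E' := ⟨.betaEtaL h, .betaEtaR h⟩
theorem subst {Γ' : Ctx} {E E' : Tm Γ g} (h : Eqv E E') (σ : Sub Γ Γ') :
    Eqv (E.subst σ) (E'.subst σ) := ⟨h.1.subst σ, h.2.subst σ⟩

theorem put (V : Tm [A] (.val A')) {W W' : Tm Γ (.val A)} (h : Eqv W W') :
    Eqv (V.put W) (V.put W') := ⟨.put (.refl _) h.1, .put (.refl _) h.2⟩
theorem on (S : Tm [] (.comp (some B₁) B₂)) {N N' : Tm Γ (.comp Δ B₁)} (h : Eqv N N') :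
    Eqv (S.on N) (S.on N') := ⟨.on (.refl _) h.1, .on (.refl _) h.2⟩
theorem fill {S S' : Tm Γ (.comp (some B₁) B₂)} (h : Eqv S S') (N : Tm Γ (.comp Δ B₁)) :
    Eqv (S.fill N) (S'.fill N) := ⟨.stkSubst (.refl _) h.1, .stkSubst (.refl _) h.2⟩
theorem inl {V V' : Tm Γ (.val A₁)} (h : Eqv V V') :
    Eqv (g := .val (.sum A₁ A₂)) (.inl V) (.inl V') := ⟨.inl h.1, .inl h.2⟩
theorem inr {V V' : Tm Γ (.val A₂)} (h : Eqv V V') :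
    Eqv (g := .val (.sum A₁ A₂)) (.inr V) (.inr V') := ⟨.inr h.1, .inr h.2⟩
theorem caseOf {V V' : Tm Γ (.val (.sum A₁ A₂))} {E₁ E₁' : Tm (A₁ :: Γ) g}
    {E₂ E₂' : Tm (A₂ :: Γ) g} (h : Eqv V V') (h₁ : Eqv E₁ E₁') (h₂ : Eqv E₂ E₂') :
    Eqv (.caseOf V E₁ E₂) (.caseOf V' E₁' E₂') :=
  ⟨.caseOf h.1 h₁.1 h₂.1, .caseOf h.2 h₁.2 h₂.2⟩
theorem pair {V V' : Tm Γ (.val A₁)} {W W' : Tm Γ (.val A₂)} (h : Eqv V V') (h' : Eqv W W') :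
    Eqv (.pair V W) (.pair V' W') := ⟨.pair h.1 h'.1, .pair h.2 h'.2⟩
theorem letPair {V V' : Tm Γ (.val (.prod A₁ A₂))} {E E' : Tm (A₂ :: A₁ :: Γ) g} (h : Eqv V V')
    (h' : Eqv E E') : Eqv (.letPair V E) (.letPair V' E') := ⟨.letPair h.1 h'.1, .letPair h.2 h'.2⟩
theorem thunk {M M' : Tm Γ (.comp none B)} (h : Eqv M M') : Eqv (.thunk M) (.thunk M') :=
  ⟨.thunk h.1, .thunk h.2⟩
theorem force {V V' : Tm Γ (.val (.U B))} (h : Eqv V V') : Eqv (.force V) (.force V') :=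
  ⟨.force h.1, .force h.2⟩
theorem ret {V V' : Tm Γ (.val A)} (h : Eqv V V') : Eqv (.ret V) (.ret V') :=
  ⟨.ret h.1, .ret h.2⟩
theorem bind {M M' : Tm Γ (.comp Δ (.F A))} {N N' : Tm (A :: Γ) (.comp none B)} (h : Eqv M M')
    (h' : Eqv N N') : Eqv (.bind M N) (.bind M' N') := ⟨.bind h.1 h'.1, .bind h.2 h'.2⟩
theorem lam {M M' : Tm (A :: Γ) (.comp Δ B)} (h : Eqv M M') : Eqv (.lam M) (.lam M') :=
  ⟨.lam h.1, .lam h.2⟩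
theorem app {M M' : Tm Γ (.comp Δ (.arr A B))} (h : Eqv M M') (V : Tm Γ (.val A)) :
    Eqv (.app M V) (.app M' V) := ⟨.app h.1 (.refl _), .app h.2 (.refl _)⟩
theorem ampI {M M' : Tm Γ (.comp Δ B₁)} {N N' : Tm Γ (.comp Δ B₂)} (h : Eqv M M')
    (h' : Eqv N N') : Eqv (.ampI M N) (.ampI M' N') := ⟨.ampI h.1 h'.1, .ampI h.2 h'.2⟩
theorem fst {M M' : Tm Γ (.comp Δ (.amp B₁ B₂))} (h : Eqv M M') : Eqv (.fst M) (.fst M') :=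
  ⟨.fst h.1, .fst h.2⟩
theorem snd {M M' : Tm Γ (.comp Δ (.amp B₁ B₂))} (h : Eqv M M') : Eqv (.snd M) (.snd M') :=
  ⟨.snd h.1, .snd h.2⟩

/-! ### The `η` laws at arbitrary arguments -/

theorem sumEta (E : Tm (.sum A₁ A₂ :: Γ) g) (V : Tm Γ (.val (.sum A₁ A₂))) :
    Eqv (E.subst (Sub.cons V Sub.id)) (.caseOf V
      (E.subst (Sub.cons (.inl (.var .z)) fun _ x => .var (.s x)))
      (E.subst (Sub.cons (.inr (.var .z)) fun _ x => .var (.s x)))) := by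
  convert (betaEta (.sumEta E)).subst (Sub.cons V Sub.id) using 1
  simp only [Tm.subst, Tm.subst_subst, Sub.cons_z]
  congr 1 <;> (apply Tm.subst_congr; intro C x; cases x <;> rfl)

theorem prodEta (E : Tm (.prod A₁ A₂ :: Γ) g) (V : Tm Γ (.val (.prod A₁ A₂))) :
    Eqv (E.subst (Sub.cons V Sub.id)) (.letPair V
      (E.subst (Sub.cons (.pair (.var (.s .z)) (.var .z)) fun _ x => .var (.s (.s x))))) := by
  convert (betaEta (.prodEta E)).subst (Sub.cons V Sub.id) using 1
  simp only [Tm.subst, Tm.subst_subst, Sub.cons_z]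
  congr 1; apply Tm.subst_congr; intro C x; cases x <;> rfl

theorem oneEta (E : Tm (.one :: Γ) g) (V : Tm Γ (.val .one)) :
    Eqv (E.subst (Sub.cons V Sub.id)) (.letUnit V (E.subst (Sub.cons .unit Sub.id))) := by
  convert (betaEta (.oneEta E)).subst (Sub.cons V Sub.id) using 1
  simp only [Tm.subst, Tm.subst_subst, Sub.cons_z]
  congr 1; apply Tm.subst_congr; intro C x; cases x <;> rfl

/-- In the presence of a value of the empty type every term equals its elimination. -/
theorem zeroEta (V : Tm Γ (.val .zero)) (E : Tm Γ g) : Eqv E (.abort V) := by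
  have := (betaEta (.zeroEta (E.wk (A := .zero)))).subst (Sub.cons V Sub.id)
  rwa [Tm.wk_subst_cons, Tm.subst_id] at this

theorem UEta (V : Tm Γ (.val (.U B))) : Eqv V (.thunk (.force V)) :=
  (betaEta (.UEta (Γ := Γ))).subst (Sub.cons V Sub.id)

theorem FEta (M : Tm Γ (.comp Δ (.F A))) : Eqv M (.bind M (.ret (.var .z))) :=
  (betaEta (.FEta .hole)).fill M

/-- Stacks commute with `bind`. -/
theorem fill_bind (S : Tm Γ (.comp (some B₁) B₂)) (M : Tm Γ (.comp Δ (.F A)))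
    (N : Tm (A :: Γ) (.comp none B₁)) :
    Eqv (S.fill (.bind M N)) (.bind M (S.wk.fill N)) := by
  have h := (betaEta (.FEta (S.fill (.bind .hole N)))).fill M
  simp only [Tm.fill_fill, Tm.fill_bind, Tm.fill_hole', Tm.fill_wk] at h
  refine h.trans (bind (refl _) ?_)
  have e : Tm.fill (Tm.wk (A := A) (.bind .hole N)) (.ret (.var .z)) =
      .bind (.ret (.var .z)) (N.ren (Ren.lift Ren.wk)) := rfl
  rw [e]
  have h' := betaEta (.FBeta (.var .z) (N.ren (Ren.lift (b := A) Ren.wk)))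
  rw [Tm.subst_ren, Tm.subst_eq_self] at h'
  · exact ⟨.stkSubst h'.1 (.refl _), .stkSubst h'.2 (.refl _)⟩
  · intro C x; cases x <;> rfl

theorem on_bind (S : Tm [] (.comp (some B₁) B₂)) (M : Tm Γ (.comp Δ (.F A)))
    (N : Tm (A :: Γ) (.comp none B₁)) :
    Eqv (S.on (.bind M N)) (.bind M (S.on N)) := by
  have h := fill_bind (S.ren Ren.nil) M N
  rwa [Tm.wk, Tm.ren_ren, show (fun a (x : Var [] a) => Ren.wk (b := A) a (Ren.nil (Γ := Γ) a x)) =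
    Ren.nil from by funext a x; cases x] at h

theorem bind_bind {A₁ A₂ : VTy} (M : Tm Γ (.comp Δ (.F A₁)))
    (N : Tm (A₁ :: Γ) (.comp none (.F A₂))) (L : Tm (A₂ :: Γ) (.comp none B)) :
    Eqv (.bind (.bind M N) L) (.bind M (.bind N (L.ren (Ren.lift Ren.wk)))) :=
  fill_bind (.bind .hole L) M N

theorem arrEta (M : Tm Γ (.comp Δ (.arr A B))) : Eqv M (.lam (.app M.wk (.var .z))) :=
  (betaEta .arrEta).fill M

theorem ampEta (M : Tm Γ (.comp Δ (.amp B₁ B₂))) : Eqv M (.ampI (.fst M) (.snd M)) :=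
  (betaEta .ampEta).fill M

theorem topEta (M : Tm Γ (.comp Δ .top)) : Eqv M .topI := (betaEta .topEta).fill M

end Eqv

section wk
variable {Γ : Ctx} {Δ : Stoup} {A A₁ A₂ C : VTy} {B B₁ B₂ : CTy}
@[simp] theorem Tm.wk_var (x : Var Γ A) : (Tm.var x).wk (A := C) = .var (.s x) := rfl
@[simp] theorem Tm.wk_hole : (Tm.hole : Tm Γ (.comp (some B) B)).wk (A := C) = .hole := rfl
@[simp] theorem Tm.wk_thunk (M : Tm Γ (.comp none B)) :
    (Tm.thunk M).wk (A := C) = .thunk M.wk := rfl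
@[simp] theorem Tm.wk_force (V : Tm Γ (.val (.U B))) :
    (Tm.force V).wk (A := C) = .force V.wk := rfl
@[simp] theorem Tm.wk_app (M : Tm Γ (.comp Δ (.arr A B))) (V : Tm Γ (.val A)) :
    (Tm.app M V).wk (A := C) = .app M.wk V.wk := rfl
@[simp] theorem Tm.subst_wk {g : Goal} (E : Tm Γ g) :
    E.subst (fun _ x => .var (.s x)) = E.wk (A := C) := (E.ren_eq_subst _).symm
end wk

attribute [simp] Tm.wk_subst

/-! ### Laws of the eliminators -/

theorem Le.of_eq {Γ : Ctx} {g : Goal} {E E' : Tm Γ g} (h : E = E') : Le E E' := h ▸ .refl E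

namespace Eqv
variable {Γ : Ctx} {Δ : Stoup} {A A' A₁ A₂ : VTy} {B B₁ B₂ : CTy} {g : Goal}

theorem sumBetaL (V : Tm Γ (.val A₁)) (E₁ : Tm (A₁ :: Γ) g) (E₂ : Tm (A₂ :: Γ) g) :
    Eqv (.caseOf (.inl V) E₁ E₂) (E₁.subst (Sub.cons V Sub.id)) := betaEta (.sumBetaL V E₁ E₂)
theorem sumBetaR (V : Tm Γ (.val A₂)) (E₁ : Tm (A₁ :: Γ) g) (E₂ : Tm (A₂ :: Γ) g) :
    Eqv (.caseOf (.inr V) E₁ E₂) (E₂.subst (Sub.cons V Sub.id)) := betaEta (.sumBetaR V E₁ E₂)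
theorem prodBeta (V₁ : Tm Γ (.val A₁)) (V₂ : Tm Γ (.val A₂)) (E : Tm (A₂ :: A₁ :: Γ) g) :
    Eqv (.letPair (.pair V₁ V₂) E) (E.subst (Sub.cons V₂ (Sub.cons V₁ Sub.id))) :=
  betaEta (.prodBeta V₁ V₂ E)
theorem UBeta (M : Tm Γ (.comp none B)) : Eqv (.force (.thunk M)) M := betaEta (.UBeta M)
theorem FBeta (V : Tm Γ (.val A)) (N : Tm (A :: Γ) (.comp none B)) :
    Eqv (.bind (.ret V) N) (N.subst (Sub.cons V Sub.id)) := betaEta (.FBeta V N)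
theorem arrBeta (M : Tm (A :: Γ) (.comp Δ B)) (V : Tm Γ (.val A)) :
    Eqv (.app (.lam M) V) (M.subst (Sub.cons V Sub.id)) := betaEta (.arrBeta M V)
theorem ampBetaL (M : Tm Γ (.comp Δ B₁)) (N : Tm Γ (.comp Δ B₂)) :
    Eqv (.fst (.ampI M N)) M := betaEta (.ampBetaL M N)
theorem ampBetaR (M : Tm Γ (.comp Δ B₁)) (N : Tm Γ (.comp Δ B₂)) :
    Eqv (.snd (.ampI M N)) N := betaEta (.ampBetaR M N)

/-- Binding `M` and returning `V`, and then binding the result, substitutes `V`. -/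
theorem bind_ret_bind (M : Tm Γ (.comp Δ (.F A))) (V : Tm (A :: Γ) (.val A'))
    (N : Tm (A' :: Γ) (.comp none B)) :
    Eqv (.bind (.bind M (.ret V)) N)
      (.bind M (N.subst (Sub.cons V fun _ x => .var (.s x)))) := by
  refine (bind_bind _ _ _).trans (bind (refl _) ((FBeta _ _).trans (of_eq ?_)))
  rw [Tm.subst_ren]; apply Tm.subst_congr; intro C x; cases x <;> rfl

end Eqv

theorem Le.err_bind {Γ : Ctx} {A : VTy} {B : CTy} (N : Tm (A :: Γ) (.comp none B)) :
    Le (.bind .err N) .err := .stkStrict (.bind .hole N)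

/-- An inequality between terms with a variable of product type can be checked at pairs. -/
theorem Le.of_pair {Γ : Ctx} {A₁ A₂ : VTy} {g : Goal} {E E' : Tm (.prod A₁ A₂ :: Γ) g}
    (h : Le (E.subst (Sub.cons (.pair (.var (.s .z)) (.var .z)) fun _ x => .var (.s (.s x))))
      (E'.subst (Sub.cons (.pair (.var (.s .z)) (.var .z)) fun _ x => .var (.s (.s x))))) :
    Le E E' := by
  refine (Eqv.betaEta (.prodEta E)).1.trans (.trans (.letPair (.refl _) ?_)
    (Eqv.betaEta (.prodEta E')).2)
  have := h.subst (Sub.lift (A := A₂) (Sub.lift (A := A₁) fun _ x =>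
    .var (Γ := .prod A₁ A₂ :: Γ) (.s x)))
  rw [Tm.subst_subst, Tm.subst_subst] at this
  convert this using 1 <;> (apply Tm.subst_congr; intro C x; cases x <;> rfl)

/-- An inequality between terms with a variable of sum type can be checked at injections. -/
theorem Le.of_inl_inr {Γ : Ctx} {A₁ A₂ : VTy} {g : Goal} {E E' : Tm (.sum A₁ A₂ :: Γ) g}
    (h₁ : Le (E.subst (Sub.cons (.inl (.var .z)) fun _ x => .var (.s x)))
      (E'.subst (Sub.cons (.inl (.var .z)) fun _ x => .var (.s x))))
    (h₂ : Le (E.subst (Sub.cons (.inr (.var .z)) fun _ x => .var (.s x)))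
      (E'.subst (Sub.cons (.inr (.var .z)) fun _ x => .var (.s x)))) :
    Le E E' := by
  refine (Eqv.betaEta (.sumEta E)).1.trans (.trans (.caseOf (.refl _) ?_ ?_)
    (Eqv.betaEta (.sumEta E')).2)
  · have := h₁.subst (Sub.lift (A := A₁) fun _ x => .var (Γ := .sum A₁ A₂ :: Γ) (.s x))
    rw [Tm.subst_subst, Tm.subst_subst] at this
    convert this using 1 <;> (apply Tm.subst_congr; intro C x; cases x <;> rfl)
  · have := h₂.subst (Sub.lift (A := A₂) fun _ x => .var (Γ := .sum A₁ A₂ :: Γ) (.s x))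
    rw [Tm.subst_subst, Tm.subst_subst] at this
    convert this using 1 <;> (apply Tm.subst_congr; intro C x; cases x <;> rfl)

theorem Eqv.of_pair {Γ : Ctx} {A₁ A₂ : VTy} {g : Goal} {E E' : Tm (.prod A₁ A₂ :: Γ) g}
    (h : Eqv (E.subst (Sub.cons (.pair (.var (.s .z)) (.var .z)) fun _ x => .var (.s (.s x))))
      (E'.subst (Sub.cons (.pair (.var (.s .z)) (.var .z)) fun _ x => .var (.s (.s x))))) :
    Eqv E E' := ⟨.of_pair h.1, .of_pair h.2⟩

theorem Eqv.of_inl_inr {Γ : Ctx} {A₁ A₂ : VTy} {g : Goal} {E E' : Tm (.sum A₁ A₂ :: Γ) g}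
    (h₁ : Eqv (E.subst (Sub.cons (.inl (.var .z)) fun _ x => .var (.s x)))
      (E'.subst (Sub.cons (.inl (.var .z)) fun _ x => .var (.s x))))
    (h₂ : Eqv (E.subst (Sub.cons (.inr (.var .z)) fun _ x => .var (.s x)))
      (E'.subst (Sub.cons (.inr (.var .z)) fun _ x => .var (.s x)))) :
    Eqv E E' := ⟨.of_inl_inr h₁.1 h₂.1, .of_inl_inr h₁.2 h₂.2⟩

/-! ### Embedding-projection pairs at arbitrary arguments -/

namespace ValCast
variable {Γ : Ctx} {Δ : Stoup} {A A' A'' A₁ A₂ A₁' A₂' : VTy} {B : CTy}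

/-- The laws of a value ep pair, for the upcast of an arbitrary value and the downcast of an
arbitrary term. -/
structure IsEP (c : ValCast A A') : Prop where
  retraction : ∀ {Γ : Ctx} (V : Tm Γ (.val A)), Eqv (c.dn.on (.ret (c.up.put V))) (.ret V)
  projection : ∀ {Γ : Ctx} {Δ : Stoup} (M : Tm Γ (.comp Δ (.F A'))),
    Le (.bind (c.dn.on M) (.ret (c.up.put (.var .z)))) M

theorem project_on (c : ValCast A A') (M : Tm Γ (.comp Δ (.F A'))) :
    Tm.on (.bind c.dn (.ret c.up)) M = .bind (c.dn.on M) (.ret (c.up.put (.var .z))) := by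
  simp only [Tm.on, Tm.ren, Tm.fill_bind]
  congr 2
  rw [Tm.ren_eq_subst]; apply Tm.subst_congr; intro C x; rcases x with _ | ⟨⟨⟩⟩; rfl

/-- The ep pair laws follow from their instances at the variable and at the hole. -/
theorem IsEP.of_var {c : ValCast A A'}
    (h : Eqv (Γ := [A]) (c.dn.on (.ret c.up)) (.ret (.var .z)))
    (h' : Le (.bind c.dn (.ret c.up)) .hole) : c.IsEP where
  retraction V := by
    have := h.subst (Sub.cons V fun _ x => nomatch x)
    rwa [Tm.on_subst] at this
  projection M := by
    have := Le.on h' (.refl M)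
    rwa [project_on, Tm.hole_on] at this

theorem _root_.Gradual.CBPV.ValEP.isEP (c : ValEP A A') : c.toValCast.IsEP :=
  .of_var c.retraction.symm c.projection

/-- Running the downcast and then a continuation that starts with the upcast. -/
theorem IsEP.bind_le {c : ValCast A A'} (hc : c.IsEP) (M : Tm Γ (.comp Δ (.F A')))
    (N : Tm (A' :: Γ) (.comp none B)) :
    Le (.bind (c.dn.on M) (N.subst (Sub.cons (c.up.put (.var .z)) fun _ x => .var (.s x))))
      (.bind M N) :=
  (Eqv.bind_ret_bind _ _ _).2.trans (.bind (hc.projection M) (.refl N))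

theorem IsEP.bind_ret_le {c : ValCast A A'} (hc : c.IsEP) {V : Tm Γ (.val A')}
    (N : Tm (A' :: Γ) (.comp none B)) {N' : Tm (A :: Γ) (.comp none B)} {M : Tm Γ (.comp none B)}
    (h : N.subst (Sub.cons (c.up.put (.var .z)) fun _ x => .var (.s x)) = N')
    (h' : N.subst (Sub.cons V Sub.id) = M) :
    Le (.bind (c.dn.on (.ret V)) N') M := by
  subst h h'; exact (hc.bind_le _ _).trans (Eqv.FBeta _ _).1

theorem IsEP.bind_ret {c : ValCast A A'} (hc : c.IsEP) (V : Tm Γ (.val A))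
    (N : Tm (A :: Γ) (.comp none B)) :
    Eqv (.bind (c.dn.on (.ret (c.up.put V))) N) (N.subst (Sub.cons V Sub.id)) :=
  (Eqv.bind (hc.retraction V) (.refl N)).trans (.FBeta V N)

theorem IsEP.id (A : VTy) : (ValCast.id A).IsEP :=
  ⟨fun _ => .refl _, fun _ => (Eqv.FEta _).2⟩

theorem IsEP.trans {c : ValCast A A'} {d : ValCast A' A''} (hc : c.IsEP) (hd : d.IsEP) :
    (c.trans d).IsEP where
  retraction V := by
    simp only [ValCast.trans, Tm.on_on, Tm.put_put]
    exact (Eqv.on _ (hd.retraction _)).trans (hc.retraction V)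
  projection M := by
    simp only [ValCast.trans, Tm.on_on, Tm.put_put]
    refine .trans ?_ (hd.projection M)
    simpa [Tm.subst] using hc.bind_le (d.dn.on M) (.ret (d.up.put (.var .z)))

theorem zero_dn_on (M : Tm Γ (.comp Δ (.F A))) : (ValCast.zero A).dn.on M = .bind M .err := rfl

theorem IsEP.zero (A : VTy) : (ValCast.zero A).IsEP where
  retraction V := (Eqv.zeroEta V _).trans (Eqv.zeroEta V _).symm
  projection M := by
    rw [zero_dn_on]
    refine (Eqv.bind_bind _ _ _).1.trans (.trans (.bind (.refl _) ?_) (Eqv.FEta M).2)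
    exact (Le.err_bind _).trans (.errBot _)

theorem sum_up_inl (c : ValCast A₁ A₁') (d : ValCast A₂ A₂') (V : Tm Γ (.val A₁)) :
    Eqv ((sum c d).up.put (.inl V)) (.inl (c.up.put V)) := by
  refine (Eqv.sumBetaL _ _ _).trans (.of_eq ?_)
  simp [Tm.subst]

theorem sum_up_inr (c : ValCast A₁ A₁') (d : ValCast A₂ A₂') (V : Tm Γ (.val A₂)) :
    Eqv ((sum c d).up.put (.inr V)) (.inr (d.up.put V)) := by
  refine (Eqv.sumBetaR _ _ _).trans (.of_eq ?_)
  simp [Tm.subst]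

theorem sum_dn_on (c : ValCast A₁ A₁') (d : ValCast A₂ A₂')
    (M : Tm Γ (.comp Δ (.F (.sum A₁' A₂')))) :
    (sum c d).dn.on M = .bind M (.caseOf (.var .z)
      (.bind (c.dn.on (.ret (.var .z))) (.ret (.inl (.var .z))))
      (.bind (d.dn.on (.ret (.var .z))) (.ret (.inr (.var .z))))) := by
  rw [Tm.on]; simp [sum, Tm.ren, Ren.lift]

theorem sum_dn_inl (c : ValCast A₁ A₁') (d : ValCast A₂ A₂') (V : Tm Γ (.val A₁')) :
    Eqv ((sum c d).dn.on (.ret (.inl V))) (.bind (c.dn.on (.ret V)) (.ret (.inl (.var .z)))) := by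
  rw [sum_dn_on]
  refine (Eqv.FBeta _ _).trans ((Eqv.sumBetaL _ _ _).trans (.of_eq ?_))
  simp [Tm.subst]

theorem sum_dn_inr (c : ValCast A₁ A₁') (d : ValCast A₂ A₂') (V : Tm Γ (.val A₂')) :
    Eqv ((sum c d).dn.on (.ret (.inr V))) (.bind (d.dn.on (.ret V)) (.ret (.inr (.var .z)))) := by
  rw [sum_dn_on]
  refine (Eqv.FBeta _ _).trans ((Eqv.sumBetaR _ _ _).trans (.of_eq ?_))
  simp [Tm.subst]

theorem prod_up_pair (c : ValCast A₁ A₁') (d : ValCast A₂ A₂') (V : Tm Γ (.val A₁))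
    (W : Tm Γ (.val A₂)) :
    Eqv ((prod c d).up.put (.pair V W)) (.pair (c.up.put V) (d.up.put W)) := by
  refine (Eqv.prodBeta _ _ _).trans (.of_eq ?_)
  simp [Tm.subst]

theorem prod_dn_on (c : ValCast A₁ A₁') (d : ValCast A₂ A₂')
    (M : Tm Γ (.comp Δ (.F (.prod A₁' A₂')))) :
    (prod c d).dn.on M = .bind M (.letPair (.var .z)
      (.bind (c.dn.on (.ret (.var (.s .z))))
        (.bind (d.dn.on (.ret (.var (.s .z)))) (.ret (.pair (.var (.s .z)) (.var .z)))))) := by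
  rw [Tm.on]; simp [prod, Tm.ren, Ren.lift]

theorem prod_dn_pair (c : ValCast A₁ A₁') (d : ValCast A₂ A₂') (V : Tm Γ (.val A₁'))
    (W : Tm Γ (.val A₂')) :
    Eqv ((prod c d).dn.on (.ret (.pair V W)))
      (.bind (c.dn.on (.ret V))
        (.bind (d.dn.on (.ret W.wk)) (.ret (.pair (.var (.s .z)) (.var .z))))) := by
  rw [prod_dn_on]
  refine (Eqv.FBeta _ _).trans ((Eqv.prodBeta _ _ _).trans (.of_eq ?_))
  simp [Tm.subst, Tm.wk, Tm.ren, Ren.wk]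

theorem U_dn_on {B B' : CTy} (c : CompCast B B') (M : Tm Γ (.comp Δ (.F (.U B')))) :
    (U c).dn.on M = .bind M (.ret (.thunk (c.dn.on (.force (.var .z))))) := by
  rw [Tm.on]; simp [U, Tm.ren, Ren.lift]

/-- To compare stacks from `F A` to `F A'` it suffices to compare them on returned values. -/
theorem le_of_ret {A A' : VTy} {S S' : Tm [] (.comp (some (.F A)) (.F A'))}
    (h : Le (Γ := [A]) (S.on (.ret (.var .z))) (S'.on (.ret (.var .z)))) : Le S S' := by
  have eq : ∀ S : Tm [] (.comp (some (.F A)) (.F A')),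
      S.wk.fill (.ret (.var .z)) = S.on (Γ := [A]) (.ret (.var .z)) := by
    intro S
    rw [Tm.on, Tm.wk]; congr 2; funext _ x; cases x
  refine (Eqv.betaEta (.FEta S)).1.trans (.trans (.bind (.refl _) ?_)
    (Eqv.betaEta (.FEta S')).2)
  rwa [eq, eq]

/-- The projection law of a value ep pair only has to be checked on returned values. -/
theorem IsEP.of_ret {c : ValCast A A'}
    (h : Eqv (Γ := [A]) (c.dn.on (.ret c.up)) (.ret (.var .z)))
    (h' : Le (Γ := [A']) (.bind (c.dn.on (.ret (.var .z))) (.ret (c.up.put (.var .z))))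
      (.ret (.var .z))) : c.IsEP :=
  .of_var h (le_of_ret (.trans (.of_eq (project_on _ _)) h'))

theorem IsEP.sum {c : ValCast A₁ A₁'} {d : ValCast A₂ A₂'} (hc : c.IsEP) (hd : d.IsEP) :
    (sum c d).IsEP := by
  refine .of_ret ?_ ?_
  · rw [← (ValCast.sum c d).up.put_var]
    refine .of_inl_inr ?_ ?_ <;>
      simp only [Tm.on_subst, Tm.put_subst, Tm.subst, Sub.cons_z]
    · refine (Eqv.on _ (.ret (sum_up_inl _ _ _))).trans ?_
      exact (sum_dn_inl _ _ _).trans (hc.bind_ret _ _)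
    · refine (Eqv.on _ (.ret (sum_up_inr _ _ _))).trans ?_
      exact (sum_dn_inr _ _ _).trans (hd.bind_ret _ _)
  · refine .of_inl_inr ?_ ?_ <;>
      simp only [Tm.on_subst, Tm.put_subst, Tm.subst, Sub.cons_z, Sub.lift_z]
    · refine (Eqv.bind (sum_dn_inl _ _ _) (.refl _)).1.trans ?_
      refine (Eqv.bind_ret_bind _ _ _).1.trans ?_
      simp only [Tm.subst, Tm.put_subst, Sub.cons_z]
      refine (Eqv.bind (.refl _) (.ret (sum_up_inl _ _ _))).1.trans ?_
      exact hc.bind_ret_le (.ret (.inl (.var .z))) (by simp [Tm.subst]) rfl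
    · refine (Eqv.bind (sum_dn_inr _ _ _) (.refl _)).1.trans ?_
      refine (Eqv.bind_ret_bind _ _ _).1.trans ?_
      simp only [Tm.subst, Tm.put_subst, Sub.cons_z]
      refine (Eqv.bind (.refl _) (.ret (sum_up_inr _ _ _))).1.trans ?_
      exact hd.bind_ret_le (.ret (.inr (.var .z))) (by simp [Tm.subst]) rfl

theorem IsEP.prod {c : ValCast A₁ A₁'} {d : ValCast A₂ A₂'} (hc : c.IsEP) (hd : d.IsEP) :
    (prod c d).IsEP := by
  refine .of_ret ?_ ?_
  · rw [← (ValCast.prod c d).up.put_var]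
    refine .of_pair ?_
    simp only [Tm.on_subst, Tm.put_subst, Tm.subst, Sub.cons_z]
    refine (Eqv.on _ (.ret (prod_up_pair _ _ _ _))).trans ?_
    refine (prod_dn_pair _ _ _ _).trans ((hc.bind_ret _ _).trans ?_)
    simp only [Tm.subst, Tm.on_subst, Tm.put_wk, Tm.put_subst, Tm.wk_var, Sub.cons_s, Sub.cons_z,
      Sub.lift_z, Sub.lift_s, Sub.id_apply]
    exact hd.bind_ret (.var .z) (.ret (.pair (.var (.s (.s .z))) (.var .z)))
  · refine .of_pair ?_
    simp only [Tm.on_subst, Tm.put_subst, Tm.subst, Sub.cons_z, Sub.lift_z]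
    refine (Eqv.bind (prod_dn_pair _ _ _ _) (.refl _)).1.trans ?_
    refine (Eqv.bind_bind _ _ _).1.trans ?_
    refine (Eqv.bind (.refl _) (.bind_ret_bind _ _ _)).1.trans ?_
    simp only [Tm.ren, Tm.put_ren, Tm.subst, Tm.put_subst, Ren.lift, Sub.cons_z, Tm.wk_var]
    refine (Eqv.bind (.refl _) (.bind (.refl _) (.ret (prod_up_pair _ _ _ _)))).1.trans ?_
    refine (Le.bind (.refl _) (hd.bind_ret_le (.ret (.pair (c.up.put (.var (.s .z))) (.var .z)))
      (by simp [Tm.subst]) (by simp only [Tm.subst, Tm.put_subst]; rfl))).trans ?_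
    exact hc.bind_ret_le (.ret (.pair (.var .z) (.var (.s .z)))) (by simp [Tm.subst]) rfl

end ValCast

namespace CompCast
variable {Γ : Ctx} {Δ : Stoup} {A A' : VTy} {B B' B'' B₁ B₂ B₁' B₂' : CTy}

/-- The upcast of a computation cast, acting on computations rather than on thunks. -/
def embed (c : CompCast B B') (M : Tm Γ (.comp none B)) : Tm Γ (.comp none B') :=
  .force (c.up.put (.thunk M))

@[simp] theorem embed_subst (c : CompCast B B') {Γ' : Ctx} (M : Tm Γ (.comp none B))
    (σ : Sub Γ Γ') : (c.embed M).subst σ = c.embed (M.subst σ) := by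
  simp [embed, Tm.subst]

@[simp] theorem embed_wk (c : CompCast B B') (M : Tm Γ (.comp none B)) :
    (c.embed M).wk (A := A) = c.embed M.wk := by
  simp [embed]

theorem embed_mono (c : CompCast B B') {M M' : Tm Γ (.comp none B)} (h : Le M M') :
    Le (c.embed M) (c.embed M') := .force (.put (.refl _) (.thunk h))

theorem embed_congr (c : CompCast B B') {M M' : Tm Γ (.comp none B)} (h : Eqv M M') :
    Eqv (c.embed M) (c.embed M') := ⟨c.embed_mono h.1, c.embed_mono h.2⟩

theorem embed_force (c : CompCast B B') (V : Tm Γ (.val (.U B))) :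
    Eqv (c.embed (.force V)) (.force (c.up.put V)) := .force (.put _ (Eqv.UEta V).symm)

theorem thunk_embed (c : CompCast B B') (M : Tm Γ (.comp none B)) :
    Eqv (.thunk (c.embed M)) (c.up.put (.thunk M)) := (Eqv.UEta _).symm

/-- The laws of a computation ep pair, at arbitrary computations. -/
structure IsEP (c : CompCast B B') : Prop where
  retraction : ∀ {Γ : Ctx} (M : Tm Γ (.comp none B)), Eqv (c.dn.on (c.embed M)) M
  projection : ∀ {Γ : Ctx} (M : Tm Γ (.comp none B')), Le (c.embed (c.dn.on M)) M

theorem _root_.Gradual.CBPV.CompEP.isEP (c : CompEP B B') : c.toCompCast.IsEP where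
  retraction M := by
    have := c.retraction.symm.subst (Sub.cons (.thunk M) fun _ x => nomatch x)
    rw [Tm.on_subst] at this
    exact this.trans (.UBeta M)
  projection M := by
    have := c.projection.subst (Sub.cons (.thunk M) fun _ x => nomatch x)
    simp only [Tm.put_subst, Tm.subst, Tm.on_subst, Sub.cons_z] at this
    refine (c.toCompCast.embed_congr (.on _ (Eqv.UBeta M).symm)).1.trans ?_
    exact (Le.force this).trans (Eqv.UBeta M).1

theorem IsEP.force {c : CompCast B B'} (hc : c.IsEP) (V : Tm Γ (.val (.U B))) :
    Eqv (c.dn.on (.force (c.up.put V))) (.force V) :=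
  (Eqv.on _ (c.embed_force V).symm).trans (hc.retraction _)

theorem IsEP.id (B : CTy) : (CompCast.id B).IsEP := ⟨Eqv.UBeta, fun M => (Eqv.UBeta M).1⟩

theorem embed_trans (c : CompCast B B') (d : CompCast B' B'') (M : Tm Γ (.comp none B)) :
    Eqv ((c.trans d).embed M) (d.embed (c.embed M)) := by
  simp only [embed, CompCast.trans, Tm.put_put]
  exact .force (.put _ (Eqv.UEta _))

theorem IsEP.trans {c : CompCast B B'} {d : CompCast B' B''} (hc : c.IsEP) (hd : d.IsEP) :
    (c.trans d).IsEP where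
  retraction M := by
    refine (Eqv.on _ (embed_trans c d M)).trans ?_
    simp only [CompCast.trans, Tm.on_on]
    exact (Eqv.on _ (hd.retraction _)).trans (hc.retraction M)
  projection M := by
    refine (embed_trans c d _).1.trans ?_
    simp only [CompCast.trans, Tm.on_on]
    exact (d.embed_mono (hc.projection _)).trans (hd.projection M)

theorem IsEP.top (B : CTy) : (CompCast.top B).IsEP where
  retraction M := ((Eqv.topEta _).trans (Eqv.topEta M).symm)
  projection M := (Eqv.UBeta _).1.trans (.errBot M)

theorem amp_dn_on (c : CompCast B₁ B₁') (d : CompCast B₂ B₂')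
    (M : Tm Γ (.comp Δ (.amp B₁' B₂'))) :
    (amp c d).dn.on M = .ampI (c.dn.on (.fst M)) (d.dn.on (.snd M)) := by
  rw [Tm.on]; simp [amp, Tm.ren]

theorem amp_embed (c : CompCast B₁ B₁') (d : CompCast B₂ B₂')
    (M : Tm Γ (.comp none (.amp B₁ B₂))) :
    Eqv ((amp c d).embed M) (.ampI (c.embed (.fst M)) (d.embed (.snd M))) := by
  refine (Eqv.UBeta _).trans (.trans (.of_eq ?_) (.ampI
    (c.embed_congr (.fst (.UBeta M))) (d.embed_congr (.snd (.UBeta M)))))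
  simp [Tm.subst, embed]

theorem IsEP.amp {c : CompCast B₁ B₁'} {d : CompCast B₂ B₂'} (hc : c.IsEP) (hd : d.IsEP) :
    (amp c d).IsEP where
  retraction M := by
    rw [amp_dn_on]
    refine (Eqv.ampI (.on _ (.fst (amp_embed c d M))) (.on _ (.snd (amp_embed c d M)))).trans ?_
    refine (Eqv.ampI (.on _ (.ampBetaL _ _)) (.on _ (.ampBetaR _ _))).trans ?_
    exact (Eqv.ampI (hc.retraction _) (hd.retraction _)).trans (Eqv.ampEta M).symm
  projection M := by
    rw [amp_dn_on]
    refine (amp_embed c d _).1.trans ?_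
    refine (Eqv.ampI (c.embed_congr (.ampBetaL _ _)) (d.embed_congr (.ampBetaR _ _))).1.trans ?_
    exact (Le.ampI (hc.projection _) (hd.projection _)).trans (Eqv.ampEta M).2

theorem arr_dn_on (c : ValCast A A') (d : CompCast B B') (M : Tm Γ (.comp Δ (.arr A' B'))) :
    (arr c d).dn.on M = .lam (d.dn.on (.app M.wk (c.up.put (.var .z)))) := by
  rw [Tm.on]; simp only [arr, Tm.ren, Tm.on_ren, Tm.put_ren, Tm.fill_lam, Tm.on_fill, Tm.fill_app]
  rfl

theorem arr_embed (c : ValCast A A') (d : CompCast B B') (M : Tm Γ (.comp none (.arr A B))) :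
    Eqv ((arr c d).embed M) (.lam (.bind (c.dn.on (.ret (.var .z)))
      (d.embed (.app M.wk.wk (.var .z))))) := by
  refine (Eqv.UBeta _).trans (.trans (.of_eq ?_) (.lam (.bind (.refl _)
    (d.embed_congr (.app (.UBeta M.wk.wk) _)))))
  simp [Tm.subst, embed]

theorem IsEP.arr {c : ValCast A A'} {d : CompCast B B'} (hc : c.IsEP) (hd : d.IsEP) :
    (arr c d).IsEP where
  retraction M := by
    rw [arr_dn_on, embed_wk]
    refine .trans (.lam ?_) (Eqv.arrEta M).symm
    refine (Eqv.on _ (.app (arr_embed c d _) _)).trans ?_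
    refine (Eqv.on _ (.arrBeta _ _)).trans ?_
    simp only [Tm.subst, Tm.on_subst, embed_subst, Tm.wk_subst, Tm.wk_subst_cons, Tm.subst_id,
      Sub.cons_z, Sub.lift_z]
    refine (Eqv.on _ (hc.bind_ret (.var .z) _)).trans ?_
    simp only [Tm.subst, embed_subst, Tm.wk_subst_cons, Tm.subst_id, Sub.cons_z]
    exact hd.retraction _
  projection M := by
    refine (arr_embed c d _).1.trans ?_
    rw [Tm.on_wk, Tm.on_wk, arr_dn_on]
    refine (Eqv.lam (.bind (.refl _) (d.embed_congr (.arrBeta _ _)))).1.trans ?_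
    simp only [Tm.subst, Tm.on_subst, Tm.put_subst, Tm.wk_subst_cons, Tm.subst_id, Sub.cons_z]
    refine (Le.lam (.bind (.refl _) (hd.projection _))).trans ?_
    exact (Le.lam (hc.bind_ret_le (.app M.wk.wk (.var .z)) (by simp [Tm.subst])
      (by simp [Tm.subst]))).trans (Eqv.arrEta M).2

theorem F_embed (c : ValCast A A') (M : Tm Γ (.comp none (.F A))) :
    Eqv ((F c).embed M) (.bind M (.ret (c.up.put (.var .z)))) := by
  refine (Eqv.UBeta _).trans (.trans (.of_eq ?_) (.bind (.UBeta M) (.refl _)))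
  simp [Tm.subst]

theorem IsEP.F {c : ValCast A A'} (hc : c.IsEP) : (F c).IsEP where
  retraction M := by
    refine (Eqv.on _ (F_embed c M)).trans ?_
    refine (Eqv.on_bind _ _ _).trans ?_
    exact (Eqv.bind (.refl _) (hc.retraction _)).trans (Eqv.FEta M).symm
  projection M := (F_embed c _).1.trans (hc.projection M)

theorem IsEP.U {c : CompCast B B'} (hc : c.IsEP) : (ValCast.U c).IsEP where
  retraction V := by
    rw [ValCast.U_dn_on]
    refine (Eqv.FBeta _ _).trans ?_
    simp only [Tm.subst, Tm.on_subst, Sub.cons_z]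
    exact (Eqv.ret (.thunk (hc.force V))).trans (.ret (Eqv.UEta V).symm)
  projection M := by
    rw [ValCast.U_dn_on]
    refine (Eqv.bind_ret_bind _ _ _).1.trans ?_
    simp only [Tm.subst, Tm.put_subst, Sub.cons_z]
    refine (Eqv.bind (.refl _) (.ret (c.thunk_embed _).symm)).1.trans ?_
    refine (Le.bind (.refl _) (.ret (.thunk (hc.projection (.force (.var .z)))))).trans ?_
    exact (Eqv.bind (.refl _) (.ret (Eqv.UEta _).symm)).1.trans (Eqv.FEta M).2

end CompCast

/-! ### Equivalence of casts -/

namespace ValCast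
variable {Γ : Ctx} {A A' A'' A₁ A₂ A₁' A₂' A₁'' A₂'' : VTy} {B B' B'' : CTy}

/-- Two value casts are equivalent if their upcasts and their downcasts are. -/
structure Equiv (c c' : ValCast A A') : Prop where
  up : Eqv c.up c'.up
  dn : Eqv c.dn c'.dn

theorem Equiv.refl (c : ValCast A A') : Equiv c c := ⟨.refl _, .refl _⟩
theorem Equiv.of_eq {c c' : ValCast A A'} (h : c = c') : Equiv c c' := h ▸ .refl c
theorem Equiv.symm {c c' : ValCast A A'} (h : Equiv c c') : Equiv c' c := ⟨h.up.symm, h.dn.symm⟩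
theorem Equiv.trans {c c' c'' : ValCast A A'} (h : Equiv c c') (h' : Equiv c' c'') :
    Equiv c c'' := ⟨h.up.trans h'.up, h.dn.trans h'.dn⟩

/-- Projections are right adjoint to embeddings, so they depend antitonically on them. -/
theorem dn_le_of_up_le {c c' : ValCast A A'} (hc : c.IsEP) (hc' : c'.IsEP) (h : Le c.up c'.up) :
    Le c'.dn c.dn := by
  refine (Eqv.FEta _).1.trans ?_
  refine (Eqv.bind (.refl _) (hc.retraction _).symm).1.trans ?_
  refine (Eqv.on_bind _ _ _).2.trans ?_
  refine (Le.on (.refl _) (.bind (.refl _) (.ret (.put h (.refl _))))).trans ?_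
  have h' := Le.on (.refl c.dn) (hc'.projection (Γ := []) .hole)
  rwa [Tm.on_hole, Tm.on_hole] at h'

theorem Equiv.of_up {c c' : ValCast A A'} (hc : c.IsEP) (hc' : c'.IsEP) (h : Eqv c.up c'.up) :
    Equiv c c' := ⟨h, dn_le_of_up_le hc' hc h.2, dn_le_of_up_le hc hc' h.1⟩

theorem Equiv.trans_congr {c c' : ValCast A A'} {d d' : ValCast A' A''} (h : Equiv c c')
    (h' : Equiv d d') : Equiv (c.trans d) (c'.trans d') :=
  ⟨⟨.put h'.up.1 h.up.1, .put h'.up.2 h.up.2⟩, ⟨.on h.dn.1 h'.dn.1, .on h.dn.2 h'.dn.2⟩⟩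

theorem trans_assoc {A''' : VTy} (c : ValCast A A') (d : ValCast A' A'')
    (e : ValCast A'' A''') :
    (c.trans d).trans e = c.trans (d.trans e) := by
  simp [ValCast.trans]

theorem id_trans (c : ValCast A A') : (ValCast.id A).trans c = c := by
  cases c; simp [ValCast.trans, ValCast.id]

theorem trans_id (c : ValCast A A') : c.trans (ValCast.id A') = c := by
  cases c; simp [ValCast.trans, ValCast.id]

theorem Equiv.zero {c : ValCast .zero A} (hc : c.IsEP) : Equiv (ValCast.zero A) c :=
  .of_up (.zero A) hc (Eqv.zeroEta _ _).symm

theorem Equiv.sum_congr {c c' : ValCast A₁ A₁'} {d d' : ValCast A₂ A₂'} (hc : c.IsEP)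
    (hc' : c'.IsEP) (hd : d.IsEP) (hd' : d'.IsEP) (h : Equiv c c') (h' : Equiv d d') :
    Equiv (sum c d) (sum c' d') :=
  .of_up (hc.sum hd) (hc'.sum hd') (.caseOf (.refl _)
    (.inl ⟨.put h.up.1 (.refl _), .put h.up.2 (.refl _)⟩)
    (.inr ⟨.put h'.up.1 (.refl _), .put h'.up.2 (.refl _)⟩))

theorem Equiv.sum_id : Equiv (sum (ValCast.id A₁) (ValCast.id A₂)) (ValCast.id _) :=
  .of_up (.sum (.id _) (.id _)) (.id _) (Eqv.betaEta (.sumEta (.var .z))).symm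

theorem Equiv.sum_trans {c : ValCast A₁ A₁'} {c' : ValCast A₁' A₁''} {d : ValCast A₂ A₂'}
    {d' : ValCast A₂' A₂''} (hc : c.IsEP) (hc' : c'.IsEP) (hd : d.IsEP) (hd' : d'.IsEP) :
    Equiv (sum (c.trans c') (d.trans d')) ((sum c d).trans (sum c' d')) := by
  refine .of_up ((hc.trans hc').sum (hd.trans hd')) ((hc.sum hd).trans (hc'.sum hd')) ?_
  simp only [ValCast.trans]
  rw [← Tm.put_var (sum _ _).up, ← Tm.put_var (sum c d).up]
  refine .of_inl_inr ?_ ?_ <;> simp only [Tm.put_subst, Tm.subst, Sub.cons_z]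
  · refine (sum_up_inl _ _ _).trans ?_
    rw [Tm.put_put]
    exact ((Eqv.put _ (sum_up_inl _ _ _)).trans (sum_up_inl _ _ _)).symm
  · refine (sum_up_inr _ _ _).trans ?_
    rw [Tm.put_put]
    exact ((Eqv.put _ (sum_up_inr _ _ _)).trans (sum_up_inr _ _ _)).symm

theorem Equiv.prod_congr {c c' : ValCast A₁ A₁'} {d d' : ValCast A₂ A₂'} (hc : c.IsEP)
    (hc' : c'.IsEP) (hd : d.IsEP) (hd' : d'.IsEP) (h : Equiv c c') (h' : Equiv d d') :
    Equiv (prod c d) (prod c' d') :=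
  .of_up (hc.prod hd) (hc'.prod hd') (.letPair (.refl _) (.pair
    ⟨.put h.up.1 (.refl _), .put h.up.2 (.refl _)⟩
    ⟨.put h'.up.1 (.refl _), .put h'.up.2 (.refl _)⟩))

theorem Equiv.prod_id : Equiv (prod (ValCast.id A₁) (ValCast.id A₂)) (ValCast.id _) :=
  .of_up (.prod (.id _) (.id _)) (.id _) (Eqv.betaEta (.prodEta (.var .z))).symm

theorem Equiv.prod_trans {c : ValCast A₁ A₁'} {c' : ValCast A₁' A₁''} {d : ValCast A₂ A₂'}
    {d' : ValCast A₂' A₂''} (hc : c.IsEP) (hc' : c'.IsEP) (hd : d.IsEP) (hd' : d'.IsEP) :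
    Equiv (prod (c.trans c') (d.trans d')) ((prod c d).trans (prod c' d')) := by
  refine .of_up ((hc.trans hc').prod (hd.trans hd')) ((hc.prod hd).trans (hc'.prod hd')) ?_
  simp only [ValCast.trans]
  rw [← Tm.put_var (prod _ _).up, ← Tm.put_var (prod c d).up]
  refine .of_pair ?_
  simp only [Tm.put_subst, Tm.subst, Sub.cons_z]
  refine (prod_up_pair _ _ _ _).trans ?_
  rw [Tm.put_put, Tm.put_put]
  exact ((Eqv.put _ (prod_up_pair _ _ _ _)).trans (prod_up_pair _ _ _ _)).symm

end ValCast

namespace CompCast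
variable {Γ : Ctx} {A A' A'' : VTy} {B B' B'' B₁ B₂ B₁' B₂' B₁'' B₂'' : CTy}

/-- Two computation casts are equivalent if their upcasts and their downcasts are. -/
structure Equiv (c c' : CompCast B B') : Prop where
  up : Eqv c.up c'.up
  dn : Eqv c.dn c'.dn

theorem Equiv.refl (c : CompCast B B') : Equiv c c := ⟨.refl _, .refl _⟩
theorem Equiv.of_eq {c c' : CompCast B B'} (h : c = c') : Equiv c c' := h ▸ .refl c
theorem Equiv.symm {c c' : CompCast B B'} (h : Equiv c c') : Equiv c' c := ⟨h.up.symm, h.dn.symm⟩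
theorem Equiv.trans {c c' c'' : CompCast B B'} (h : Equiv c c') (h' : Equiv c' c'') :
    Equiv c c'' := ⟨h.up.trans h'.up, h.dn.trans h'.dn⟩

/-- Embeddings are left adjoint to projections, so they depend antitonically on them. -/
theorem up_le_of_dn_le {c c' : CompCast B B'} (hc : c.IsEP) (hc' : c'.IsEP) (h : Le c.dn c'.dn) :
    Le c'.up c.up := by
  refine (Eqv.UEta _).1.trans (.trans (.thunk ?_) (Eqv.UEta _).2)
  rw [← Tm.put_var c.up, ← Tm.put_var c'.up]
  refine (c'.embed_force _).2.trans ?_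
  refine (c'.embed_congr (hc.retraction _)).2.trans ?_
  refine (c'.embed_mono (.on h (.refl _))).trans ?_
  exact (hc'.projection _).trans (c.embed_force _).1

theorem Equiv.of_dn {c c' : CompCast B B'} (hc : c.IsEP) (hc' : c'.IsEP) (h : Eqv c.dn c'.dn) :
    Equiv c c' := ⟨⟨up_le_of_dn_le hc' hc h.2, up_le_of_dn_le hc hc' h.1⟩, h⟩

theorem Equiv.trans_congr {c c' : CompCast B B'} {d d' : CompCast B' B''} (h : Equiv c c')
    (h' : Equiv d d') : Equiv (c.trans d) (c'.trans d') :=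
  ⟨⟨.put h'.up.1 h.up.1, .put h'.up.2 h.up.2⟩, ⟨.on h.dn.1 h'.dn.1, .on h.dn.2 h'.dn.2⟩⟩

theorem trans_assoc {B''' : CTy} (c : CompCast B B') (d : CompCast B' B'')
    (e : CompCast B'' B''') :
    (c.trans d).trans e = c.trans (d.trans e) := by
  simp [CompCast.trans]

theorem id_trans (c : CompCast B B') : (CompCast.id B).trans c = c := by
  cases c; simp [CompCast.trans, CompCast.id]

theorem trans_id (c : CompCast B B') : c.trans (CompCast.id B') = c := by
  cases c; simp [CompCast.trans, CompCast.id]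

theorem Equiv.top {c : CompCast .top B} (hc : c.IsEP) : Equiv (CompCast.top B) c :=
  .of_dn (.top B) hc (Eqv.topEta _).symm

theorem _root_.Gradual.CBPV.ValCast.Equiv.U_congr
    {c c' : CompCast B B'} (hc : c.IsEP) (hc' : c'.IsEP) (h : Equiv c c') :
    ValCast.Equiv (.U c) (.U c') := .of_up hc.U hc'.U h.up

theorem _root_.Gradual.CBPV.ValCast.Equiv.U_id : ValCast.Equiv (.U (CompCast.id B)) (.id _) :=
  .of_up (IsEP.id B).U (.id _) (.refl _)

theorem _root_.Gradual.CBPV.ValCast.Equiv.U_trans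
    {c : CompCast B B'} {d : CompCast B' B''} (hc : c.IsEP) (hd : d.IsEP) :
    ValCast.Equiv (.U (c.trans d)) (.trans (.U c) (.U d)) :=
  .of_up (hc.trans hd).U (hc.U.trans hd.U) (.refl _)

theorem Equiv.F_congr {c c' : ValCast A A'} (hc : c.IsEP) (hc' : c'.IsEP)
    (h : ValCast.Equiv c c') : Equiv (F c) (F c') := .of_dn (.F hc) (.F hc') h.dn

theorem Equiv.F_id : Equiv (F (.id A)) (.id _) := .of_dn (.F (.id A)) (.id _) (.refl _)

theorem Equiv.F_trans {c : ValCast A A'} {d : ValCast A' A''} (hc : c.IsEP) (hd : d.IsEP) :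
    Equiv (F (c.trans d)) ((F c).trans (F d)) :=
  .of_dn (.F (hc.trans hd)) (.trans (.F hc) (.F hd)) (.refl _)

theorem Equiv.amp_congr {c c' : CompCast B₁ B₁'} {d d' : CompCast B₂ B₂'} (hc : c.IsEP)
    (hc' : c'.IsEP) (hd : d.IsEP) (hd' : d'.IsEP) (h : Equiv c c') (h' : Equiv d d') :
    Equiv (amp c d) (amp c' d') :=
  .of_dn (hc.amp hd) (hc'.amp hd') (.ampI
    ⟨.on h.dn.1 (.refl _), .on h.dn.2 (.refl _)⟩
    ⟨.on h'.dn.1 (.refl _), .on h'.dn.2 (.refl _)⟩)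

theorem Equiv.amp_id : Equiv (amp (CompCast.id B₁) (CompCast.id B₂)) (CompCast.id _) :=
  .of_dn (.amp (.id _) (.id _)) (.id _) (Eqv.ampEta .hole).symm

theorem Equiv.amp_trans {c : CompCast B₁ B₁'} {c' : CompCast B₁' B₁''} {d : CompCast B₂ B₂'}
    {d' : CompCast B₂' B₂''} (hc : c.IsEP) (hc' : c'.IsEP) (hd : d.IsEP) (hd' : d'.IsEP) :
    Equiv (amp (c.trans c') (d.trans d')) ((amp c d).trans (amp c' d')) := by
  refine .of_dn ((hc.trans hc').amp (hd.trans hd')) ((hc.amp hd).trans (hc'.amp hd')) ?_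
  simp only [CompCast.trans]
  rw [← Tm.on_hole (amp c' d').dn, ← Tm.on_hole (amp _ _).dn, amp_dn_on, amp_dn_on, amp_dn_on,
    Tm.on_on, Tm.on_on]
  exact (Eqv.ampI (.on _ (.ampBetaL _ _)) (.on _ (.ampBetaR _ _))).symm

theorem Equiv.arr_congr {c c' : ValCast A A'} {d d' : CompCast B B'} (hc : c.IsEP)
    (hc' : c'.IsEP) (hd : d.IsEP) (hd' : d'.IsEP) (h : ValCast.Equiv c c') (h' : Equiv d d') :
    Equiv (arr c d) (arr c' d') :=
  .of_dn (hd.arr hc) (hd'.arr hc') (.lam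
    ⟨.on h'.dn.1 (.app (.refl _) (.put h.up.1 (.refl _))),
      .on h'.dn.2 (.app (.refl _) (.put h.up.2 (.refl _)))⟩)

theorem Equiv.arr_id : Equiv (arr (ValCast.id A) (CompCast.id B)) (CompCast.id _) :=
  .of_dn (.arr (.id _) (.id _)) (.id _) (Eqv.arrEta .hole).symm

theorem Equiv.arr_trans {c : ValCast A A'} {c' : ValCast A' A''} {d : CompCast B B'}
    {d' : CompCast B' B''} (hc : c.IsEP) (hc' : c'.IsEP) (hd : d.IsEP) (hd' : d'.IsEP) :
    Equiv (arr (c.trans c') (d.trans d')) ((arr c d).trans (arr c' d')) := by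
  refine .of_dn (.arr (hc.trans hc') (hd.trans hd')) (.trans (.arr hc hd) (.arr hc' hd')) ?_
  simp only [CompCast.trans, ValCast.trans]
  rw [arr_dn_on, ← Tm.on_hole (arr c' d').dn, Tm.on_wk, arr_dn_on]
  refine .symm (.lam ((Eqv.on _ (.arrBeta _ _)).trans (.of_eq ?_)))
  simp [Tm.subst]

end CompCast

/-! ### Casts of either kind -/

namespace CastData

/-- The ep pair laws of the kind at hand. -/
def IsEP : {k : Kind} → {T T' : Ty [] k} → CastData T T' → Prop
  | .val, _, _, c => ValCast.IsEP c
  | .comp, _, _, c => CompCast.IsEP c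

/-- Equivalence of both halves of two casts. -/
def Equiv : {k : Kind} → {T T' : Ty [] k} → CastData T T' → CastData T T' → Prop
  | .val, _, _, c, c' => ValCast.Equiv c c'
  | .comp, _, _, c, c' => CompCast.Equiv c c'

/-- The identity cast. -/
def id : {k : Kind} → (T : Ty [] k) → CastData T T
  | .val, A => ValCast.id A
  | .comp, B => CompCast.id B

/-- The composite of two casts. -/
def trans : {k : Kind} → {T T' T'' : Ty [] k} → CastData T T' → CastData T' T'' →
    CastData T T''
  | .val, _, _, _, c, d => ValCast.trans c d
  | .comp, _, _, _, c, d => CompCast.trans c d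

end CastData

end CBPV

/-! ### The casts of the contract translation are functorial ep pairs -/

namespace DynInterp
open GTT (NDyn)
variable (ρ : DynInterp)

theorem sumDyn_isEP (A₁ A₂ : GTT.VTy) {c : CBPV.ValCast (ρ.ty A₁) ρ.dyn}
    {d : CBPV.ValCast (ρ.ty A₂) ρ.dyn} (hc : c.IsEP) (hd : d.IsEP) :
    (ρ.sumDyn A₁ A₂ c d).IsEP := by
  cases A₁ <;> cases A₂ <;>
    first
    | exact (ρ.valEP .sum).isEP
    | exact (hc.sum hd).trans (ρ.valEP .sum).isEP

theorem prodDyn_isEP (A₁ A₂ : GTT.VTy) {c : CBPV.ValCast (ρ.ty A₁) ρ.dyn}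
    {d : CBPV.ValCast (ρ.ty A₂) ρ.dyn} (hc : c.IsEP) (hd : d.IsEP) :
    (ρ.prodDyn A₁ A₂ c d).IsEP := by
  cases A₁ <;> cases A₂ <;>
    first
    | exact (ρ.valEP .prod).isEP
    | exact (hc.prod hd).trans (ρ.valEP .prod).isEP

theorem UDyn_isEP (B : GTT.CTy) {c : CBPV.CompCast (ρ.ty B) ρ.dynC} (hc : c.IsEP) :
    (ρ.UDyn B c).IsEP := by
  cases B <;>
    first
    | exact (ρ.valEP .U).isEP
    | exact hc.U.trans (ρ.valEP .U).isEP

theorem ampDyn_isEP (B₁ B₂ : GTT.CTy) {c : CBPV.CompCast (ρ.ty B₁) ρ.dynC}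
    {d : CBPV.CompCast (ρ.ty B₂) ρ.dynC} (hc : c.IsEP) (hd : d.IsEP) :
    (ρ.ampDyn B₁ B₂ c d).IsEP := by
  cases B₁ <;> cases B₂ <;>
    first
    | exact (ρ.compEP .amp).isEP
    | exact (hc.amp hd).trans (ρ.compEP .amp).isEP

theorem arrDyn_isEP (A : GTT.VTy) (B : GTT.CTy) {c : CBPV.ValCast (ρ.ty A) ρ.dyn}
    {d : CBPV.CompCast (ρ.ty B) ρ.dynC} (hc : c.IsEP) (hd : d.IsEP) :
    (ρ.arrDyn A B c d).IsEP := by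
  cases A <;> cases B <;>
    first
    | exact (ρ.compEP .arr).isEP
    | exact (hd.arr hc).trans (ρ.compEP .arr).isEP

theorem FDyn_isEP (A : GTT.VTy) {c : CBPV.ValCast (ρ.ty A) ρ.dyn} (hc : c.IsEP) :
    (ρ.FDyn A c).IsEP := by
  cases A <;>
    first
    | exact (ρ.compEP .F).isEP
    | exact (CBPV.CompCast.IsEP.F hc).trans (ρ.compEP .F).isEP

theorem cast_isEP {k : Kind} (T T' : GTT.Ty k) (h : NDyn T T') : (ρ.cast T T' h).IsEP := by
  induction T with
  | dyn =>
    cases T' with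
    | dyn => exact CBPV.ValCast.IsEP.id _
    | _ => exact h.elim
  | U B ih =>
    cases T' with
    | dyn => exact ρ.UDyn_isEP B (ih .dynC (.dynC B))
    | U B' => exact CBPV.CompCast.IsEP.U (ih B' h)
    | _ => exact h.elim
  | zero => exact CBPV.ValCast.IsEP.zero _
  | sum A₁ A₂ ih₁ ih₂ =>
    cases T' with
    | dyn => exact ρ.sumDyn_isEP A₁ A₂ (ih₁ .dyn (.dyn A₁)) (ih₂ .dyn (.dyn A₂))
    | sum A₁' A₂' => exact CBPV.ValCast.IsEP.sum (ih₁ A₁' h.1) (ih₂ A₂' h.2)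
    | _ => exact h.elim
  | one =>
    cases T' with
    | dyn => exact (ρ.valEP .one).isEP
    | one => exact CBPV.ValCast.IsEP.id _
    | _ => exact h.elim
  | prod A₁ A₂ ih₁ ih₂ =>
    cases T' with
    | dyn => exact ρ.prodDyn_isEP A₁ A₂ (ih₁ .dyn (.dyn A₁)) (ih₂ .dyn (.dyn A₂))
    | prod A₁' A₂' => exact CBPV.ValCast.IsEP.prod (ih₁ A₁' h.1) (ih₂ A₂' h.2)
    | _ => exact h.elim
  | dynC =>
    cases T' with
    | dynC => exact CBPV.CompCast.IsEP.id _
    | _ => exact h.elim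
  | F A ih =>
    cases T' with
    | dynC => exact ρ.FDyn_isEP A (ih .dyn (.dyn A))
    | F A' => exact CBPV.CompCast.IsEP.F (ih A' h)
    | _ => exact h.elim
  | top => exact CBPV.CompCast.IsEP.top _
  | amp B₁ B₂ ih₁ ih₂ =>
    cases T' with
    | dynC => exact ρ.ampDyn_isEP B₁ B₂ (ih₁ .dynC (.dynC B₁)) (ih₂ .dynC (.dynC B₂))
    | amp B₁' B₂' => exact CBPV.CompCast.IsEP.amp (ih₁ B₁' h.1) (ih₂ B₂' h.2)
    | _ => exact h.elim
  | arr A B ih₁ ih₂ =>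
    cases T' with
    | dynC => exact ρ.arrDyn_isEP A B (ih₁ .dyn (.dyn A)) (ih₂ .dynC (.dynC B))
    | arr A' B' => exact CBPV.CompCast.IsEP.arr (ih₁ A' h.1) (ih₂ B' h.2)
    | _ => exact h.elim

/-- Up to equivalence, the cast to `?` from a sum always goes through `? + ?`, even where the
definition uses the cast from `? + ?` itself, since a sum of identities is an identity. -/
theorem sumDyn_equiv (A₁ A₂ : GTT.VTy) :
    CBPV.ValCast.Equiv
      (ρ.sumDyn A₁ A₂ (ρ.cast A₁ .dyn (.dyn A₁)) (ρ.cast A₂ .dyn (.dyn A₂)))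
      ((CBPV.ValCast.sum (ρ.cast A₁ .dyn (.dyn A₁)) (ρ.cast A₂ .dyn (.dyn A₂))).trans
        (ρ.valEP .sum).toValCast) := by
  cases A₁ <;> cases A₂ <;>
    first
    | exact .refl _
    | exact .trans (.of_eq (CBPV.ValCast.id_trans _).symm) (.trans_congr (.symm .sum_id) (.refl _))

theorem prodDyn_equiv (A₁ A₂ : GTT.VTy) :
    CBPV.ValCast.Equiv
      (ρ.prodDyn A₁ A₂ (ρ.cast A₁ .dyn (.dyn A₁)) (ρ.cast A₂ .dyn (.dyn A₂)))
      ((CBPV.ValCast.prod (ρ.cast A₁ .dyn (.dyn A₁)) (ρ.cast A₂ .dyn (.dyn A₂))).trans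
        (ρ.valEP .prod).toValCast) := by
  cases A₁ <;> cases A₂ <;>
    first
    | exact .refl _
    | exact .trans (.of_eq (CBPV.ValCast.id_trans _).symm) (.trans_congr (.symm .prod_id) (.refl _))

theorem UDyn_equiv (B : GTT.CTy) :
    CBPV.ValCast.Equiv (ρ.UDyn B (ρ.cast B .dynC (.dynC B)))
      ((CBPV.ValCast.U (ρ.cast B .dynC (.dynC B))).trans (ρ.valEP .U).toValCast) := by
  cases B <;>
    first
    | exact .refl _
    | exact .trans (.of_eq (CBPV.ValCast.id_trans _).symm)
        (.trans_congr (.symm CBPV.ValCast.Equiv.U_id) (.refl _))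

theorem ampDyn_equiv (B₁ B₂ : GTT.CTy) :
    CBPV.CompCast.Equiv
      (ρ.ampDyn B₁ B₂ (ρ.cast B₁ .dynC (.dynC B₁)) (ρ.cast B₂ .dynC (.dynC B₂)))
      ((CBPV.CompCast.amp (ρ.cast B₁ .dynC (.dynC B₁)) (ρ.cast B₂ .dynC (.dynC B₂))).trans
        (ρ.compEP .amp).toCompCast) := by
  cases B₁ <;> cases B₂ <;>
    first
    | exact .refl _
    | exact .trans (.of_eq (CBPV.CompCast.id_trans _).symm) (.trans_congr (.symm .amp_id) (.refl _))

theorem arrDyn_equiv (A : GTT.VTy) (B : GTT.CTy) :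
    CBPV.CompCast.Equiv
      (ρ.arrDyn A B (ρ.cast A .dyn (.dyn A)) (ρ.cast B .dynC (.dynC B)))
      ((CBPV.CompCast.arr (ρ.cast A .dyn (.dyn A)) (ρ.cast B .dynC (.dynC B))).trans
        (ρ.compEP .arr).toCompCast) := by
  cases A <;> cases B <;>
    first
    | exact .refl _
    | exact .trans (.of_eq (CBPV.CompCast.id_trans _).symm) (.trans_congr (.symm .arr_id) (.refl _))

theorem FDyn_equiv (A : GTT.VTy) :
    CBPV.CompCast.Equiv (ρ.FDyn A (ρ.cast A .dyn (.dyn A)))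
      ((CBPV.CompCast.F (ρ.cast A .dyn (.dyn A))).trans (ρ.compEP .F).toCompCast) := by
  cases A <;>
    first
    | exact .refl _
    | exact .trans (.of_eq (CBPV.CompCast.id_trans _).symm) (.trans_congr (.symm .F_id) (.refl _))

/-- A cast from a type to itself is an identity. This needs `η`, as the cast recurses through the
type. -/
theorem cast_refl {k : Kind} (T : GTT.Ty k) (h : NDyn T T) :
    (ρ.cast T T h).Equiv (.id (ρ.ty T)) := by
  induction T with
  | dyn => exact CBPV.ValCast.Equiv.refl _
  | U B ih =>
    exact (CBPV.ValCast.Equiv.U_congr (ρ.cast_isEP B B h) (.id _) (ih h)).trans .U_id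
  | zero => exact CBPV.ValCast.Equiv.zero (.id _)
  | sum A₁ A₂ ih₁ ih₂ =>
    exact (CBPV.ValCast.Equiv.sum_congr (ρ.cast_isEP A₁ A₁ h.1) (.id _)
      (ρ.cast_isEP A₂ A₂ h.2) (.id _) (ih₁ h.1) (ih₂ h.2)).trans .sum_id
  | one => exact CBPV.ValCast.Equiv.refl _
  | prod A₁ A₂ ih₁ ih₂ =>
    exact (CBPV.ValCast.Equiv.prod_congr (ρ.cast_isEP A₁ A₁ h.1) (.id _)
      (ρ.cast_isEP A₂ A₂ h.2) (.id _) (ih₁ h.1) (ih₂ h.2)).trans .prod_id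
  | dynC => exact CBPV.CompCast.Equiv.refl _
  | F A ih =>
    exact (CBPV.CompCast.Equiv.F_congr (ρ.cast_isEP A A h) (.id _) (ih h)).trans .F_id
  | top => exact CBPV.CompCast.Equiv.top (.id _)
  | amp B₁ B₂ ih₁ ih₂ =>
    exact (CBPV.CompCast.Equiv.amp_congr (ρ.cast_isEP B₁ B₁ h.1) (.id _)
      (ρ.cast_isEP B₂ B₂ h.2) (.id _) (ih₁ h.1) (ih₂ h.2)).trans .amp_id
  | arr A B ih₁ ih₂ =>
    exact (CBPV.CompCast.Equiv.arr_congr (ρ.cast_isEP A A h.1) (.id _)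
      (ρ.cast_isEP B B h.2) (.id _) (ih₁ h.1) (ih₂ h.2)).trans .arr_id

/-- Casts compose. If the last type is dynamic, the composite goes through the ground type of its
outer connective, and the claim for the components passes through `sumDyn_equiv` and its
analogues. -/
theorem cast_trans {k : Kind} (T T' T'' : GTT.Ty k) (h : NDyn T T') (h' : NDyn T' T'') :
    (ρ.cast T T'' (h.trans h')).Equiv ((ρ.cast T T' h).trans (ρ.cast T' T'' h')) := by
  induction T with
  | dyn =>
    cases T' with
    | dyn => exact CBPV.ValCast.Equiv.of_eq (CBPV.ValCast.id_trans _).symm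
    | _ => exact h.elim
  | zero =>
    exact CBPV.ValCast.Equiv.zero (.trans (.zero _) (ρ.cast_isEP T' T'' h'))
  | one =>
    cases T' with
    | one => exact CBPV.ValCast.Equiv.of_eq (CBPV.ValCast.id_trans _).symm
    | dyn =>
      cases T'' with
      | dyn => exact CBPV.ValCast.Equiv.of_eq (CBPV.ValCast.trans_id _).symm
      | _ => exact h'.elim
    | _ => exact h.elim
  | U B ih =>
    cases T' with
    | dyn =>
      cases T'' with
      | dyn => exact CBPV.ValCast.Equiv.of_eq (CBPV.ValCast.trans_id _).symm
      | _ => exact h'.elim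
    | U B' =>
      have hB := ρ.cast_isEP B B' h
      cases T'' with
      | dyn =>
        have hB' := ρ.cast_isEP B' .dynC (.dynC B')
        refine (ρ.UDyn_equiv B).trans ?_
        refine .trans ?_ (.trans_congr (.refl _) (ρ.UDyn_equiv B').symm)
        refine .trans (.trans_congr ?_ (.refl _)) (.of_eq (CBPV.ValCast.trans_assoc _ _ _))
        exact (CBPV.ValCast.Equiv.U_congr (ρ.cast_isEP B .dynC _) (hB.trans hB')
          (ih B' .dynC h (.dynC B'))).trans (.U_trans hB hB')
      | U B'' =>
        have hB' := ρ.cast_isEP B' B'' h'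
        exact (CBPV.ValCast.Equiv.U_congr (ρ.cast_isEP B B'' _) (hB.trans hB')
          (ih B' B'' h h')).trans (.U_trans hB hB')
      | _ => exact h'.elim
    | _ => exact h.elim
  | sum A₁ A₂ ih₁ ih₂ =>
    cases T' with
    | dyn =>
      cases T'' with
      | dyn => exact CBPV.ValCast.Equiv.of_eq (CBPV.ValCast.trans_id _).symm
      | _ => exact h'.elim
    | sum A₁' A₂' =>
      have h₁ := ρ.cast_isEP A₁ A₁' h.1
      have h₂ := ρ.cast_isEP A₂ A₂' h.2
      cases T'' with
      | dyn =>
        have h₁' := ρ.cast_isEP A₁' .dyn (.dyn A₁')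
        have h₂' := ρ.cast_isEP A₂' .dyn (.dyn A₂')
        refine (ρ.sumDyn_equiv A₁ A₂).trans ?_
        refine .trans ?_ (.trans_congr (.refl _) (ρ.sumDyn_equiv A₁' A₂').symm)
        refine .trans (.trans_congr ?_ (.refl _)) (.of_eq (CBPV.ValCast.trans_assoc _ _ _))
        exact (CBPV.ValCast.Equiv.sum_congr (ρ.cast_isEP A₁ .dyn _) (h₁.trans h₁')
          (ρ.cast_isEP A₂ .dyn _) (h₂.trans h₂') (ih₁ A₁' .dyn h.1 (.dyn A₁'))
          (ih₂ A₂' .dyn h.2 (.dyn A₂'))).trans (.sum_trans h₁ h₁' h₂ h₂')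
      | sum A₁'' A₂'' =>
        have h₁' := ρ.cast_isEP A₁' A₁'' h'.1
        have h₂' := ρ.cast_isEP A₂' A₂'' h'.2
        exact (CBPV.ValCast.Equiv.sum_congr (ρ.cast_isEP A₁ A₁'' _) (h₁.trans h₁')
          (ρ.cast_isEP A₂ A₂'' _) (h₂.trans h₂') (ih₁ A₁' A₁'' h.1 h'.1)
          (ih₂ A₂' A₂'' h.2 h'.2)).trans (.sum_trans h₁ h₁' h₂ h₂')
      | _ => exact h'.elim
    | _ => exact h.elim
  | prod A₁ A₂ ih₁ ih₂ =>
    cases T' with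
    | dyn =>
      cases T'' with
      | dyn => exact CBPV.ValCast.Equiv.of_eq (CBPV.ValCast.trans_id _).symm
      | _ => exact h'.elim
    | prod A₁' A₂' =>
      have h₁ := ρ.cast_isEP A₁ A₁' h.1
      have h₂ := ρ.cast_isEP A₂ A₂' h.2
      cases T'' with
      | dyn =>
        have h₁' := ρ.cast_isEP A₁' .dyn (.dyn A₁')
        have h₂' := ρ.cast_isEP A₂' .dyn (.dyn A₂')
        refine (ρ.prodDyn_equiv A₁ A₂).trans ?_
        refine .trans ?_ (.trans_congr (.refl _) (ρ.prodDyn_equiv A₁' A₂').symm)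
        refine .trans (.trans_congr ?_ (.refl _)) (.of_eq (CBPV.ValCast.trans_assoc _ _ _))
        exact (CBPV.ValCast.Equiv.prod_congr (ρ.cast_isEP A₁ .dyn _) (h₁.trans h₁')
          (ρ.cast_isEP A₂ .dyn _) (h₂.trans h₂') (ih₁ A₁' .dyn h.1 (.dyn A₁'))
          (ih₂ A₂' .dyn h.2 (.dyn A₂'))).trans (.prod_trans h₁ h₁' h₂ h₂')
      | prod A₁'' A₂'' =>
        have h₁' := ρ.cast_isEP A₁' A₁'' h'.1
        have h₂' := ρ.cast_isEP A₂' A₂'' h'.2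
        exact (CBPV.ValCast.Equiv.prod_congr (ρ.cast_isEP A₁ A₁'' _) (h₁.trans h₁')
          (ρ.cast_isEP A₂ A₂'' _) (h₂.trans h₂') (ih₁ A₁' A₁'' h.1 h'.1)
          (ih₂ A₂' A₂'' h.2 h'.2)).trans (.prod_trans h₁ h₁' h₂ h₂')
      | _ => exact h'.elim
    | _ => exact h.elim
  | dynC =>
    cases T' with
    | dynC => exact CBPV.CompCast.Equiv.of_eq (CBPV.CompCast.id_trans _).symm
    | _ => exact h.elim
  | top =>
    exact CBPV.CompCast.Equiv.top (.trans (.top _) (ρ.cast_isEP T' T'' h'))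
  | F A ih =>
    cases T' with
    | dynC =>
      cases T'' with
      | dynC => exact CBPV.CompCast.Equiv.of_eq (CBPV.CompCast.trans_id _).symm
      | _ => exact h'.elim
    | F A' =>
      have hA := ρ.cast_isEP A A' h
      cases T'' with
      | dynC =>
        have hA' := ρ.cast_isEP A' .dyn (.dyn A')
        refine (ρ.FDyn_equiv A).trans ?_
        refine .trans ?_ (.trans_congr (.refl _) (ρ.FDyn_equiv A').symm)
        refine .trans (.trans_congr ?_ (.refl _)) (.of_eq (CBPV.CompCast.trans_assoc _ _ _))
        exact (CBPV.CompCast.Equiv.F_congr (ρ.cast_isEP A .dyn _) (hA.trans hA')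
          (ih A' .dyn h (.dyn A'))).trans (.F_trans hA hA')
      | F A'' =>
        have hA' := ρ.cast_isEP A' A'' h'
        exact (CBPV.CompCast.Equiv.F_congr (ρ.cast_isEP A A'' _) (hA.trans hA')
          (ih A' A'' h h')).trans (.F_trans hA hA')
      | _ => exact h'.elim
    | _ => exact h.elim
  | amp B₁ B₂ ih₁ ih₂ =>
    cases T' with
    | dynC =>
      cases T'' with
      | dynC => exact CBPV.CompCast.Equiv.of_eq (CBPV.CompCast.trans_id _).symm
      | _ => exact h'.elim
    | amp B₁' B₂' =>
      have h₁ := ρ.cast_isEP B₁ B₁' h.1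
      have h₂ := ρ.cast_isEP B₂ B₂' h.2
      cases T'' with
      | dynC =>
        have h₁' := ρ.cast_isEP B₁' .dynC (.dynC B₁')
        have h₂' := ρ.cast_isEP B₂' .dynC (.dynC B₂')
        refine (ρ.ampDyn_equiv B₁ B₂).trans ?_
        refine .trans ?_ (.trans_congr (.refl _) (ρ.ampDyn_equiv B₁' B₂').symm)
        refine .trans (.trans_congr ?_ (.refl _)) (.of_eq (CBPV.CompCast.trans_assoc _ _ _))
        exact (CBPV.CompCast.Equiv.amp_congr (ρ.cast_isEP B₁ .dynC _) (h₁.trans h₁')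
          (ρ.cast_isEP B₂ .dynC _) (h₂.trans h₂') (ih₁ B₁' .dynC h.1 (.dynC B₁'))
          (ih₂ B₂' .dynC h.2 (.dynC B₂'))).trans (.amp_trans h₁ h₁' h₂ h₂')
      | amp B₁'' B₂'' =>
        have h₁' := ρ.cast_isEP B₁' B₁'' h'.1
        have h₂' := ρ.cast_isEP B₂' B₂'' h'.2
        exact (CBPV.CompCast.Equiv.amp_congr (ρ.cast_isEP B₁ B₁'' _) (h₁.trans h₁')
          (ρ.cast_isEP B₂ B₂'' _) (h₂.trans h₂') (ih₁ B₁' B₁'' h.1 h'.1)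
          (ih₂ B₂' B₂'' h.2 h'.2)).trans (.amp_trans h₁ h₁' h₂ h₂')
      | _ => exact h'.elim
    | _ => exact h.elim
  | arr A B ih₁ ih₂ =>
    cases T' with
    | dynC =>
      cases T'' with
      | dynC => exact CBPV.CompCast.Equiv.of_eq (CBPV.CompCast.trans_id _).symm
      | _ => exact h'.elim
    | arr A' B' =>
      have h₁ := ρ.cast_isEP A A' h.1
      have h₂ := ρ.cast_isEP B B' h.2
      cases T'' with
      | dynC =>
        have h₁' := ρ.cast_isEP A' .dyn (.dyn A')
        have h₂' := ρ.cast_isEP B' .dynC (.dynC B')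
        refine (ρ.arrDyn_equiv A B).trans ?_
        refine .trans ?_ (.trans_congr (.refl _) (ρ.arrDyn_equiv A' B').symm)
        refine .trans (.trans_congr ?_ (.refl _)) (.of_eq (CBPV.CompCast.trans_assoc _ _ _))
        exact (CBPV.CompCast.Equiv.arr_congr (ρ.cast_isEP A .dyn _) (h₁.trans h₁')
          (ρ.cast_isEP B .dynC _) (h₂.trans h₂') (ih₁ A' .dyn h.1 (.dyn A'))
          (ih₂ B' .dynC h.2 (.dynC B'))).trans (.arr_trans h₁ h₁' h₂ h₂')
      | arr A'' B'' =>
        have h₁' := ρ.cast_isEP A' A'' h'.1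
        have h₂' := ρ.cast_isEP B' B'' h'.2
        exact (CBPV.CompCast.Equiv.arr_congr (ρ.cast_isEP A A'' _) (h₁.trans h₁')
          (ρ.cast_isEP B B'' _) (h₂.trans h₂') (ih₁ A' A'' h.1 h'.1)
          (ih₂ B' B'' h.2 h'.2)).trans (.arr_trans h₁ h₁' h₂ h₂')
      | _ => exact h'.elim
    | _ => exact h.elim

end DynInterp

theorem Var.map_lift_ren {α β : Type} {f : α → β} {Γ Γ' : List α} {b : α} {r : Ren Γ Γ'}
    {r' : Ren (Γ.map f) (Γ'.map f)} (h : ∀ a (x : Var Γ a), r' _ (x.map f) = (r _ x).map f)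
    (a : α) (x : Var (b :: Γ) a) :
    Ren.lift (b := f b) r' _ (x.map f) = (r.lift _ x).map f := by
  cases x with
  | z => rfl
  | s x => exact congrArg Var.s (h a x)

namespace DynInterp
open CBPV (Le Eqv)
variable (ρ : DynInterp)

/-! ### The translation commutes with substitution and plugging -/

/-- The translation commutes with renaming: `r'` is any renaming that agrees with `r`. -/
theorem tm_ren {Γ Γ' : GTT.Ctx} {g : GTT.Goal} (E : GTT.Tm Γ g) {r : Ren Γ Γ'}
    {r' : Ren (ρ.ctx Γ) (ρ.ctx Γ')}
    (h : ∀ a (x : Var Γ a), r' _ (x.map ρ.ty) = (r _ x).map ρ.ty) :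
    ρ.tm (E.ren r) = (ρ.tm E).ren r' := by
  induction E generalizing Γ' with
  | upcast hA V ih => exact (congrArg (ρ.up hA).put (ih h)).trans (CBPV.Tm.put_ren _ _ _).symm
  | dncast hB M ih => exact (congrArg (ρ.dn hB).on (ih h)).trans (CBPV.Tm.on_ren _ _ _).symm
  | var x => exact congrArg CBPV.Tm.var (h _ x).symm
  | hole => rfl
  | err => rfl
  | abort V ih => exact congrArg CBPV.Tm.abort (ih h)
  | inl V ih => exact congrArg CBPV.Tm.inl (ih h)
  | inr V ih => exact congrArg CBPV.Tm.inr (ih h)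
  | caseOf V E₁ E₂ ih ih₁ ih₂ =>
    exact congr (congrArg₂ CBPV.Tm.caseOf (ih h) (ih₁ (Var.map_lift_ren h)))
      (ih₂ (Var.map_lift_ren h))
  | unit => rfl
  | letUnit V E ih ih' => exact congrArg₂ CBPV.Tm.letUnit (ih h) (ih' h)
  | pair V W ih ih' => exact congrArg₂ CBPV.Tm.pair (ih h) (ih' h)
  | @letPair Γ A₁ A₂ g V E ih ih' =>
    let r₁ : Ren (ρ.ctx (A₁ :: Γ)) (ρ.ctx (A₁ :: Γ')) := r'.lift
    have h₁ : ∀ a (x : Var (A₁ :: Γ) a), r₁ _ (x.map ρ.ty) = (r.lift _ x).map ρ.ty :=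
      Var.map_lift_ren h
    have h' := Var.map_lift_ren (b := A₂) h₁
    exact congrArg₂ CBPV.Tm.letPair (ih h) (ih' h')
  | thunk M ih => exact congrArg CBPV.Tm.thunk (ih h)
  | force V ih => exact congrArg CBPV.Tm.force (ih h)
  | ret V ih => exact congrArg CBPV.Tm.ret (ih h)
  | bind M N ih ih' => exact congrArg₂ CBPV.Tm.bind (ih h) (ih' (Var.map_lift_ren h))
  | lam M ih => exact congrArg CBPV.Tm.lam (ih (Var.map_lift_ren h))
  | app M V ih ih' => exact congrArg₂ CBPV.Tm.app (ih h) (ih' h)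
  | topI => rfl
  | ampI M N ih ih' => exact congrArg₂ CBPV.Tm.ampI (ih h) (ih' h)
  | fst M ih => exact congrArg CBPV.Tm.fst (ih h)
  | snd M ih => exact congrArg CBPV.Tm.snd (ih h)

theorem tm_wk {Γ : GTT.Ctx} {g : GTT.Goal} {A : GTT.VTy} (E : GTT.Tm Γ g) :
    ρ.tm (E.wk (A := A)) = (ρ.tm E).wk (A := ρ.ty A) := ρ.tm_ren E fun _ _ => rfl

/-- `τ` translates the GTT substitution `σ`. -/
def Translates {Γ Γ' : GTT.Ctx} (σ : GTT.Sub Γ Γ') (τ : CBPV.Sub (ρ.ctx Γ) (ρ.ctx Γ')) : Prop :=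
  ∀ A (x : Var Γ A), τ _ (x.map ρ.ty) = ρ.tm (σ _ x)

variable {ρ} in
theorem Translates.lift {Γ Γ' : GTT.Ctx} {A : GTT.VTy} {σ : GTT.Sub Γ Γ'}
    {τ : CBPV.Sub (ρ.ctx Γ) (ρ.ctx Γ')} (h : ρ.Translates σ τ) :
    ρ.Translates (σ.lift (A := A)) (τ.lift (A := ρ.ty A)) := by
  intro C x
  cases x with
  | z => rfl
  | s x => exact (congrArg CBPV.Tm.wk (h C x)).trans (ρ.tm_wk _).symm

theorem tm_subst {Γ Γ' : GTT.Ctx} {g : GTT.Goal} (E : GTT.Tm Γ g) {σ : GTT.Sub Γ Γ'}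
    {τ : CBPV.Sub (ρ.ctx Γ) (ρ.ctx Γ')} (h : ρ.Translates σ τ) :
    ρ.tm (E.subst σ) = (ρ.tm E).subst τ := by
  induction E generalizing Γ' with
  | upcast hA V ih => exact (congrArg (ρ.up hA).put (ih h)).trans (CBPV.Tm.put_subst _ _ _).symm
  | dncast hB M ih => exact (congrArg (ρ.dn hB).on (ih h)).trans (CBPV.Tm.on_subst _ _ _).symm
  | var x => exact (h _ x).symm
  | hole => rfl
  | err => rfl
  | abort V ih => exact congrArg CBPV.Tm.abort (ih h)
  | inl V ih => exact congrArg CBPV.Tm.inl (ih h)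
  | inr V ih => exact congrArg CBPV.Tm.inr (ih h)
  | caseOf V E₁ E₂ ih ih₁ ih₂ =>
    exact congr (congrArg₂ CBPV.Tm.caseOf (ih h) (ih₁ h.lift)) (ih₂ h.lift)
  | unit => rfl
  | letUnit V E ih ih' => exact congrArg₂ CBPV.Tm.letUnit (ih h) (ih' h)
  | pair V W ih ih' => exact congrArg₂ CBPV.Tm.pair (ih h) (ih' h)
  | letPair V E ih ih' => exact congrArg₂ CBPV.Tm.letPair (ih h) (ih' h.lift.lift)
  | thunk M ih => exact congrArg CBPV.Tm.thunk (ih h)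
  | force V ih => exact congrArg CBPV.Tm.force (ih h)
  | ret V ih => exact congrArg CBPV.Tm.ret (ih h)
  | bind M N ih ih' => exact congrArg₂ CBPV.Tm.bind (ih h) (ih' h.lift)
  | lam M ih => exact congrArg CBPV.Tm.lam (ih h.lift)
  | app M V ih ih' => exact congrArg₂ CBPV.Tm.app (ih h) (ih' h)
  | topI => rfl
  | ampI M N ih ih' => exact congrArg₂ CBPV.Tm.ampI (ih h) (ih' h)
  | fst M ih => exact congrArg CBPV.Tm.fst (ih h)
  | snd M ih => exact congrArg CBPV.Tm.snd (ih h)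

theorem tm_fill {Γ : GTT.Ctx} {Δ : GTT.Stoup} {B₁ B₂ : GTT.CTy}
    (S : GTT.Tm Γ (.comp (some B₁) B₂)) (N : GTT.Tm Γ (.comp Δ B₁)) :
    ρ.tm (S.fill N) = CBPV.Tm.fill (ρ.tm S) (ρ.tm N) := by
  suffices ∀ {Γ : GTT.Ctx} {g : GTT.Goal} (S : GTT.Tm Γ g) {B₂ : GTT.CTy}
      (h : g = .comp (some B₁) B₂) (N : GTT.Tm Γ (.comp Δ B₁)),
      ρ.tm (S.plug h N) = CBPV.Tm.plug (ρ.tm S) (congrArg ρ.goal h) (ρ.tm N) from this S rfl N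
  intro Γ g S
  induction S with
  | dncast hB M ih =>
    intro _ h N; cases h
    exact (congrArg (ρ.dn hB).on (ih rfl N)).trans (CBPV.Tm.on_fill _ _ _).symm
  | hole => intro _ h N; cases h; rfl
  | abort V _ => intro _ h N; cases h; rfl
  | caseOf V E₁ E₂ _ ih₁ ih₂ =>
    intro _ h N; cases h
    refine congrArg₂ (CBPV.Tm.caseOf _) ((ih₁ rfl _).trans ?_) ((ih₂ rfl _).trans ?_) <;>
      (rw [tm_wk]; rfl)
  | letUnit V E _ ih =>
    intro _ h N; cases h; exact congrArg (CBPV.Tm.letUnit _) (ih rfl N)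
  | letPair V E _ ih =>
    intro _ h N; cases h
    refine congrArg (CBPV.Tm.letPair _) ((ih rfl _).trans ?_)
    rw [tm_wk, tm_wk]; rfl
  | bind M L ih _ =>
    intro _ h N; cases h; exact congrArg (CBPV.Tm.bind · (ρ.tm L)) (ih rfl N)
  | lam M ih =>
    intro _ h N; cases h
    refine congrArg CBPV.Tm.lam ((ih rfl _).trans ?_)
    rw [tm_wk]; rfl
  | app M V ih _ =>
    intro _ h N; cases h; exact congrArg (CBPV.Tm.app · (ρ.tm V)) (ih rfl N)
  | topI => intro _ h N; cases h; rfl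
  | ampI M L ih ih' =>
    intro _ h N; cases h; exact congrArg₂ CBPV.Tm.ampI (ih rfl N) (ih' rfl N)
  | fst M ih => intro _ h N; cases h; exact congrArg CBPV.Tm.fst (ih rfl N)
  | snd M ih => intro _ h N; cases h; exact congrArg CBPV.Tm.snd (ih rfl N)
  | _ => intro _ h; cases h

theorem tm_betaEta {Γ : GTT.Ctx} {g : GTT.Goal} {E E' : GTT.Tm Γ g} (h : GTT.BetaEta E E') :
    Eqv (ρ.tm E) (ρ.tm E') := by
  cases h with
  | sumBetaL V E₁ E₂ =>
    refine (Eqv.sumBetaL _ _ _).trans (.of_eq (ρ.tm_subst _ ?_).symm)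
    intro A x; cases x <;> rfl
  | sumBetaR V E₁ E₂ =>
    refine (Eqv.sumBetaR _ _ _).trans (.of_eq (ρ.tm_subst _ ?_).symm)
    intro A x; cases x <;> rfl
  | @sumEta Γ A₁ A₂ g E =>
    refine (Eqv.betaEta (.sumEta _)).trans
      (.caseOf (.refl _) (.of_eq (ρ.tm_subst (Γ' := A₁ :: .sum A₁ A₂ :: Γ) E ?_).symm)
        (.of_eq (ρ.tm_subst (Γ' := A₂ :: .sum A₁ A₂ :: Γ) E ?_).symm)) <;>
      (intro A x; cases x <;> rfl)
  | zeroEta E => exact Eqv.betaEta (.zeroEta _)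
  | prodBeta V₁ V₂ E =>
    refine (Eqv.prodBeta _ _ _).trans (.of_eq (ρ.tm_subst _ ?_).symm)
    intro A x; rcases x with _ | _ | x <;> rfl
  | @prodEta Γ A₁ A₂ g E =>
    refine (Eqv.betaEta (.prodEta _)).trans (.letPair (.refl _)
      (.of_eq (ρ.tm_subst (Γ' := A₂ :: A₁ :: .prod A₁ A₂ :: Γ) E ?_).symm))
    intro A x; cases x <;> rfl
  | oneBeta E => exact Eqv.betaEta (.oneBeta _)
  | @oneEta Γ g E =>
    refine (Eqv.betaEta (.oneEta _)).trans
      (.of_eq (congrArg (CBPV.Tm.letUnit _) (ρ.tm_subst (Γ' := .one :: Γ) E ?_).symm))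
    intro A x; cases x <;> rfl
  | UBeta M => exact Eqv.UBeta _
  | UEta => exact Eqv.betaEta .UEta
  | FBeta V M =>
    refine (Eqv.FBeta _ _).trans (.of_eq (ρ.tm_subst _ ?_).symm)
    intro A x; cases x <;> rfl
  | FEta M =>
    refine (Eqv.betaEta (.FEta _)).trans (.bind (.refl _) (.of_eq ?_))
    rw [tm_fill, tm_wk]; rfl
  | arrBeta M V =>
    refine (Eqv.arrBeta _ _).trans (.of_eq (ρ.tm_subst _ ?_).symm)
    intro A x; cases x <;> rfl
  | arrEta => exact Eqv.betaEta .arrEta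
  | ampBetaL M₁ M₂ => exact Eqv.ampBetaL _ _
  | ampBetaR M₁ M₂ => exact Eqv.ampBetaR _ _
  | ampEta => exact Eqv.betaEta .ampEta
  | topEta => exact Eqv.betaEta .topEta

/-! ### Casts between contexts and between stoups -/

/-- The upcast and downcast of `A ⊑ A'`. -/
def valCast {A A' : GTT.VTy} (h : GTT.Dyn A A') : CBPV.ValCast (ρ.ty A) (ρ.ty A') :=
  ρ.cast A A' h.ndyn

/-- The upcast and downcast of `B ⊑ B'`. -/
def compCast {B B' : GTT.CTy} (h : GTT.Dyn B B') : CBPV.CompCast (ρ.ty B) (ρ.ty B') :=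
  ρ.cast B B' h.ndyn

theorem valCast_isEP {A A' : GTT.VTy} (h : GTT.Dyn A A') : (ρ.valCast h).IsEP :=
  ρ.cast_isEP A A' h.ndyn

theorem compCast_isEP {B B' : GTT.CTy} (h : GTT.Dyn B B') : (ρ.compCast h).IsEP :=
  ρ.cast_isEP B B' h.ndyn

theorem up_refl {A : GTT.VTy} (h : GTT.Dyn A A) {Γ : CBPV.Ctx} (V : CBPV.Tm Γ (.val (ρ.ty A))) :
    Eqv ((ρ.up h).put V) V := by
  have e : CBPV.ValCast.Equiv (ρ.valCast h) (.id _) := ρ.cast_refl A h.ndyn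
  exact ⟨.put e.up.1 (.refl V), .put e.up.2 (.refl V)⟩

theorem up_trans {A A' A'' : GTT.VTy} (h : GTT.Dyn A A') (h' : GTT.Dyn A' A'')
    (h'' : GTT.Dyn A A'') {Γ : CBPV.Ctx} (V : CBPV.Tm Γ (.val (ρ.ty A))) :
    Eqv ((ρ.up h'').put V) ((ρ.up h').put ((ρ.up h).put V)) := by
  have e : CBPV.ValCast.Equiv (ρ.valCast h'') ((ρ.valCast h).trans (ρ.valCast h')) :=
    ρ.cast_trans A A' A'' h.ndyn h'.ndyn
  rw [← CBPV.Tm.put_put]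
  exact ⟨.put e.up.1 (.refl V), .put e.up.2 (.refl V)⟩

theorem dn_refl {B : GTT.CTy} (h : GTT.Dyn B B) {Γ : CBPV.Ctx} {Δ : CBPV.Stoup}
    (M : CBPV.Tm Γ (.comp Δ (ρ.ty B))) : Eqv ((ρ.dn h).on M) M := by
  have e : CBPV.CompCast.Equiv (ρ.compCast h) (.id _) := ρ.cast_refl B h.ndyn
  exact ⟨.on e.dn.1 (.refl M), .on e.dn.2 (.refl M)⟩

theorem dn_trans {B B' B'' : GTT.CTy} (h : GTT.Dyn B B') (h' : GTT.Dyn B' B'')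
    (h'' : GTT.Dyn B B'') {Γ : CBPV.Ctx} {Δ : CBPV.Stoup}
    (M : CBPV.Tm Γ (.comp Δ (ρ.ty B''))) :
    Eqv ((ρ.dn h'').on M) ((ρ.dn h).on ((ρ.dn h').on M)) := by
  have e : CBPV.CompCast.Equiv (ρ.compCast h'') ((ρ.compCast h).trans (ρ.compCast h')) :=
    ρ.cast_trans B B' B'' h.ndyn h'.ndyn
  rw [← CBPV.Tm.on_on]
  exact ⟨.on e.dn.1 (.refl M), .on e.dn.2 (.refl M)⟩

theorem upSub_refl {Γ : GTT.Ctx} (Φ : GTT.CtxDyn Γ Γ) (C : CBPV.VTy) (x : Var (ρ.ctx Γ) C) :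
    Eqv (ρ.upSub Φ C x) (.var x) := by
  induction Γ with
  | nil => cases x
  | cons A Γ ih =>
    cases x with
    | z => exact ρ.up_refl _ _
    | s x => exact ⟨(ih Φ.tail x).1.wk, (ih Φ.tail x).2.wk⟩

theorem subst_upSub_refl {Γ : GTT.Ctx} (Φ : GTT.CtxDyn Γ Γ) {g : CBPV.Goal}
    (E : CBPV.Tm (ρ.ctx Γ) g) : Eqv (E.subst (ρ.upSub Φ)) E := by
  constructor
  · conv_rhs => rw [← E.subst_id]
    exact .subst_mono (.refl _) fun C x => (ρ.upSub_refl Φ C x).1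
  · conv_lhs => rw [← E.subst_id]
    exact .subst_mono (.refl _) fun C x => (ρ.upSub_refl Φ C x).2

theorem upSub_trans {Γ Γ' Γ'' : GTT.Ctx} (Φ : GTT.CtxDyn Γ Γ') (Φ' : GTT.CtxDyn Γ' Γ'')
    (C : CBPV.VTy) (x : Var (ρ.ctx Γ'') C) :
    Eqv (ρ.upSub (Φ.trans Φ') C x) ((ρ.upSub Φ' C x).subst (ρ.upSub Φ)) := by
  induction Φ generalizing Γ'' with
  | nil => cases Φ'; cases x
  | cons h Φ ih =>
    cases Φ' with
    | cons h' Φ' =>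
      cases x with
      | z =>
        refine (ρ.up_trans h h' _ _).trans (.of_eq ?_)
        exact (CBPV.Tm.put_subst (ρ.up h') (.var .z) (ρ.upSub (GTT.CtxDyn.cons h Φ))).symm
      | s x =>
        have e : ((ρ.upSub Φ' C x).wk).subst (ρ.upSub (GTT.CtxDyn.cons h Φ)) =
            ((ρ.upSub Φ' C x).subst (ρ.upSub Φ)).wk := by
          refine (CBPV.Tm.wk_subst_cons _ _ _).trans ?_
          rw [CBPV.Tm.wk, CBPV.Tm.ren_subst]; rfl
        exact .trans ⟨(ih Φ' x).1.wk, (ih Φ' x).2.wk⟩ (.of_eq e.symm)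

theorem upSub_var {Γ Γ' Ξ Ξ' : GTT.Ctx} {A A' : GTT.VTy} (Φ : GTT.CtxDyn Γ Γ')
    (h : GTT.Dyn A A') (Χ : GTT.CtxDyn Ξ Ξ') :
    ρ.upSub (Χ.append (.cons h Φ)) _ ((Var.at Ξ').map ρ.ty) =
      (ρ.up h).put (.var ((Var.at Ξ).map ρ.ty)) := by
  induction Χ with
  | nil => rfl
  | cons h' Χ ih => exact (congrArg CBPV.Tm.wk ih).trans (CBPV.Tm.put_wk _ _)

/-- The translation of the substitution `Sub.at` of `W` for a variable in the middle. -/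
def subAt {Γ : GTT.Ctx} {A : GTT.VTy} (W : CBPV.Tm (ρ.ctx Γ) (.val (ρ.ty A))) :
    (Ξ : GTT.Ctx) → CBPV.Sub (ρ.ctx (Ξ ++ A :: Γ)) (ρ.ctx (Ξ ++ Γ))
  | [] => CBPV.Sub.cons W CBPV.Sub.id
  | _ :: Ξ => (subAt W Ξ).lift

theorem translates_at {Γ : GTT.Ctx} {A : GTT.VTy} (V : GTT.Tm Γ (.val A)) (Ξ : GTT.Ctx) :
    ρ.Translates (GTT.Sub.at V Ξ) (ρ.subAt (ρ.tm V) Ξ) := by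
  induction Ξ with
  | nil => intro C x; cases x <;> rfl
  | cons D Ξ ih => exact ih.lift

/-- Substituting in the middle of a context is compatible with the upcasts of contexts. -/
theorem upSub_at_le {Γ Γ' Ξ Ξ' : GTT.Ctx} {A A' : GTT.VTy} {Φ : GTT.CtxDyn Γ Γ'}
    {h : GTT.Dyn A A'} (Χ : GTT.CtxDyn Ξ Ξ') {W : CBPV.Tm (ρ.ctx Γ) (.val (ρ.ty A))}
    {W' : CBPV.Tm (ρ.ctx Γ') (.val (ρ.ty A'))}
    (hW : Le ((ρ.up h).put W) (W'.subst (ρ.upSub Φ))) (C : CBPV.VTy)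
    (x : Var (ρ.ctx (Ξ' ++ A' :: Γ')) C) :
    Le ((ρ.upSub (Χ.append (.cons h Φ)) C x).subst (ρ.subAt W Ξ))
      ((ρ.subAt W' Ξ' C x).subst (ρ.upSub (Χ.append Φ))) := by
  induction Χ with
  | nil =>
    cases x with
    | z => exact .trans (.of_eq (CBPV.Tm.put_subst _ _ _)) hW
    | s x =>
      exact .of_eq ((CBPV.Tm.wk_subst_cons _ _ _).trans (CBPV.Tm.subst_id _))
  | cons h' Χ ih =>
    cases x with
    | z => exact .of_eq (CBPV.Tm.put_subst _ _ _)
    | s x =>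
      refine .trans (.of_eq (CBPV.Tm.wk_subst _ _)) (.trans (ih x).wk (.of_eq ?_))
      refine .trans ?_ (CBPV.Tm.wk_subst_cons _ _ _).symm
      rw [CBPV.Tm.wk, CBPV.Tm.ren_subst]; rfl

end DynInterp
namespace CBPV

/-! ### Commuting conversions -/

/-- An operation on terms that commutes with substitution and is monotone, such as `V ↦ u[V]` for
a closed value `u`, or `M ↦ S[M]` for a closed stack `S`. -/
structure Natural {g g' : Goal} (K : ∀ {Γ : Ctx}, Tm Γ g → Tm Γ g') : Prop where
  subst : ∀ {Γ Γ' : Ctx} (E : Tm Γ g) (σ : Sub Γ Γ'), (K E).subst σ = K (E.subst σ)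
  mono : ∀ {Γ : Ctx} {E E' : Tm Γ g}, Le E E' → Le (K E) (K E')

namespace Natural
variable {g g' : Goal}

theorem id : Natural (g := g) fun E => E := ⟨fun _ _ => rfl, fun h => h⟩

theorem put {A A' : VTy} (u : Tm [A] (.val A')) : Natural fun V => u.put V :=
  ⟨Tm.put_subst u, .put (.refl u)⟩

theorem on {Δ : Stoup} {B B' : CTy} (S : Tm [] (.comp (some B) B')) :
    Natural (g := .comp Δ B) fun M => S.on M :=
  ⟨Tm.on_subst S, .on (.refl S)⟩

variable {K : ∀ {Γ : Ctx}, Tm Γ g → Tm Γ g'} {Γ : Ctx} {A₁ A₂ : VTy}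

theorem congr (hK : Natural K) {E E' : Tm Γ g} (h : Eqv E E') : Eqv (K E) (K E') :=
  ⟨hK.mono h.1, hK.mono h.2⟩

/-- By `η` for sums, applied to `K (case x …)` as a term in `x`, at `x = V`. -/
theorem caseOf (hK : Natural K) (V : Tm Γ (.val (.sum A₁ A₂))) (E₁ : Tm (A₁ :: Γ) g)
    (E₂ : Tm (A₂ :: Γ) g) : Eqv (K (.caseOf V E₁ E₂)) (.caseOf V (K E₁) (K E₂)) := by
  have h := Eqv.sumEta (K (.caseOf (.var .z) (E₁.ren (Ren.lift Ren.wk))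
    (E₂.ren (Ren.lift Ren.wk)))) V
  simp only [hK.subst, Tm.subst, Tm.subst_ren, Sub.cons_z] at h
  refine .trans (.of_eq ?_) (h.trans (.caseOf (.refl V)
    (hK.congr ((Eqv.sumBetaL _ _ _).trans (.of_eq ?_)))
    (hK.congr ((Eqv.sumBetaR _ _ _).trans (.of_eq ?_)))))
  · rw [Tm.subst_eq_self, Tm.subst_eq_self] <;> (intro C x; cases x <;> rfl)
  · rw [Tm.subst_subst]; apply Tm.subst_eq_self; intro C x; cases x <;> rfl
  · rw [Tm.subst_subst]; apply Tm.subst_eq_self; intro C x; cases x <;> rfl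

theorem letPair (hK : Natural K) (V : Tm Γ (.val (.prod A₁ A₂))) (E : Tm (A₂ :: A₁ :: Γ) g) :
    Eqv (K (.letPair V E)) (.letPair V (K E)) := by
  have h := Eqv.prodEta (K (.letPair (.var .z) (E.ren (Ren.lift (Ren.lift Ren.wk))))) V
  simp only [hK.subst, Tm.subst, Tm.subst_ren, Sub.cons_z] at h
  refine .trans (.of_eq ?_) (h.trans (.letPair (.refl V)
    (hK.congr ((Eqv.prodBeta _ _ _).trans (.of_eq ?_)))))
  · rw [Tm.subst_eq_self]; intro C x; rcases x with _ | _ | x <;> rfl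
  · rw [Tm.subst_subst]; apply Tm.subst_eq_self; intro C x; rcases x with _ | _ | x <;> rfl

theorem letUnit (hK : Natural K) (V : Tm Γ (.val .one)) (E : Tm Γ g) :
    Eqv (K (.letUnit V E)) (.letUnit V (K E)) := by
  have h := Eqv.oneEta (K (.letUnit (.var .z) E.wk)) V
  simp only [hK.subst, Tm.subst, Sub.cons_z, Tm.wk_subst_cons, Tm.subst_id] at h
  have h' := hK.congr (Eqv.betaEta (.oneBeta E))
  exact h.trans ⟨.letUnit (.refl V) h'.1, .letUnit (.refl V) h'.2⟩

end Natural

/-- The substitution `σ`, extended by the upcast `u` of the newest variable. -/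
def Sub.under {Γ Γ' : Ctx} {A A' : VTy} (u : Tm [A] (.val A')) (σ : Sub Γ' Γ) :
    Sub (A' :: Γ') (A :: Γ) := Sub.cons (u.put (.var .z)) fun _ x => (σ _ x).wk

theorem Tm.subst_under {Γ Γ' : Ctx} {A A' : VTy} {g : Goal} (E : Tm (A' :: Γ') g)
    (u : Tm [A] (.val A')) (σ : Sub Γ' Γ) :
    E.subst (σ.under u) =
      (E.subst σ.lift).subst (Sub.cons (u.put (.var .z)) fun _ x => .var (.s x)) := by
  rw [Tm.subst_subst]; apply Tm.subst_congr; intro C x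
  cases x <;> simp [Sub.under, Tm.subst]

/-! ### The congruence rules of term dynamism -/

section congruence
variable {Γ Γ' : Ctx} {Δ : Stoup} {A A' A₁ A₁' A₂ A₂' : VTy} {B B' B₁ B₁' B₂ B₂' : CTy}
  {g g' : Goal} {K : ∀ {Γ : Ctx}, Tm Γ g → Tm Γ g'} {σ : Sub Γ' Γ}

/-- The value on the left is taken apart by `η`, so that the upcast of a sum computes on
injections; `K` is then moved out of the branches. -/
theorem caseOf_le (hK : Natural K) {c : ValCast A₁ A₁'} {d : ValCast A₂ A₂'}
    {V : Tm Γ (.val (.sum A₁ A₂))} {V' : Tm Γ' (.val (.sum A₁' A₂'))} {E₁ : Tm (A₁ :: Γ) g'}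
    {E₂ : Tm (A₂ :: Γ) g'} {E₁' : Tm (A₁' :: Γ') g} {E₂' : Tm (A₂' :: Γ') g}
    (hV : Le ((ValCast.sum c d).up.put V) (V'.subst σ))
    (h₁ : Le E₁ (K (E₁'.subst (σ.under c.up)))) (h₂ : Le E₂ (K (E₂'.subst (σ.under d.up)))) :
    Le (.caseOf V E₁ E₂) (K ((Tm.caseOf V' E₁' E₂').subst σ)) := by
  refine .trans ?_ (hK.mono (.caseOf hV (.refl _) (.refl _)))
  refine (Le.caseOf (.refl V) h₁ h₂).trans ((hK.caseOf _ _ _).2.trans (hK.mono ?_))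
  have h := Eqv.sumEta (.caseOf ((ValCast.sum c d).up.put (.var .z))
    ((E₁'.subst σ.lift).ren (Ren.lift Ren.wk)) ((E₂'.subst σ.lift).ren (Ren.lift Ren.wk))) V
  simp only [Tm.subst, Tm.put_subst, Sub.cons_z, Tm.subst_ren] at h
  refine .trans (Le.caseOf (.refl V) ?_ ?_) (h.2.trans (.of_eq ?_))
  · refine .trans ?_ (Le.caseOf (ValCast.sum_up_inl c d _ ).2 (.refl _) (.refl _))
    refine .trans (.of_eq ?_) (Eqv.sumBetaL _ _ _).2
    rw [Tm.subst_under, Tm.subst_subst (E₁'.subst σ.lift)]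
    apply Tm.subst_congr; intro C x; cases x <;> rfl
  · refine .trans ?_ (Le.caseOf (ValCast.sum_up_inr c d _ ).2 (.refl _) (.refl _))
    refine .trans (.of_eq ?_) (Eqv.sumBetaR _ _ _).2
    rw [Tm.subst_under, Tm.subst_subst (E₂'.subst σ.lift)]
    apply Tm.subst_congr; intro C x; cases x <;> rfl
  · congr 1 <;> (apply Tm.subst_eq_self; intro C x; cases x <;> rfl)

theorem letPair_le (hK : Natural K) {c : ValCast A₁ A₁'} {d : ValCast A₂ A₂'}
    {V : Tm Γ (.val (.prod A₁ A₂))} {V' : Tm Γ' (.val (.prod A₁' A₂'))}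
    {E : Tm (A₂ :: A₁ :: Γ) g'} {E' : Tm (A₂' :: A₁' :: Γ') g}
    (hV : Le ((ValCast.prod c d).up.put V) (V'.subst σ))
    (h : Le E (K (E'.subst ((σ.under c.up).under d.up)))) :
    Le (.letPair V E) (K ((Tm.letPair V' E').subst σ)) := by
  refine .trans ?_ (hK.mono (.letPair hV (.refl _)))
  refine (Le.letPair (.refl V) h).trans ((hK.letPair _ _).2.trans (hK.mono ?_))
  have h := Eqv.prodEta (.letPair ((ValCast.prod c d).up.put (.var .z))
    ((E'.subst σ.lift.lift).ren (Ren.lift (Ren.lift Ren.wk)))) V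
  simp only [Tm.subst, Tm.put_subst, Sub.cons_z, Tm.subst_ren] at h
  refine .trans (Le.letPair (.refl V) ?_) (h.2.trans (.of_eq ?_))
  · refine .trans ?_ (Le.letPair (ValCast.prod_up_pair c d _ _).2 (.refl _))
    refine .trans (.of_eq ?_) (Eqv.prodBeta _ _ _).2
    rw [Tm.subst_subst, Tm.subst_subst]; apply Tm.subst_congr; intro C x
    rcases x with _ | _ | x
    · rfl
    · simp [Sub.under, Tm.subst]; rfl
    · simp only [Sub.under, Sub.cons_s, Sub.lift_s, Tm.wk, Tm.subst_ren, Tm.ren_ren]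
      exact Tm.ren_eq_subst _ _
  · congr 1; apply Tm.subst_eq_self; intro C x; rcases x with _ | _ | x <;> rfl

theorem letUnit_le (hK : Natural K) {V : Tm Γ (.val .one)} {V' : Tm Γ' (.val .one)}
    {E : Tm Γ g'} {E' : Tm Γ' g} (hV : Le V (V'.subst σ)) (h : Le E (K (E'.subst σ))) :
    Le (.letUnit V E) (K ((Tm.letUnit V' E').subst σ)) :=
  (Le.letUnit hV h).trans (hK.letUnit _ _).2

theorem force_le {c : CompCast B B'} (hc : c.IsEP) {V : Tm Γ (.val (.U B))}
    {V' : Tm Γ (.val (.U B'))} (h : Le (c.up.put V) V') :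
    Le (.force V) (c.dn.on (.force V')) :=
  (hc.force V).2.trans (.on (.refl _) (.force h))

/-- One half of the adjunction between embedding and projection; `force_le` is the other. -/
theorem thunk_le {c : CompCast B B'} (hc : c.IsEP) {M : Tm Γ (.comp none B)}
    {M' : Tm Γ (.comp none B')} (h : Le M (c.dn.on M')) :
    Le (c.up.put (.thunk M)) (.thunk M') :=
  (c.thunk_embed M).2.trans (.thunk ((c.embed_mono h).trans (hc.projection M')))

theorem ret_le {c : ValCast A A'} (hc : c.IsEP) {V : Tm Γ (.val A)} {V' : Tm Γ (.val A')}
    (h : Le (c.up.put V) V') : Le (.ret V) (c.dn.on (.ret V')) :=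
  (hc.retraction V).2.trans (.on (.refl _) (.ret h))

theorem bind_le {c : ValCast A A'} (hc : c.IsEP) (S : Tm [] (.comp (some B') B))
    {M : Tm Γ (.comp Δ (.F A))} {M' : Tm Γ (.comp Δ (.F A'))} {N : Tm (A :: Γ) (.comp none B)}
    {N' : Tm (A' :: Γ') (.comp none B')} (hM : Le M (c.dn.on M'))
    (hN : Le N (S.on (N'.subst (σ.under c.up)))) :
    Le (.bind M N) (S.on (.bind M' (N'.subst σ.lift))) := by
  refine (Le.bind hM hN).trans ((Eqv.on_bind _ _ _).2.trans (.on (.refl S) ?_))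
  rw [Tm.subst_under]; exact hc.bind_le _ _

theorem lam_le (c : ValCast A A') (d : CompCast B B') {M : Tm (A :: Γ) (.comp Δ B)}
    {M' : Tm (A' :: Γ') (.comp Δ B')} (h : Le M (d.dn.on (M'.subst (σ.under c.up)))) :
    Le (.lam M) ((CompCast.arr c d).dn.on (.lam (M'.subst σ.lift))) := by
  rw [CompCast.arr_dn_on]
  refine (Le.lam h).trans (.lam (.on (.refl _) (.trans (.of_eq ?_) (Eqv.arrBeta _ _).2)))
  rw [Tm.subst_under, Tm.subst_ren]; apply Tm.subst_congr; intro C x; cases x <;> rfl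

theorem app_le (c : ValCast A A') (d : CompCast B B') {M : Tm Γ (.comp Δ (.arr A B))}
    {M' : Tm Γ (.comp Δ (.arr A' B'))} {V : Tm Γ (.val A)} {V' : Tm Γ (.val A')}
    (hM : Le M ((CompCast.arr c d).dn.on M')) (hV : Le (c.up.put V) V') :
    Le (.app M V) (d.dn.on (.app M' V')) := by
  rw [CompCast.arr_dn_on] at hM
  refine (Le.app hM (.refl V)).trans ((Eqv.arrBeta _ _).1.trans ?_)
  simp only [Tm.on_subst, Tm.subst, Tm.wk_subst_cons, Tm.subst_id, Tm.put_subst, Sub.cons_z]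
  exact .on (.refl _) (.app (.refl M') hV)

theorem ampI_le (c : CompCast B₁ B₁') (d : CompCast B₂ B₂') {M : Tm Γ (.comp Δ B₁)}
    {M' : Tm Γ (.comp Δ B₁')} {N : Tm Γ (.comp Δ B₂)} {N' : Tm Γ (.comp Δ B₂')}
    (hM : Le M (c.dn.on M')) (hN : Le N (d.dn.on N')) :
    Le (.ampI M N) ((CompCast.amp c d).dn.on (.ampI M' N')) := by
  rw [CompCast.amp_dn_on]
  exact .ampI (hM.trans (.on (.refl _) (Eqv.ampBetaL _ _).2))
    (hN.trans (.on (.refl _) (Eqv.ampBetaR _ _).2))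

theorem fst_le (c : CompCast B₁ B₁') (d : CompCast B₂ B₂') {M : Tm Γ (.comp Δ (.amp B₁ B₂))}
    {M' : Tm Γ (.comp Δ (.amp B₁' B₂'))} (hM : Le M ((CompCast.amp c d).dn.on M')) :
    Le (.fst M) (c.dn.on (.fst M')) := by
  rw [CompCast.amp_dn_on] at hM
  exact (Le.fst hM).trans (Eqv.ampBetaL _ _).1

theorem snd_le (c : CompCast B₁ B₁') (d : CompCast B₂ B₂') {M : Tm Γ (.comp Δ (.amp B₁ B₂))}
    {M' : Tm Γ (.comp Δ (.amp B₁' B₂'))} (hM : Le M ((CompCast.amp c d).dn.on M')) :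
    Le (.snd M) (d.dn.on (.snd M')) := by
  rw [CompCast.amp_dn_on] at hM
  exact (Le.snd hM).trans (Eqv.ampBetaR _ _).1

end congruence
end CBPV

namespace DynInterp
open CBPV (Le Eqv Natural)
variable (ρ : DynInterp)

/-! ### The downcast of the hole -/

section dnStoup
variable {Γ : CBPV.Ctx} {Δ Δ' : GTT.Stoup} {C C₁ C₂ : CBPV.CTy} (Ψ : GTT.StoupDyn Δ Δ')

theorem dnStoup_mono {M M' : CBPV.Tm Γ (.comp (ρ.stoup Δ) C)} (h : Le M M') :
    Le (ρ.dnStoup Ψ M) (ρ.dnStoup Ψ M') := by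
  cases Ψ with
  | none => exact h
  | some _ => exact .stkSubst (.refl _) h

theorem dnStoup_subst {Γ' : CBPV.Ctx} (M : CBPV.Tm Γ (.comp (ρ.stoup Δ) C))
    (σ : CBPV.Sub Γ Γ') : (ρ.dnStoup Ψ M).subst σ = ρ.dnStoup Ψ (M.subst σ) := by
  cases Ψ with
  | none => rfl
  | some _ => exact (CBPV.Tm.fill_subst _ _ _).trans (congrArg _ (CBPV.Tm.on_subst _ _ _))

theorem dnStoup_fill (S : CBPV.Tm Γ (.comp (some C₁) C₂))
    (M : CBPV.Tm Γ (.comp (ρ.stoup Δ) C₁)) :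
    ρ.dnStoup Ψ (S.fill M) = S.fill (ρ.dnStoup Ψ M) := by
  cases Ψ with
  | none => rfl
  | some _ => exact CBPV.Tm.fill_fill _ _ _

theorem dnStoup_abort (V : CBPV.Tm Γ (.val .zero)) :
    ρ.dnStoup Ψ (.abort V : CBPV.Tm Γ (.comp (ρ.stoup Δ) C)) = .abort V := by
  cases Ψ <;> rfl

theorem dnStoup_caseOf {A₁ A₂ : CBPV.VTy} (V : CBPV.Tm Γ (.val (.sum A₁ A₂)))
    (E₁ : CBPV.Tm (A₁ :: Γ) (.comp (ρ.stoup Δ) C)) (E₂ : CBPV.Tm (A₂ :: Γ) (.comp (ρ.stoup Δ) C)) :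
    ρ.dnStoup Ψ (.caseOf V E₁ E₂) = .caseOf V (ρ.dnStoup Ψ E₁) (ρ.dnStoup Ψ E₂) := by
  cases Ψ with
  | none => rfl
  | some _ => refine (CBPV.Tm.fill_caseOf _ _ _ _).trans ?_; simp only [CBPV.Tm.on_wk]; rfl

theorem dnStoup_letUnit (V : CBPV.Tm Γ (.val .one)) (E : CBPV.Tm Γ (.comp (ρ.stoup Δ) C)) :
    ρ.dnStoup Ψ (.letUnit V E) = .letUnit V (ρ.dnStoup Ψ E) := by
  cases Ψ <;> rfl

theorem dnStoup_letPair {A₁ A₂ : CBPV.VTy} (V : CBPV.Tm Γ (.val (.prod A₁ A₂)))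
    (E : CBPV.Tm (A₂ :: A₁ :: Γ) (.comp (ρ.stoup Δ) C)) :
    ρ.dnStoup Ψ (.letPair V E) = .letPair V (ρ.dnStoup Ψ E) := by
  cases Ψ with
  | none => rfl
  | some _ => refine (CBPV.Tm.fill_letPair _ _ _).trans ?_; simp only [CBPV.Tm.on_wk]; rfl

theorem dnStoup_bind {A : CBPV.VTy} (M : CBPV.Tm Γ (.comp (ρ.stoup Δ) (.F A)))
    (N : CBPV.Tm (A :: Γ) (.comp none C)) :
    ρ.dnStoup Ψ (.bind M N) = .bind (ρ.dnStoup Ψ M) N := by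
  cases Ψ <;> rfl

theorem dnStoup_lam {A : CBPV.VTy} (M : CBPV.Tm (A :: Γ) (.comp (ρ.stoup Δ) C)) :
    ρ.dnStoup Ψ (.lam M) = .lam (ρ.dnStoup Ψ M) := by
  cases Ψ with
  | none => rfl
  | some _ => refine (CBPV.Tm.fill_lam _ _).trans ?_; simp only [CBPV.Tm.on_wk]; rfl

theorem dnStoup_app {A : CBPV.VTy} (M : CBPV.Tm Γ (.comp (ρ.stoup Δ) (.arr A C)))
    (V : CBPV.Tm Γ (.val A)) : ρ.dnStoup Ψ (.app M V) = .app (ρ.dnStoup Ψ M) V := by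
  cases Ψ <;> rfl

theorem dnStoup_topI : ρ.dnStoup Ψ (.topI : CBPV.Tm Γ (.comp (ρ.stoup Δ) .top)) = .topI := by
  cases Ψ <;> rfl

theorem dnStoup_ampI (M : CBPV.Tm Γ (.comp (ρ.stoup Δ) C₁))
    (N : CBPV.Tm Γ (.comp (ρ.stoup Δ) C₂)) :
    ρ.dnStoup Ψ (.ampI M N) = .ampI (ρ.dnStoup Ψ M) (ρ.dnStoup Ψ N) := by
  cases Ψ <;> rfl

theorem dnStoup_fst (M : CBPV.Tm Γ (.comp (ρ.stoup Δ) (.amp C₁ C₂))) :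
    ρ.dnStoup Ψ (.fst M) = .fst (ρ.dnStoup Ψ M) := by
  cases Ψ <;> rfl

theorem dnStoup_snd (M : CBPV.Tm Γ (.comp (ρ.stoup Δ) (.amp C₁ C₂))) :
    ρ.dnStoup Ψ (.snd M) = .snd (ρ.dnStoup Ψ M) := by
  cases Ψ <;> rfl

theorem dnStoup_refl (Ψ : GTT.StoupDyn Δ Δ) (M : CBPV.Tm Γ (.comp (ρ.stoup Δ) C)) :
    Eqv (ρ.dnStoup Ψ M) M := by
  cases Ψ with
  | none => exact .refl M
  | some h =>
    have e := ρ.dn_refl h (.hole (Γ := Γ))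
    exact .trans ⟨.stkSubst e.1 (.refl M), .stkSubst e.2 (.refl M)⟩ (.of_eq M.fill_hole)

theorem dnStoup_trans {Δ'' : GTT.Stoup} (Ψ' : GTT.StoupDyn Δ' Δ'') (Ψ'' : GTT.StoupDyn Δ Δ'')
    (M : CBPV.Tm Γ (.comp (ρ.stoup Δ) C)) :
    Eqv (ρ.dnStoup Ψ'' M) (ρ.dnStoup Ψ' (ρ.dnStoup Ψ M)) := by
  cases Ψ with
  | none => cases Ψ'; exact .refl M
  | some h =>
    cases Ψ' with
    | some h' =>
      have e := ρ.dn_trans h h' Ψ''.hole (.hole (Γ := Γ))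
      refine .trans ⟨.stkSubst e.1 (.refl M), .stkSubst e.2 (.refl M)⟩ (.of_eq ?_)
      exact .trans (congrArg _ (CBPV.Tm.on_fill (ρ.dn h) .hole _).symm)
        (CBPV.Tm.fill_fill _ _ _).symm

end dnStoup
end DynInterp

namespace GTT

theorem GoalDyn.dyn_val {A A' : VTy} : GoalDyn (.val A) (.val A') → Dyn A A'
  | .val h => h

theorem GoalDyn.stoupDyn {Δ Δ' : Stoup} {B B' : CTy} :
    GoalDyn (.comp Δ B) (.comp Δ' B') → StoupDyn Δ Δ'
  | .comp Ψ _ => Ψ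

theorem GoalDyn.dyn_comp {Δ Δ' : Stoup} {B B' : CTy} :
    GoalDyn (.comp Δ B) (.comp Δ' B') → Dyn B B'
  | .comp _ h => h

end GTT

namespace DynInterp
open CBPV (Le Eqv Natural)
variable (ρ : DynInterp)

/-! ### Graduality -/

/-- The interpretation of term dynamism. The upcast of a value on the left is compared with the
value on the right in the context of the former, and a computation on the left with the downcast
of the computation on the right. -/
def Sem {Γ Γ' : GTT.Ctx} (Φ : GTT.CtxDyn Γ Γ') : {g g' : GTT.Goal} → GTT.GoalDyn g g' →
    GTT.Tm Γ g → GTT.Tm Γ' g' → Prop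
  | .val _, .val _, h, V, V' =>
      Le ((ρ.up h.dyn_val).put (ρ.tm V)) ((ρ.tm V').subst (ρ.upSub Φ))
  | .comp _ _, .comp _ _, h, M, M' =>
      Le (ρ.dnStoup h.stoupDyn (ρ.tm M)) ((ρ.dn h.dyn_comp).on ((ρ.tm M').subst (ρ.upSub Φ)))
  | _, _, _, _, _ => False

section
variable {Γ Γ' Γ'' : GTT.Ctx} {g g' g'' : GTT.Goal} {Φ : GTT.CtxDyn Γ Γ'}
  {Φ' : GTT.CtxDyn Γ' Γ''} {h : GTT.GoalDyn g g'} {h' : GTT.GoalDyn g' g''}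

/-- Between terms of the same type in the same context, `Sem` is the order of CBPV*. -/
theorem sem_refl {Γ : GTT.Ctx} {g : GTT.Goal} {E E' : GTT.Tm Γ g} (hE : Le (ρ.tm E) (ρ.tm E')) :
    ρ.Sem (.refl Γ) (.refl g) E E' := by
  cases g with
  | val A =>
    exact (ρ.up_refl _ _).1.trans (hE.trans (ρ.subst_upSub_refl _ _).2)
  | comp Δ B =>
    exact (ρ.dnStoup_refl _ _).1.trans
      (hE.trans ((ρ.subst_upSub_refl _ _).2.trans (ρ.dn_refl _ _).2))

variable {ρ} in
theorem Sem.trans {E : GTT.Tm Γ g} {E' : GTT.Tm Γ' g'} {E'' : GTT.Tm Γ'' g''}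
    (hE : ρ.Sem Φ h E E') (hE' : ρ.Sem Φ' h' E' E'') :
    ρ.Sem (Φ.trans Φ') (h.trans h') E E'' := by
  have key {g : CBPV.Goal} (E : CBPV.Tm (ρ.ctx Γ'') g) :
      Le ((E.subst (ρ.upSub Φ')).subst (ρ.upSub Φ)) (E.subst (ρ.upSub (Φ.trans Φ'))) := by
    rw [CBPV.Tm.subst_subst]
    exact .subst_mono (.refl E) fun C x => (ρ.upSub_trans Φ Φ' C x).2
  cases h with
  | val h =>
    cases h' with
    | val h' =>
      refine (ρ.up_trans h h' _ _).1.trans ?_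
      refine Le.trans (.put (.refl _) hE) ?_
      refine Le.trans (.of_eq (CBPV.Tm.put_subst _ _ _).symm) ?_
      exact Le.trans (.subst hE' _) (key _)
  | comp Ψ h =>
    cases h' with
    | comp Ψ' h' =>
      refine (ρ.dnStoup_trans Ψ Ψ' _ _).1.trans ?_
      refine Le.trans (ρ.dnStoup_mono Ψ' hE) ?_
      refine Le.trans (.of_eq (ρ.dnStoup_fill Ψ' ((ρ.dn h).ren Ren.nil) _)) ?_
      refine Le.trans (.on (.refl _) (.of_eq (ρ.dnStoup_subst Ψ' _ _).symm)) ?_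
      refine Le.trans (.on (.refl _) (.subst hE' _)) ?_
      refine Le.trans (.on (.refl _) (.of_eq (CBPV.Tm.on_subst _ _ _))) ?_
      exact Le.trans (ρ.dn_trans h h' _ _).2 (.on (.refl _) (key _))

variable {ρ} in
theorem Sem.valSubst {Ξ Ξ' : GTT.Ctx} {A A' : GTT.VTy} {hA : GTT.Dyn A A'}
    {Χ : GTT.CtxDyn Ξ Ξ'} {V : GTT.Tm Γ (.val A)} {V' : GTT.Tm Γ' (.val A')}
    {E : GTT.Tm (Ξ ++ A :: Γ) g} {E' : GTT.Tm (Ξ' ++ A' :: Γ') g'}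
    (hV : ρ.Sem Φ (.val hA) V V') (hE : ρ.Sem (Χ.append (.cons hA Φ)) h E E') :
    ρ.Sem (Χ.append Φ) h (E.subst (GTT.Sub.at V Ξ)) (E'.subst (GTT.Sub.at V' Ξ')) := by
  have e := ρ.tm_subst E (ρ.translates_at V Ξ)
  have e' := ρ.tm_subst E' (ρ.translates_at V' Ξ')
  have key : Le (((ρ.tm E').subst (ρ.upSub (Χ.append (.cons hA Φ)))).subst (ρ.subAt (ρ.tm V) Ξ))
      ((ρ.tm (E'.subst (GTT.Sub.at V' Ξ'))).subst (ρ.upSub (Χ.append Φ))) := by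
    rw [e', CBPV.Tm.subst_subst, CBPV.Tm.subst_subst]
    exact .subst_mono (.refl _) (ρ.upSub_at_le Χ hV)
  cases h with
  | val h =>
    refine Le.trans (.put (.refl _) (.of_eq e)) ?_
    refine Le.trans (.of_eq (CBPV.Tm.put_subst _ _ _).symm) ?_
    exact Le.trans (.subst hE _) key
  | comp Ψ h =>
    refine Le.trans (ρ.dnStoup_mono Ψ (.of_eq e)) ?_
    refine Le.trans (.of_eq (ρ.dnStoup_subst Ψ _ _).symm) ?_
    refine Le.trans (.subst hE _) ?_
    exact Le.trans (.of_eq (CBPV.Tm.on_subst _ _ _)) (.on (.refl _) key)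

variable {ρ} in
theorem Sem.stkSubst {Δ Δ' : GTT.Stoup} {B₁ B₁' B₂ B₂' : GTT.CTy} {Ψ : GTT.StoupDyn Δ Δ'}
    {h₁ : GTT.Dyn B₁ B₁'} {h₂ : GTT.Dyn B₂ B₂'} {M₁ : GTT.Tm Γ (.comp Δ B₁)}
    {M₁' : GTT.Tm Γ' (.comp Δ' B₁')} {M₂ : GTT.Tm Γ (.comp (some B₁) B₂)}
    {M₂' : GTT.Tm Γ' (.comp (some B₁') B₂')} (hM₁ : ρ.Sem Φ (.comp Ψ h₁) M₁ M₁')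
    (hM₂ : ρ.Sem Φ (.comp (.some h₁) h₂) M₂ M₂') :
    ρ.Sem Φ (.comp Ψ h₂) (M₂.fill M₁) (M₂'.fill M₁') := by
  refine Le.trans (ρ.dnStoup_mono Ψ (.of_eq (ρ.tm_fill M₂ M₁))) ?_
  refine Le.trans (.of_eq (ρ.dnStoup_fill Ψ _ _)) ?_
  refine Le.trans (.stkSubst hM₁ (.refl _)) ?_
  refine Le.trans (.of_eq (.trans ?_ (CBPV.Tm.fill_fill (ρ.tm M₂) ((ρ.dn h₁).on .hole)
    ((ρ.tm M₁').subst (ρ.upSub Φ))).symm)) ?_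
  · exact congrArg (CBPV.Tm.fill (ρ.tm M₂)) (CBPV.Tm.on_fill (ρ.dn h₁) .hole _).symm
  refine Le.trans (.stkSubst (.refl _) hM₂) (.of_eq ?_)
  refine (CBPV.Tm.on_fill (ρ.dn h₂) _ _).trans (congrArg (ρ.dn h₂).on ?_)
  exact (CBPV.Tm.fill_subst _ _ _).symm.trans
    (congrArg (CBPV.Tm.subst · (ρ.upSub Φ)) (ρ.tm_fill M₂' M₁').symm)

variable {ρ} in
theorem Sem.abort {V : GTT.Tm Γ (.val .zero)} {V' : GTT.Tm Γ' (.val .zero)}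
    (hV : ρ.Sem Φ (.val (.refl .zero)) V V') : ρ.Sem Φ h (.abort V) (.abort V') := by
  have hV : Le (ρ.tm V) ((ρ.tm V').subst (ρ.upSub Φ)) := (ρ.up_refl _ _).2.trans hV
  cases h with
  | val h => exact Le.trans (Eqv.zeroEta (ρ.tm V) _).1 (.abort hV)
  | comp Ψ h =>
    refine Le.trans (.of_eq (ρ.dnStoup_abort Ψ _)) ?_
    exact Le.trans (.abort hV) (Eqv.zeroEta ((ρ.tm V').subst (ρ.upSub Φ)) _).2

variable {ρ} in
theorem Sem.caseOf {A₁ A₁' A₂ A₂' : GTT.VTy} {h₁ : GTT.Dyn A₁ A₁'} {h₂ : GTT.Dyn A₂ A₂'}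
    {V : GTT.Tm Γ (.val (.sum A₁ A₂))} {V' : GTT.Tm Γ' (.val (.sum A₁' A₂'))}
    {E₁ : GTT.Tm (A₁ :: Γ) g} {E₁' : GTT.Tm (A₁' :: Γ') g'} {E₂ : GTT.Tm (A₂ :: Γ) g}
    {E₂' : GTT.Tm (A₂' :: Γ') g'} (hV : ρ.Sem Φ (.val (.sum h₁ h₂)) V V')
    (hE₁ : ρ.Sem (.cons h₁ Φ) h E₁ E₁') (hE₂ : ρ.Sem (.cons h₂ Φ) h E₂ E₂') :
    ρ.Sem Φ h (.caseOf V E₁ E₂) (.caseOf V' E₁' E₂') := by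
  cases h with
  | val h =>
    exact ((Natural.put (ρ.up h)).caseOf _ _ _).1.trans
      (CBPV.caseOf_le .id (c := ρ.valCast h₁) (d := ρ.valCast h₂) hV hE₁ hE₂)
  | comp Ψ h =>
    refine Le.trans (.of_eq (ρ.dnStoup_caseOf Ψ _ _ _)) ?_
    exact CBPV.caseOf_le (.on (ρ.dn h)) (c := ρ.valCast h₁) (d := ρ.valCast h₂) hV hE₁ hE₂

variable {ρ} in
theorem Sem.letUnit {V : GTT.Tm Γ (.val .one)} {V' : GTT.Tm Γ' (.val .one)} {E : GTT.Tm Γ g}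
    {E' : GTT.Tm Γ' g'} (hV : ρ.Sem Φ (.val (.refl .one)) V V') (hE : ρ.Sem Φ h E E') :
    ρ.Sem Φ h (.letUnit V E) (.letUnit V' E') := by
  have hV : Le (ρ.tm V) ((ρ.tm V').subst (ρ.upSub Φ)) := (ρ.up_refl _ _).2.trans hV
  cases h with
  | val h =>
    exact ((Natural.put (ρ.up h)).letUnit _ _).1.trans (CBPV.letUnit_le .id hV hE)
  | comp Ψ h =>
    refine Le.trans (.of_eq (ρ.dnStoup_letUnit Ψ _ _)) ?_
    exact CBPV.letUnit_le (.on (ρ.dn h)) hV hE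

variable {ρ} in
theorem Sem.letPair {A₁ A₁' A₂ A₂' : GTT.VTy} {h₁ : GTT.Dyn A₁ A₁'} {h₂ : GTT.Dyn A₂ A₂'}
    {V : GTT.Tm Γ (.val (.prod A₁ A₂))} {V' : GTT.Tm Γ' (.val (.prod A₁' A₂'))}
    {E : GTT.Tm (A₂ :: A₁ :: Γ) g} {E' : GTT.Tm (A₂' :: A₁' :: Γ') g'}
    (hV : ρ.Sem Φ (.val (.prod h₁ h₂)) V V') (hE : ρ.Sem (.cons h₂ (.cons h₁ Φ)) h E E') :
    ρ.Sem Φ h (.letPair V E) (.letPair V' E') := by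
  cases h with
  | val h =>
    exact ((Natural.put (ρ.up h)).letPair _ _).1.trans
      (CBPV.letPair_le .id (c := ρ.valCast h₁) (d := ρ.valCast h₂) hV hE)
  | comp Ψ h =>
    refine Le.trans (.of_eq (ρ.dnStoup_letPair Ψ _ _)) ?_
    exact CBPV.letPair_le (.on (ρ.dn h)) (c := ρ.valCast h₁) (d := ρ.valCast h₂) hV hE

/-- The contract translation is sound for term dynamism. -/
theorem graduality {E : GTT.Tm Γ g} {E' : GTT.Tm Γ' g'} (hE : GTT.TmDyn Φ h E E') :
    ρ.Sem Φ h E E' := by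
  -- The proofs of type dynamism are given as `‹_›`, since unification does not determine proofs.
  induction hE with
  | refl E => exact ρ.sem_refl (.refl _)
  | var Φ h Χ => exact .of_eq (ρ.upSub_var Φ h Χ).symm
  | trans _ _ ih ih' => exact ih.trans ih'
  | valSubst _ _ ih ih' => exact Sem.valSubst (hA := ‹_›) (Χ := ‹_›) ih ih'
  | hole Φ h => exact .of_eq (CBPV.Tm.fill_hole' _)
  | stkSubst _ _ ih ih' => exact Sem.stkSubst (Ψ := ‹_›) (h₁ := ‹_›) (h₂ := ‹_›) ih ih'
  | @inl _ _ _ _ _ _ _ h₁ h₂ _ _ _ ih =>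
    exact (CBPV.ValCast.sum_up_inl (ρ.valCast h₁) (ρ.valCast h₂) _).1.trans (.inl ih)
  | @inr _ _ _ _ _ _ _ h₁ h₂ _ _ _ ih =>
    exact (CBPV.ValCast.sum_up_inr (ρ.valCast h₁) (ρ.valCast h₂) _).1.trans (.inr ih)
  | caseOf _ _ _ ih ih₁ ih₂ => exact Sem.caseOf (h₁ := ‹_›) (h₂ := ‹_›) ih ih₁ ih₂
  | abort _ _ ih => exact ih.abort
  | unit Φ => exact (ρ.up_refl _ _).1
  | letUnit _ _ ih ih' => exact ih.letUnit ih'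
  | @pair _ _ _ _ _ _ _ h₁ h₂ _ _ _ _ _ _ ih ih' =>
    exact (CBPV.ValCast.prod_up_pair (ρ.valCast h₁) (ρ.valCast h₂) _ _).1.trans (.pair ih ih')
  | letPair _ _ ih ih' => exact Sem.letPair (h₁ := ‹_›) (h₂ := ‹_›) ih ih'
  | thunk _ ih => exact CBPV.thunk_le (ρ.compCast_isEP ‹_›) ih
  | force _ ih => exact CBPV.force_le (ρ.compCast_isEP ‹_›) ih
  | ret _ ih => exact CBPV.ret_le (ρ.valCast_isEP ‹_›) ih
  | @bind _ _ _ _ _ _ _ _ _ Ψ hA hB _ _ _ _ _ _ ih ih' =>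
    refine Le.trans (.of_eq (ρ.dnStoup_bind Ψ _ _)) ?_
    exact CBPV.bind_le (ρ.valCast_isEP hA) (ρ.dn hB) ih ih'
  | @lam _ _ _ _ _ _ _ _ _ Ψ hA hB _ _ _ ih =>
    refine Le.trans (.of_eq (ρ.dnStoup_lam Ψ _)) ?_
    exact CBPV.lam_le (ρ.valCast hA) (ρ.compCast hB) ih
  | @app _ _ _ _ _ _ _ _ _ Ψ hA hB _ _ _ _ _ _ ih ih' =>
    refine Le.trans (.of_eq (ρ.dnStoup_app Ψ _ _)) ?_
    exact CBPV.app_le (ρ.valCast hA) (ρ.compCast hB) ih ih'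
  | topI Φ Ψ => exact Le.trans (.of_eq (ρ.dnStoup_topI Ψ)) (ρ.dn_refl (.refl .top) .topI).2
  | @ampI _ _ _ _ _ _ _ _ _ Ψ h₁ h₂ _ _ _ _ _ _ ih ih' =>
    refine Le.trans (.of_eq (ρ.dnStoup_ampI Ψ _ _)) ?_
    exact CBPV.ampI_le (ρ.compCast h₁) (ρ.compCast h₂) ih ih'
  | @fst _ _ _ _ _ _ _ _ _ Ψ h₁ h₂ _ _ _ ih =>
    refine Le.trans (.of_eq (ρ.dnStoup_fst Ψ _)) ?_
    exact CBPV.fst_le (ρ.compCast h₁) (ρ.compCast h₂) ih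
  | @snd _ _ _ _ _ _ _ _ _ Ψ h₁ h₂ _ _ _ ih =>
    refine Le.trans (.of_eq (ρ.dnStoup_snd Ψ _)) ?_
    exact CBPV.snd_le (ρ.compCast h₁) (ρ.compCast h₂) ih
  | upBound h => exact (ρ.subst_upSub_refl _ _).2
  | upBest h => exact (ρ.up_refl _ _).1
  | dnBound h => exact (ρ.dnStoup_refl _ _).1
  | dnBest h =>
    refine Le.trans (.of_eq (CBPV.Tm.fill_hole' _)) (.trans (.of_eq ?_) (ρ.dn_refl _ _).2)
    exact (CBPV.Tm.on_subst (ρ.dn h) .hole (ρ.upSub (.refl _))).symm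
  | retractF => exact ρ.sem_refl ((ρ.valCast_isEP (.dyn _)).retraction _).1
  | retractU => exact ρ.sem_refl ((ρ.compCast_isEP (.dynC _)).force _).1
  | betaEtaL h => exact ρ.sem_refl (ρ.tm_betaEta h).1
  | betaEtaR h => exact ρ.sem_refl (ρ.tm_betaEta h).2
  | errBot Φ h M' => exact .errBot _
  | stkStrict S => exact ρ.sem_refl (.trans (.of_eq (ρ.tm_fill S .err)) (.stkStrict _))

end
end DynInterp
end Gradual

theorem mainTheorem5 (ρ : Gradual.DynInterp) :
    (∀ (Γ Γ' : Gradual.GTT.Ctx) (Δ Δ' : Gradual.GTT.Stoup) (B B' : Gradual.GTT.CTy)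
      (Φ : Gradual.GTT.CtxDyn Γ Γ') (Ψ : Gradual.GTT.StoupDyn Δ Δ') (h : Gradual.GTT.Dyn B B')
      (M : Gradual.GTT.Tm Γ (.comp Δ B)) (M' : Gradual.GTT.Tm Γ' (.comp Δ' B')),
      Gradual.GTT.TmDyn Φ (.comp Ψ h) M M' →
      Gradual.CBPV.Le
        (ρ.dnStoup Ψ (ρ.tm M))
        ((ρ.dn h).on ((ρ.tm M').subst (ρ.upSub Φ)))) ∧
    (∀ (Γ Γ' : Gradual.GTT.Ctx) (A A' : Gradual.GTT.VTy)
      (Φ : Gradual.GTT.CtxDyn Γ Γ') (h : Gradual.GTT.Dyn A A')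
      (V : Gradual.GTT.Tm Γ (.val A)) (V' : Gradual.GTT.Tm Γ' (.val A')),
      Gradual.GTT.TmDyn Φ (.val h) V V' →
      Gradual.CBPV.Le
        ((ρ.up h).put (ρ.tm V))
        ((ρ.tm V').subst (ρ.upSub Φ))) :=
  ⟨fun _ _ _ _ _ _ _ _ _ _ _ h => ρ.graduality h, fun _ _ _ _ _ _ _ _ h => ρ.graduality h⟩
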